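/- Let $\Bbbk$ be a field (of arbitrary characteristic), let $n$ be a natural number, and let $S=\Bbbk[X_{i,j}]_{1\le i,j\le n}$ act on $R=\Bbbk[x_{i,j}]_{1\le i,j\le n}$ by contraction: $\star$ is the $\Bbbk$-bilinear action with $X^a\star x^b=x^{b-a}$ if $a\le b$ componentwise and $X^a\star x^b=0$ otherwise. For $f\in R$ let $f^\perp=\{g\in S: g\star f=0\}$ be its apolar ideal, and let $\operatorname{perm}_n,\det_n\in R$ be the permanent and the determinant of the generic matrix $(x_{i,j})$. For $f\in\{\operatorname{perm}_n,\det_n\}$ the $S$-module $S/f^\perp$ has a minimal graded free resolution $\cdots\to F_2\to F_1\to F_0\to S/f^\perp\to 0$ by finitely generated graded free modules $F_i=\bigoplus_{j\in\mathbb Z}S(-j)^{\beta_{i,j}}$; the $\beta_{i,j}$ are the graded Betti numbers. A relation is an element of $\ker(F_1\to F_0)$; it is called linear (resp. quadratic) if all its coefficients with respect to the homogeneous basis of $F_1$ are homogeneous of degree $1$ (resp. $2$). **Proposition.** For $\operatorname{perm}_n^\perp$ (and any minimal graded free resolution of $S/\operatorname{perm}_n^\perp$): 1. The dimension of the $\Bbbk$-vector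 space of linear relations is $$\beta_{2,3}=4\binom{n+1}{3}\binom{n+2}{3}=\tfrac19 n^2(n+1)^2(n-1)(n+2).$$ 2. The dimension of the $\Bbbk$-vector space of quadratic relations modulo the subspace of those lying in the $S$-submodule generated by the linear relations is $$\beta_{2,4}=2\binom n2\binom n4=\tfrac1{24}n^2(n-1)^2(n-2)(n-3).$$ 3. $\beta_{2,j}=0$ for all $j\ne 3,4$. **Companion corollary.** If $\operatorname{char}\Bbbk\ne 2$, then for $\det_n^\perp$ (and any minimal graded free resolution of $S/\det_n^\perp$) one has $\beta_{2,j}=0$ for all $j\neq 3$. -/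

import Mathlib

open MvPolynomial

noncomputable section

/-! ### Contraction and apolar ideals

Both the ring of operators `S` and the ring of polynomials `R` acted upon are written as
`MvPolynomial σ k`. -/

section Apolarity

variable {σ k : Type*} [Field k]

/-- Contraction by the monomial with exponent vector `a`: on monomials, `X^b` is sent to
`X^(b - a)` if `a ≤ b` and to `0` otherwise. -/
def contractMonomial (a : σ →₀ ℕ) : MvPolynomial σ k →ₗ[k] MvPolynomial σ k where
  toFun f := f.divMonomial a
  map_add' f g := add_divMonomial f g a
  map_smul' c f := by
    ext m
    simp [coeff_divMonomial]

/-- The contraction action `g ⋆ f` ("differentiation without coefficients"), bilinear in the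
operator `g` and the polynomial `f`. -/
def contract : MvPolynomial σ k →ₗ[k] MvPolynomial σ k →ₗ[k] MvPolynomial σ k :=
  (basisMonomials σ k).constr k contractMonomial

/-- The value of the contraction action on two monomials. -/
theorem contract_monomial_monomial (a b : σ →₀ ℕ) (c e : k) [Decidable (a ≤ b)] :
    contract (monomial a c) (monomial b e) = if a ≤ b then monomial (b - a) (c * e) else 0 := by
  have h : (monomial a c : MvPolynomial σ k) = c • basisMonomials σ k a := by
    simp [smul_monomial]
  rw [h, contract, map_smul, Module.Basis.constr_basis]
  classical
  ext m
  by_cases hab : a ≤ b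
  · have : b = a + m ↔ b - a = m := by
      constructor
      · rintro rfl; simp
      · rintro rfl; exact (add_tsub_cancel_of_le hab).symm
    simp [contractMonomial, coeff_divMonomial, hab, coeff_monomial, this]
  · have : b ≠ a + m := fun h => hab (h ▸ le_self_add)
    simp [contractMonomial, coeff_divMonomial, hab, coeff_monomial, this]

/-- Contraction makes `R` an `S`-module. -/
theorem contract_mul (g h f : MvPolynomial σ k) :
    contract (g * h) f = contract g (contract h f) := by
  classical
  induction g using MvPolynomial.induction_on' with
  | add p q hp hq => simp only [add_mul, map_add, LinearMap.add_apply, hp, hq]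
  | monomial a c =>
    induction h using MvPolynomial.induction_on' with
    | add p q hp hq => simp only [mul_add, map_add, LinearMap.add_apply, hp, hq]
    | monomial b e =>
      have key : ∀ (u : σ →₀ ℕ) (r : k) (x : MvPolynomial σ k),
          contract (monomial u r) x = r • x.divMonomial u := by
        intro u r x
        have h : (monomial u r : MvPolynomial σ k) = r • basisMonomials σ k u := by
          simp [smul_monomial]
        rw [h, contract, map_smul, Module.Basis.constr_basis]
        rfl
      rw [monomial_mul, key, key, key, add_comm a b, divMonomial_add]
      ext m
      simp [coeff_divMonomial, mul_assoc]

/-- The apolar ideal `f^⊥ = {g | g ⋆ f = 0}`. -/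
def apolarIdeal (f : MvPolynomial σ k) : Ideal (MvPolynomial σ k) where
  carrier := {g | contract g f = 0}
  zero_mem' := by simp
  add_mem' {g h} hg hh := by
    simp only [Set.mem_ofPred_eq] at *
    rw [map_add, LinearMap.add_apply, hg, hh, add_zero]
  smul_mem' c g hg := by
    simp only [Set.mem_ofPred_eq, smul_eq_mul] at *
    rw [contract_mul, hg, map_zero]

end Apolarity

/-- The permanent of the generic `n × n` matrix. -/
def genericPerm (k : Type*) [Field k] (n : ℕ) : MvPolynomial (Fin n × Fin n) k :=
  (Matrix.mvPolynomialX (Fin n) (Fin n) k).permanent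

/-- The determinant of the generic `n × n` matrix. -/
def genericDet (k : Type*) [Field k] (n : ℕ) : MvPolynomial (Fin n × Fin n) k :=
  (Matrix.mvPolynomialX (Fin n) (Fin n) k).det

/-! ### Minimal graded free resolutions -/

section Resolution

variable {σ k : Type*} [Field k]

/-- `p` is homogeneous of the (possibly negative) integer degree `e` for the standard grading.
For `e < 0` this means `p = 0`. -/
def IsHomogeneousOfIntDegree (p : MvPolynomial σ k) (e : ℤ) : Prop :=
  ∀ a ∈ p.support, (a.degree : ℤ) = e

/-- A minimal graded free resolution
`⋯ → F₂ → F₁ → F₀ → S / I → 0` of `S / I` over `S = k[X_s : s ∈ σ]`, with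
`F_i = ⨁_b S(-deg i b)`, the sum over `b : Fin (rank i)`.  The standard basis vector of `F_i`
indexed by `b` is homogeneous of degree `deg i b`. -/
structure MinimalGradedFreeResolution (I : Ideal (MvPolynomial σ k)) where
  /-- the rank of `F_i` -/
  rank : ℕ → ℕ
  /-- the degrees of the basis vectors of `F_i` -/
  deg : ∀ i, Fin (rank i) → ℤ
  /-- the differential `F_{i+1} → F_i` -/
  d : ∀ i, (Fin (rank (i + 1)) → MvPolynomial σ k) →ₗ[MvPolynomial σ k]
    (Fin (rank i) → MvPolynomial σ k)
  /-- the augmentation `F_0 → S / I` -/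
  aug : (Fin (rank 0) → MvPolynomial σ k) →ₗ[MvPolynomial σ k] MvPolynomial σ k ⧸ I
  /-- the differentials preserve degrees -/
  d_graded : ∀ i b a,
    IsHomogeneousOfIntDegree (d i (Pi.single b 1) a) (deg (i + 1) b - deg i a)
  /-- the augmentation preserves degrees -/
  aug_graded : ∀ a, ∃ p : MvPolynomial σ k,
    IsHomogeneousOfIntDegree p (deg 0 a) ∧ aug (Pi.single a 1) = Ideal.Quotient.mk I p
  aug_surjective : Function.Surjective aug
  exact_aug : Function.Exact (d 0) aug
  exact_d : ∀ i, Function.Exact (d (i + 1)) (d i)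
  /-- minimality: the image of `F_{i+1} → F_i` lies in `𝔪 F_i`, where `𝔪` is the ideal generated
  by the variables, that is, the polynomials with constant coefficient zero -/
  minimal : ∀ i v a, constantCoeff (d i v a) = 0

namespace MinimalGradedFreeResolution

variable {I : Ideal (MvPolynomial σ k)} (F : MinimalGradedFreeResolution I)

/-- The graded Betti number `β_{i,j}`: the number of summands `S(-j)` of `F_i`. -/
def betti (i : ℕ) (j : ℤ) : ℕ :=
  Nat.card {b : Fin (F.rank i) // F.deg i b = j}

/-- The relations between the chosen minimal generators of `I` (the kernel of `F₁ → F₀`) all of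
whose coefficients are homogeneous of degree `m`: linear relations for `m = 1`, quadratic
relations for `m = 2`. -/
def relations (m : ℕ) : Submodule k (Fin (F.rank 1) → MvPolynomial σ k) where
  carrier := {v | F.d 0 v = 0 ∧ ∀ a, (v a).IsHomogeneous m}
  zero_mem' := ⟨map_zero _, fun _ => isHomogeneous_zero _ _ _⟩
  add_mem' {v w} hv hw := ⟨by rw [map_add, hv.1, hw.1, add_zero],
    fun a => (hv.2 a).add (hw.2 a)⟩
  smul_mem' c v hv := by
    refine ⟨?_, fun a => ?_⟩
    · have : c • v = (C c : MvPolynomial σ k) • v := by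
        ext1 a
        simp [smul_eq_C_mul]
      rw [this, map_smul, hv.1, smul_zero]
    · rw [Pi.smul_apply, smul_eq_C_mul]
      simpa using (isHomogeneous_C σ c).mul (hv.2 a)

/-- The quadratic relations lying in the `S`-submodule of `F₁` generated by the linear relations,
as a subspace of the space of quadratic relations. -/
def quadraticFromLinear : Submodule k (F.relations 2) :=
  ((Submodule.span (MvPolynomial σ k)
      (F.relations 1 : Set (Fin (F.rank 1) → MvPolynomial σ k))).restrictScalars k).comap
    (F.relations 2).subtype

end MinimalGradedFreeResolution

end Resolution

end

noncomputable section

/-! ### Rook boards -/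

section Board

variable {α β : Type*} [DecidableEq α] [DecidableEq β] {M : Type*}

/-! Write `I` for the apolar ideal. The quotient `S / I` has a basis `[A, B]` indexed by sets of
rows and columns with `|A| = |B|`. The variable of a cell `(r, q)` sends `[A, B]` to `± [A ∪ {r}, B
∪ {q}]` if `r ∉ A` and `q ∉ B`, and to zero otherwise. This is all that is used about the permanent
and the determinant (`MinorSystem`, `immanantMinorSystem`): for the permanent every sign is `1`,
while for the determinant exchanging two columns changes the sign.

The numbers `β_{2,j}` are then computed by Koszul cohomology of this module. Let a functional `θ` on
relations with coefficients of degree `p + 1` kill the multiples of relations of degree `p`. Lifting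
elements of `I` to `F₁` turns `θ` into an alternating 2-cocycle on the degree `p + 1` part of `S /
I`. If the cocycle is a coboundary, then `θ` vanishes on all relations of degree `p + 1`, so there
are no new ones (`QuadricPresentation.functional_eq_zero`). The same argument one cohomological
degree lower shows that quadrics generate `I` (`MinorSystem.mem_span_X_mul`).

Cocycles are integrated combinatorially in `IsTwoCocycle.exists_coboundary`. The values on two
blocked cells vanish. If one cell is blocked, the value of the primitive is forced, and it is well
defined because a function that agrees on non-attacking cells of a large enough board is constant.
On two free non-attacking cells a potential is needed, which exists because 1-cocycles on the
chessboard complex of a board with at least four rows and columns are coboundaries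
(`board_potential`).

The argument fails only for `p = 1`, in multidegrees that are 2 on two rows and 1 on four columns,
or the transpose. There the cocycle identity lets a column index move at the cost of a sign. For the
permanent, one value determines all the others in such a multidegree. An explicit relation and a
functional given by sums of coefficients show that it really contributes one class
(`HasExceptionalType.exists_separating`), so that counting labels gives `β_{2,4}`. For the
determinant, cycling three columns returns the value with sign `-1`, so it is zero if 2 is
invertible. Finally `β_{2,3}` follows from the Hilbert function `dim (S / I)_d = binom(n, d) ^ 2`.

Existence of resolutions is independent of this: minimal covers of graded submodules are iterated.
-/

theorem Finset.exists_mem_ne_ne {R : Finset α} (h : 3 ≤ R.card) (a b : α) :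
    ∃ x ∈ R, x ≠ a ∧ x ≠ b := by
  have : ({a, b} : Finset α).card < R.card := (Finset.card_le_two).trans_lt h
  obtain ⟨x, hx, hx'⟩ := Finset.exists_mem_notMem_of_card_lt_card this
  refine ⟨x, hx, ?_⟩
  simpa using hx'

theorem Finset.exists_mem_ne_ne_ne {R : Finset α} (h : 4 ≤ R.card) (a b c : α) :
    ∃ x ∈ R, x ≠ a ∧ x ≠ b ∧ x ≠ c := by
  have : ({a, b, c} : Finset α).card < R.card := (Finset.card_le_three).trans_lt h
  obtain ⟨x, hx, hx'⟩ := Finset.exists_mem_notMem_of_card_lt_card this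
  refine ⟨x, hx, ?_⟩
  simpa using hx'

/-- A function on a board of size at least `2 × 3` that takes equal values on any two cells in
different rows and columns is constant. -/
theorem board_const {R : Finset α} {Q : Finset β} (hR : 2 ≤ R.card) (hQ : 3 ≤ Q.card)
    (g : α → β → M)
    (hg : ∀ r ∈ R, ∀ q ∈ Q, ∀ r' ∈ R, ∀ q' ∈ Q, r ≠ r' → q ≠ q' → g r q = g r' q') :
    ∀ r ∈ R, ∀ q ∈ Q, ∀ r' ∈ R, ∀ q' ∈ Q, g r q = g r' q' := by
  have same_row : ∀ r ∈ R, ∀ q ∈ Q, ∀ q' ∈ Q, g r q = g r q' := by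
    intro r hr q hq q' hq'
    -- Two cells of one row are compared through a cell in another row and a third column, which
    -- attacks neither.
    obtain ⟨r₂, hr₂, hne⟩ := Finset.exists_mem_ne hR r
    obtain ⟨q₂, hq₂, h1, h2⟩ := Finset.exists_mem_ne_ne hQ q q'
    rw [hg r hr q hq r₂ hr₂ q₂ hq₂ hne.symm h1.symm, hg r₂ hr₂ q₂ hq₂ r hr q' hq' hne h2]
  intro r hr q hq r' hr' q' hq'
  by_cases h : r = r'
  · subst h; exact same_row r hr q hq q' hq'
  · obtain ⟨q₂, hq₂, h1, -⟩ := Finset.exists_mem_ne_ne hQ q q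
    rw [hg r hr q hq r' hr' q₂ hq₂ h h1.symm, same_row r' hr' q₂ hq₂ q' hq']

theorem board_const' {R : Finset α} {Q : Finset β} (hR : 3 ≤ R.card) (hQ : 2 ≤ Q.card)
    (g : α → β → M)
    (hg : ∀ r ∈ R, ∀ q ∈ Q, ∀ r' ∈ R, ∀ q' ∈ Q, r ≠ r' → q ≠ q' → g r q = g r' q') :
    ∀ r ∈ R, ∀ q ∈ Q, ∀ r' ∈ R, ∀ q' ∈ Q, g r q = g r' q' :=
  fun r hr q hq r' hr' q' hq' => board_const hQ hR (fun q r => g r q)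
    (fun q hq r hr q' hq' r' hr' h h' => hg r hr q hq r' hr' q' hq' h' h) q hq r hr q' hq' r' hr'

/-- `1`-cocycles on the chessboard complex of a board of size at least `4 × 4` are
coboundaries. -/
theorem board_potential [AddCommGroup M] {R : Finset α} {Q : Finset β}
    (hR : 4 ≤ R.card) (hQ : 4 ≤ Q.card) (h : α × β → α × β → M)
    (anti : ∀ s t, h s t = - h t s)
    (cocycle : ∀ s ∈ R ×ˢ Q, ∀ t ∈ R ×ˢ Q, ∀ u ∈ R ×ˢ Q, s.1 ≠ t.1 → s.2 ≠ t.2 → s.1 ≠ u.1 →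
      s.2 ≠ u.2 → t.1 ≠ u.1 → t.2 ≠ u.2 → h s t = h s u + h u t) :
    ∃ φ : α × β → M, ∀ s ∈ R ×ˢ Q, ∀ t ∈ R ×ˢ Q, s.1 ≠ t.1 → s.2 ≠ t.2 →
      h s t = φ s - φ t := by
  obtain ⟨r₀, hr₀⟩ : R.Nonempty := Finset.card_pos.1 (by omega)
  obtain ⟨q₀, hq₀⟩ : Q.Nonempty := Finset.card_pos.1 (by omega)
  set o : α × β := (r₀, q₀) with ho
  have hoRQ : o ∈ R ×ˢ Q := Finset.mk_mem_product hr₀ hq₀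
  -- The potential should be `φ t = h t o`, but `h` is meaningful only on non-attacking pairs. The
  -- value is therefore computed along a path `t, u, o` with `u` attacking neither end, and must be
  -- shown independent of `u`.
  have key : ∀ t : α × β, ∃ v : M, t ∈ R ×ˢ Q → ∀ u ∈ R ×ˢ Q, u.1 ≠ r₀ → u.2 ≠ q₀ → u.1 ≠ t.1 →
      u.2 ≠ t.2 → v = h t u + h u o := by
    intro t
    have step : t ∈ R ×ˢ Q → ∀ u ∈ R ×ˢ Q, ∀ u' ∈ R ×ˢ Q, u.1 ≠ r₀ → u.2 ≠ q₀ → u.1 ≠ t.1 →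
      u.2 ≠ t.2 → u'.1 ≠ r₀ → u'.2 ≠ q₀ → u'.1 ≠ t.1 → u'.2 ≠ t.2 → u.1 ≠ u'.1 → u.2 ≠ u'.2 →
      h t u + h u o = h t u' + h u' o := by
      intro ht u hu u' hu' h1 h2 h3 h4 h1' h2' h3' h4' h5 h6
      rw [cocycle t ht u hu u' hu' h3.symm h4.symm h3'.symm h4'.symm h5 h6,
        cocycle u' hu' o hoRQ u hu h1' h2' h5.symm h6.symm (Ne.symm h1) (Ne.symm h2)]
      abel
    by_cases ht : t ∈ R ×ˢ Q
    swap
    · exact ⟨0, fun h => absurd h ht⟩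
    -- If `t` lies in the row of `o`, the admissible `u` avoid one row and at most two columns. At
    -- least a `3 × 2` board remains, so agreement on non-attacking choices of `u` suffices. The
    -- column case is the transpose, and if `t` does not attack `o` the cocycle identity gives `h t
    -- o` directly.
    by_cases h1 : t.1 = r₀
    · have c1 : 3 ≤ (R.erase r₀).card := by rw [Finset.card_erase_of_mem hr₀]; omega
      have c2 : 2 ≤ ((Q.erase q₀).erase t.2).card := by
        have := Finset.pred_card_le_card_erase (s := Q) (a := q₀)
        have := Finset.pred_card_le_card_erase (s := Q.erase q₀) (a := t.2)
        omega
      have cst := board_const' c1 c2 (fun r q => h t (r, q) + h (r, q) o) (by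
        intro r hr q hq r' hr' q' hq' hne hne'
        simp only [Finset.mem_erase] at hr hq hr' hq'
        exact step ht (r, q) (Finset.mk_mem_product hr.2 hq.2.2) (r', q')
          (Finset.mk_mem_product hr'.2 hq'.2.2) hr.1 hq.2.1 (by simpa [h1] using hr.1) hq.1 hr'.1
          hq'.2.1 (by simpa [h1] using hr'.1) hq'.1 hne hne')
      obtain ⟨r, hr⟩ : (R.erase r₀).Nonempty := Finset.card_pos.1 (by omega)
      obtain ⟨q, hq⟩ : ((Q.erase q₀).erase t.2).Nonempty := Finset.card_pos.1 (by omega)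
      refine ⟨_, fun _ u hu a1 a2 a3 a4 => cst r hr q hq u.1 ?_ u.2 ?_⟩
      · rw [Finset.mem_product] at hu; simp [hu.1, a1]
      · rw [Finset.mem_product] at hu; simp [hu.2, a2, a4]
    by_cases h2 : t.2 = q₀
    · have c1 : 3 ≤ (Q.erase q₀).card := by rw [Finset.card_erase_of_mem hq₀]; omega
      have c2 : 2 ≤ ((R.erase r₀).erase t.1).card := by
        have := Finset.pred_card_le_card_erase (s := R) (a := r₀)
        have := Finset.pred_card_le_card_erase (s := R.erase r₀) (a := t.1)
        omega
      have cst := board_const c2 c1 (fun r q => h t (r, q) + h (r, q) o) (by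
        intro r hr q hq r' hr' q' hq' hne hne'
        simp only [Finset.mem_erase] at hr hq hr' hq'
        exact step ht (r, q) (Finset.mk_mem_product hr.2.2 hq.2) (r', q')
          (Finset.mk_mem_product hr'.2.2 hq'.2) hr.2.1 hq.1 hr.1 (by simpa [h2] using hq.1) hr'.2.1
          hq'.1 hr'.1 (by simpa [h2] using hq'.1) hne hne')
      obtain ⟨q, hq⟩ : (Q.erase q₀).Nonempty := Finset.card_pos.1 (by omega)
      obtain ⟨r, hr⟩ : ((R.erase r₀).erase t.1).Nonempty := Finset.card_pos.1 (by omega)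
      refine ⟨_, fun _ u hu a1 a2 a3 a4 => cst r hr q hq u.1 ?_ u.2 ?_⟩
      · rw [Finset.mem_product] at hu; simp [hu.1, a1, a3]
      · rw [Finset.mem_product] at hu; simp [hu.2, a2]
    exact ⟨h t o, fun _ u hu a1 a2 a3 a4 => cocycle t ht o hoRQ u hu h1 h2 a3.symm a4.symm
      (Ne.symm a1) (Ne.symm a2)⟩
  choose φ hφ using key
  refine ⟨φ, fun s hs t ht h1 h2 => ?_⟩
  -- One cell attacking none of `o`, `s`, `t` computes both potentials at once; this takes four rows
  -- and four columns.
  obtain ⟨r, hr, a1, a2, a3⟩ := Finset.exists_mem_ne_ne_ne hR r₀ s.1 t.1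
  obtain ⟨q, hq, b1, b2, b3⟩ := Finset.exists_mem_ne_ne_ne hQ q₀ s.2 t.2
  have hu : (r, q) ∈ R ×ˢ Q := Finset.mk_mem_product hr hq
  rw [hφ s hs (r, q) hu a1 b1 a2 b2, hφ t ht (r, q) hu a1 b1 a3 b3,
    cocycle s hs t ht (r, q) hu h1 h2 a2.symm b2.symm a3.symm b3.symm, anti (r, q) t]
  abel

end Board

/-! ### Cocycles on partial matchings -/

section Matching

variable {α β k : Type*} [DecidableEq α] [DecidableEq β] [Field k]

/-- A cell is blocked by the rows `A` and the columns `B` if it lies in one of them. -/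
abbrev Blocked (s : α × β) (A : Finset α) (B : Finset β) : Prop := s.1 ∈ A ∨ s.2 ∈ B

/-- Structure constants `±1` of a commutative action of the cells on pairs of sets of rows and
columns of the same size. -/
structure IsSignSystem (c : α × β → Finset α → Finset β → k) : Prop where
  sq : ∀ u A B, A.card = B.card → ¬ Blocked u A B → c u A B * c u A B = 1
  comm : ∀ t u A B, A.card = B.card → ¬ Blocked t A B → ¬ Blocked u A B → t.1 ≠ u.1 → t.2 ≠ u.2 →
    c u A B * c t (insert u.1 A) (insert u.2 B) = c t A B * c u (insert t.1 A) (insert t.2 B)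

/-- The transpose of multiplication by the cell `u`, on functions of pairs of sets. -/
def pull (c : α × β → Finset α → Finset β → k) (f : Finset α → Finset β → k) (u : α × β)
    (A : Finset α) (B : Finset β) : k :=
  if Blocked u A B then 0 else c u A B * f (insert u.1 A) (insert u.2 B)

theorem pull_of_blocked {c : α × β → Finset α → Finset β → k} {f : Finset α → Finset β → k}
    {u : α × β} {A : Finset α} {B : Finset β} (h : Blocked u A B) : pull c f u A B = 0 :=
  if_pos h

theorem pull_of_not_blocked {c : α × β → Finset α → Finset β → k} {f : Finset α → Finset β → k}
    {u : α × β} {A : Finset α} {B : Finset β} (h : ¬ Blocked u A B) :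
    pull c f u A B = c u A B * f (insert u.1 A) (insert u.2 B) :=
  if_neg h

theorem pull_erase {c : α × β → Finset α → Finset β → k} {f : Finset α → Finset β → k}
    {A : Finset α} {B : Finset β} {z : α} {q : β} (hz : z ∈ A) (hq : q ∈ B) :
    pull c f (z, q) (A.erase z) (B.erase q) = c (z, q) (A.erase z) (B.erase q) * f A B := by
  rw [pull_of_not_blocked (by simp [Blocked])]
  simp [Finset.insert_erase hz, Finset.insert_erase hq]

/-- Alternating `2`-cocycles in the Koszul complex of partial matchings. -/
structure IsTwoCocycle (c : α × β → Finset α → Finset β → k) (p : ℕ)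
    (l : α × β → α × β → Finset α → Finset β → k) : Prop where
  self : ∀ s A B, l s s A B = 0
  skew : ∀ s t A B, l s t A B = - l t s A B
  cocycle : ∀ s t u A B, A.card = p → B.card = p →
    pull c (l s t) u A B - pull c (l s u) t A B + pull c (l t u) s A B = 0

/-- The cells `s`, `t` together with the sets `A`, `B` have the multidegree `(2, 2 | 1, 1, 1, 1)`
or its transpose. -/
def IsExceptional (s t : α × β) (A : Finset α) (B : Finset β) : Prop :=
  s.1 ≠ t.1 ∧ s.2 ≠ t.2 ∧ ((A = {s.1, t.1} ∧ s.2 ∉ B ∧ t.2 ∉ B) ∨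
    (B = {s.2, t.2} ∧ s.1 ∉ A ∧ t.1 ∉ A))

namespace IsTwoCocycle

variable {c : α × β → Finset α → Finset β → k} {p : ℕ}
  {l : α × β → α × β → Finset α → Finset β → k}

/-- Apply the cocycle identity to `s`, `t` and the cell `(z, q)` on the pair of sets with `z` and
`q` removed. As `s` and `t` are still blocked there, only a unit times `l s t A B` survives. -/
theorem eq_zero_of_blocked_erase (hc : IsSignSystem c) (hl : IsTwoCocycle c p l) {s t : α × β}
    {A : Finset α} {B : Finset β} (hA : A.card = p + 1) (hB : B.card = p + 1) {z : α} {q : β}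
    (hz : z ∈ A) (hq : q ∈ B) (hs : Blocked s (A.erase z) (B.erase q))
    (ht : Blocked t (A.erase z) (B.erase q)) : l s t A B = 0 := by
  have cA : (A.erase z).card = p := by rw [Finset.card_erase_of_mem hz]; omega
  have cB : (B.erase q).card = p := by rw [Finset.card_erase_of_mem hq]; omega
  have h := hl.cocycle s t (z, q) _ _ cA cB
  rw [pull_of_blocked hs, pull_of_blocked ht, pull_erase hz hq] at h
  have h1 := hc.sq (z, q) _ _ (cA.trans cB.symm) (by simp [Blocked])
  have h2 : c (z, q) (A.erase z) (B.erase q) ≠ 0 := fun h0 => by simp [h0] at h1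
  simpa [h2] using h

/-- It suffices to remove a row and a column so that both cells stay blocked. A blocking line
survives the removal of any other line, so the only difficulty is that `A` or `B` consists exactly
of the two lines blocking `s` and `t`, which forces `p = 1`. Even then the value vanishes if a cell
is also blocked in the other direction, or if the cells share a line; the exceptional configuration
is what remains. -/
theorem eq_zero_of_blocked (hc : IsSignSystem c) (hl : IsTwoCocycle c p l) (hp : 1 ≤ p)
    (hexc : ∀ s t A B, p = 1 → A.card = 2 → B.card = 2 → IsExceptional s t A B → l s t A B = 0)
    {s t : α × β} {A : Finset α} {B : Finset β} (hA : A.card = p + 1) (hB : B.card = p + 1)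
    (hs : Blocked s A B) (ht : Blocked t A B) : l s t A B = 0 := by
  have mixed : ∀ (s t : α × β) (A : Finset α) (B : Finset β), A.card = p + 1 → B.card = p + 1 →
      s.1 ∈ A → t.2 ∈ B → l s t A B = 0 := by
    intro s t A B hA hB hs ht
    obtain ⟨z, hz, hz'⟩ := Finset.exists_mem_ne (s := A) (by omega) s.1
    obtain ⟨q, hq, hq'⟩ := Finset.exists_mem_ne (s := B) (by omega) t.2
    exact eq_zero_of_blocked_erase hc hl hA hB hz hq
      (Or.inl (Finset.mem_erase.2 ⟨hz'.symm, hs⟩)) (Or.inr (Finset.mem_erase.2 ⟨hq'.symm, ht⟩))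
  have nz : ∀ (z : α) (q : β) (A : Finset α) (B : Finset β), A.card = p + 1 → B.card = p + 1 →
      z ∈ A → q ∈ B → c (z, q) (A.erase z) (B.erase q) ≠ 0 := by
    intro z q A B hA hB hz hq h0
    have h1 := hc.sq (z, q) (A.erase z) (B.erase q) (by
      rw [Finset.card_erase_of_mem hz, Finset.card_erase_of_mem hq, hA, hB]) (by simp [Blocked])
    simp [h0] at h1
  rcases hs with hs | hs <;> rcases ht with ht | ht
  · by_cases hz : ∃ z ∈ A, z ≠ s.1 ∧ z ≠ t.1
    · obtain ⟨z, hz, h1, h2⟩ := hz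
      obtain ⟨q, hq⟩ : B.Nonempty := Finset.card_pos.1 (by omega)
      exact eq_zero_of_blocked_erase hc hl hA hB hz hq
        (Or.inl (Finset.mem_erase.2 ⟨h1.symm, hs⟩)) (Or.inl (Finset.mem_erase.2 ⟨h2.symm, ht⟩))
    push Not at hz
    have hA2 : A = {s.1, t.1} := by
      ext x
      simp only [Finset.mem_insert, Finset.mem_singleton]
      exact ⟨fun hx => or_iff_not_imp_left.2 (hz x hx), by rintro (rfl | rfl) <;> assumption⟩
    have hne : s.1 ≠ t.1 := fun h => by rw [hA2, h] at hA; simp at hA; omega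
    have hp1 : p = 1 := by rw [hA2, Finset.card_pair hne] at hA; omega
    by_cases hsB : s.2 ∈ B
    · rw [hl.skew, mixed t s A B hA hB ht hsB, neg_zero]
    by_cases htB : t.2 ∈ B
    · exact mixed s t A B hA hB hs htB
    by_cases hst : s.2 = t.2
    swap
    · exact hexc s t A B hp1 (by omega) (by omega) ⟨hne, hst, Or.inl ⟨hA2, hsB, htB⟩⟩
    -- The cells share a column. After removal of `s.1` and `q` the cell `t` is still blocked, and
    -- in the term where `s` is multiplied back the column of `t` becomes occupied, so `mixed` kills
    -- that term.
    obtain ⟨q, hq⟩ : B.Nonempty := Finset.card_pos.1 (by omega)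
    have cA : (A.erase s.1).card = p := by rw [Finset.card_erase_of_mem hs]; omega
    have cB : (B.erase q).card = p := by rw [Finset.card_erase_of_mem hq]; omega
    have h := hl.cocycle s t (s.1, q) _ _ cA cB
    have hsB' : s.2 ∉ B.erase q := fun h => hsB (Finset.mem_of_mem_erase h)
    rw [pull_erase hs hq, pull_of_blocked (u := t) (Or.inl (Finset.mem_erase.2 ⟨hne.symm, ht⟩)),
      pull_of_not_blocked (u := s) (by simp [Blocked, hsB']), Finset.insert_erase hs, hl.skew t,
      mixed (s.1, q) t A _ hA (by rw [Finset.card_insert_of_notMem hsB', cB]) hs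
        (by simp [hst])] at h
    simpa [nz _ _ A B hA hB hs hq] using h
  · exact mixed s t A B hA hB hs ht
  · rw [hl.skew, mixed t s A B hA hB ht hs, neg_zero]
  · by_cases hz : ∃ z ∈ B, z ≠ s.2 ∧ z ≠ t.2
    · obtain ⟨z, hz, h1, h2⟩ := hz
      obtain ⟨q, hq⟩ : A.Nonempty := Finset.card_pos.1 (by omega)
      exact eq_zero_of_blocked_erase hc hl hA hB hq hz
        (Or.inr (Finset.mem_erase.2 ⟨h1.symm, hs⟩)) (Or.inr (Finset.mem_erase.2 ⟨h2.symm, ht⟩))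
    push Not at hz
    have hB2 : B = {s.2, t.2} := by
      ext x
      simp only [Finset.mem_insert, Finset.mem_singleton]
      exact ⟨fun hx => or_iff_not_imp_left.2 (hz x hx), by rintro (rfl | rfl) <;> assumption⟩
    have hne : s.2 ≠ t.2 := fun h => by rw [hB2, h] at hB; simp at hB; omega
    have hp1 : p = 1 := by rw [hB2, Finset.card_pair hne] at hB; omega
    by_cases hsA : s.1 ∈ A
    · exact mixed s t A B hA hB hsA ht
    by_cases htA : t.1 ∈ A
    · rw [hl.skew, mixed t s A B hA hB htA hs, neg_zero]
    by_cases hst : s.1 = t.1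
    swap
    · exact hexc s t A B hp1 (by omega) (by omega) ⟨hst, hne, Or.inr ⟨hB2, hsA, htA⟩⟩
    obtain ⟨q, hq⟩ : A.Nonempty := Finset.card_pos.1 (by omega)
    have cB : (B.erase s.2).card = p := by rw [Finset.card_erase_of_mem hs]; omega
    have cA : (A.erase q).card = p := by rw [Finset.card_erase_of_mem hq]; omega
    have h := hl.cocycle s t (q, s.2) _ _ cA cB
    have hsA' : s.1 ∉ A.erase q := fun h => hsA (Finset.mem_of_mem_erase h)
    rw [pull_erase hq hs, pull_of_blocked (u := t) (Or.inr (Finset.mem_erase.2 ⟨hne.symm, ht⟩)),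
      pull_of_not_blocked (u := s) (by simp [Blocked, hsA']), Finset.insert_erase hs,
      mixed t (q, s.2) _ B (by rw [Finset.card_insert_of_notMem hsA', cA]) hB
        (by simp [hst]) hs] at h
    simpa [nz _ _ A B hA hB hq hs] using h

/-- The value of `g(t) = c(t, w) λ(s, t; w)`, `t w = (A, B)`, for a cell `s` blocked by `w`, does
not depend on `t`: the case of non-attacking cells. -/
theorem eq_of_nonattacking (hc : IsSignSystem c) (hl : IsTwoCocycle c p l) (hp : 1 ≤ p)
    (hexc : ∀ s t A B, p = 1 → A.card = 2 → B.card = 2 → IsExceptional s t A B → l s t A B = 0)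
    {s t u : α × β} {A : Finset α} {B : Finset β} (hA : A.card = p + 2) (hB : B.card = p + 2)
    (ht₁ : t.1 ∈ A) (ht₂ : t.2 ∈ B) (hu₁ : u.1 ∈ A) (hu₂ : u.2 ∈ B) (h₁ : t.1 ≠ u.1)
    (h₂ : t.2 ≠ u.2) (hst : Blocked s (A.erase t.1) (B.erase t.2))
    (hsu : Blocked s (A.erase u.1) (B.erase u.2)) :
    c t (A.erase t.1) (B.erase t.2) * l s t (A.erase t.1) (B.erase t.2) =
      c u (A.erase u.1) (B.erase u.2) * l s u (A.erase u.1) (B.erase u.2) := by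
  set A' := (A.erase t.1).erase u.1 with hA'
  set B' := (B.erase t.2).erase u.2 with hB'
  have huA : u.1 ∈ A.erase t.1 := Finset.mem_erase.2 ⟨h₁.symm, hu₁⟩
  have huB : u.2 ∈ B.erase t.2 := Finset.mem_erase.2 ⟨h₂.symm, hu₂⟩
  have e1 : insert u.1 A' = A.erase t.1 := Finset.insert_erase huA
  have e2 : insert u.2 B' = B.erase t.2 := Finset.insert_erase huB
  have e3 : insert t.1 A' = A.erase u.1 := by
    rw [hA', Finset.erase_right_comm, Finset.insert_erase (Finset.mem_erase.2 ⟨h₁, ht₁⟩)]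
  have e4 : insert t.2 B' = B.erase u.2 := by
    rw [hB', Finset.erase_right_comm, Finset.insert_erase (Finset.mem_erase.2 ⟨h₂, ht₂⟩)]
  have cA : A'.card = p := by
    rw [Finset.card_erase_of_mem huA, Finset.card_erase_of_mem ht₁]; omega
  have cB : B'.card = p := by
    rw [Finset.card_erase_of_mem huB, Finset.card_erase_of_mem ht₂]; omega
  have bt : ¬ Blocked t A' B' := by simp [Blocked, hA', hB']
  have bu : ¬ Blocked u A' B' := by simp [Blocked, hA', hB']
  have h := hl.cocycle s t u A' B' cA cB
  -- If `s` is free on `A'`, `B'` but becomes blocked on adding either `t` or `u`, then it attacks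
  -- both. Hence adding `s` blocks `t` and `u`, and the value there is zero.
  have h0 : pull c (l t u) s A' B' = 0 := by
    by_cases hs : Blocked s A' B'
    · exact pull_of_blocked hs
    have hs' := hs
    simp only [Blocked, not_or] at hs
    rw [← e1, ← e2] at hst
    rw [← e3, ← e4] at hsu
    simp only [Blocked, Finset.mem_insert, hs.1, hs.2, or_false] at hst hsu
    rw [pull_of_not_blocked hs', eq_zero_of_blocked hc hl hp hexc
      (by rw [Finset.card_insert_of_notMem hs.1, cA])
      (by rw [Finset.card_insert_of_notMem hs.2, cB]), mul_zero]
    · rcases hsu with hsu | hsu <;> simp [Blocked, hsu]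
    · rcases hst with hst | hst <;> simp [Blocked, hst]
  rw [h0, pull_of_not_blocked bt, pull_of_not_blocked bu, e1, e2, e3, e4] at h
  have hcomm := hc.comm t u A' B' (cA.trans cB.symm) bt bu h₁ h₂
  rw [e1, e2, e3, e4] at hcomm
  have s1 := hc.sq t A' B' (cA.trans cB.symm) bt
  have s2 := hc.sq u A' B' (cA.trans cB.symm) bu
  have hst' : c u A' B' * l s t (A.erase t.1) (B.erase t.2) =
      c t A' B' * l s u (A.erase u.1) (B.erase u.2) := by linear_combination h
  linear_combination (-c t (A.erase t.1) (B.erase t.2) * l s t (A.erase t.1) (B.erase t.2)) * s2 +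
    c u A' B' * l s t (A.erase t.1) (B.erase t.2) * hcomm +
    c t A' B' * c u (A.erase u.1) (B.erase u.2) * hst' +
    (c u (A.erase u.1) (B.erase u.2) * l s u (A.erase u.1) (B.erase u.2)) * s1

/-- If the row of `s` is in `A`, the cells of `A × B` off that row form a board of at least `2 × 3`
cells, and removing any of them leaves `s` blocked. The restriction to non-attacking cells is
therefore lifted by `board_const`. Columns are treated symmetrically. -/
theorem eq_of_blocked (hc : IsSignSystem c) (hl : IsTwoCocycle c p l) (hp : 1 ≤ p)
    (hexc : ∀ s t A B, p = 1 → A.card = 2 → B.card = 2 → IsExceptional s t A B → l s t A B = 0)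
    {s t u : α × β} {A : Finset α} {B : Finset β} (hA : A.card = p + 2) (hB : B.card = p + 2)
    (ht₁ : t.1 ∈ A) (ht₂ : t.2 ∈ B) (hu₁ : u.1 ∈ A) (hu₂ : u.2 ∈ B)
    (hst : Blocked s (A.erase t.1) (B.erase t.2)) (hsu : Blocked s (A.erase u.1) (B.erase u.2)) :
    c t (A.erase t.1) (B.erase t.2) * l s t (A.erase t.1) (B.erase t.2) =
      c u (A.erase u.1) (B.erase u.2) * l s u (A.erase u.1) (B.erase u.2) := by
  set g : α → β → k := fun r q =>
    c (r, q) (A.erase r) (B.erase q) * l s (r, q) (A.erase r) (B.erase q) with hg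
  have step := fun r q r' q' hr hq hr' hq' h1 h2 h3 h4 =>
    eq_of_nonattacking (s := s) (t := (r, q)) (u := (r', q')) hc hl hp hexc hA hB hr hq hr' hq' h1
      h2 h3 h4
  have rows : s.1 ∈ A → ∀ r ∈ A.erase s.1, ∀ q ∈ B, ∀ r' ∈ A.erase s.1, ∀ q' ∈ B,
      g r q = g r' q' := by
    intro hs
    refine board_const (by rw [Finset.card_erase_of_mem hs]; omega) (by omega) g ?_
    intro r hr q hq r' hr' q' hq' h h'
    simp only [Finset.mem_erase] at hr hr'
    exact step r q r' q' hr.2 hq hr'.2 hq' h h' (Or.inl (Finset.mem_erase.2 ⟨hr.1.symm, hs⟩))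
      (Or.inl (Finset.mem_erase.2 ⟨hr'.1.symm, hs⟩))
  have cols : s.2 ∈ B → ∀ r ∈ A, ∀ q ∈ B.erase s.2, ∀ r' ∈ A, ∀ q' ∈ B.erase s.2,
      g r q = g r' q' := by
    intro hs
    refine board_const' (by omega) (by rw [Finset.card_erase_of_mem hs]; omega) g ?_
    intro r hr q hq r' hr' q' hq' h h'
    simp only [Finset.mem_erase] at hq hq'
    exact step r q r' q' hr hq.2 hr' hq'.2 h h' (Or.inr (Finset.mem_erase.2 ⟨hq.1.symm, hs⟩))
      (Or.inr (Finset.mem_erase.2 ⟨hq'.1.symm, hs⟩))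
  change g t.1 t.2 = g u.1 u.2
  -- A cell off both lines of `s` belongs to both boards and links the two constants when `s` is
  -- blocked in both directions.
  obtain ⟨z, hz, hz'⟩ := Finset.exists_mem_ne (s := A) (by omega) s.1
  obtain ⟨q, hq, hq'⟩ := Finset.exists_mem_ne (s := B) (by omega) s.2
  have hzA : z ∈ A.erase s.1 := Finset.mem_erase.2 ⟨hz', hz⟩
  have hqB : q ∈ B.erase s.2 := Finset.mem_erase.2 ⟨hq', hq⟩
  have base : ∀ t : α × β, t.1 ∈ A → t.2 ∈ B → Blocked s (A.erase t.1) (B.erase t.2) →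
      g t.1 t.2 = g z q := by
    rintro t ht₁ ht₂ (h | h)
    · rw [Finset.mem_erase] at h
      exact rows h.2 _ (Finset.mem_erase.2 ⟨h.1.symm, ht₁⟩) _ ht₂ _ hzA _ hq
    · rw [Finset.mem_erase] at h
      exact cols h.2 _ ht₁ _ (Finset.mem_erase.2 ⟨h.1.symm, ht₂⟩) _ hz _ hqB
  rw [base t ht₁ ht₂ hst, base u hu₁ hu₂ hsu]

end IsTwoCocycle

end Matching

/-! ### Integrating cocycles on partial matchings -/

section Matching

variable {α β k : Type*} [DecidableEq α] [DecidableEq β] [Field k]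

namespace IsTwoCocycle

variable {c : α × β → Finset α → Finset β → k} {p : ℕ}
  {l : α × β → α × β → Finset α → Finset β → k}

/-- Weighting `l s t` with the constants of both cells removes the signs: the twisted identity
becomes `h s t = h s u + h u t`, the form needed for the chessboard complex. -/
theorem untwisted_cocycle (hc : IsSignSystem c) (hl : IsTwoCocycle c p l)
    {s t u : α × β} {A : Finset α} {B : Finset β} (hA : A.card = p) (hB : B.card = p)
    (hs : ¬ Blocked s A B) (ht : ¬ Blocked t A B) (hu : ¬ Blocked u A B)
    (hst₁ : s.1 ≠ t.1) (hst₂ : s.2 ≠ t.2) (hsu₁ : s.1 ≠ u.1) (hsu₂ : s.2 ≠ u.2)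
    (htu₁ : t.1 ≠ u.1) (htu₂ : t.2 ≠ u.2) :
    c s (insert t.1 (insert u.1 A)) (insert t.2 (insert u.2 B)) *
        c t (insert u.1 A) (insert u.2 B) * l s t (insert u.1 A) (insert u.2 B) =
      c s (insert t.1 (insert u.1 A)) (insert t.2 (insert u.2 B)) *
        c u (insert t.1 A) (insert t.2 B) * l s u (insert t.1 A) (insert t.2 B) +
      c u (insert s.1 (insert t.1 A)) (insert s.2 (insert t.2 B)) *
        c t (insert s.1 A) (insert s.2 B) * l u t (insert s.1 A) (insert s.2 B) := by
  have h := hl.cocycle s t u A B hA hB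
  rw [pull_of_not_blocked hs, pull_of_not_blocked ht, pull_of_not_blocked hu, hl.skew t u] at h
  have hAB := hA.trans hB.symm
  have c1 := hc.comm t u A B hAB ht hu htu₁ htu₂
  have c2 := hc.comm s t A B hAB hs ht hst₁ hst₂
  simp only [Blocked, not_or] at hs ht hu
  have c3 := hc.comm s u (insert t.1 A) (insert t.2 B)
    (by rw [Finset.card_insert_of_notMem ht.1, Finset.card_insert_of_notMem ht.2, hAB])
    (by simp [Blocked, hs, hst₁, hst₂]) (by simp [Blocked, hu, htu₁.symm, htu₂.symm]) hsu₁ hsu₂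
  rw [Finset.insert_comm u.1, Finset.insert_comm u.2] at c3
  have su := hc.sq u A B hAB (by simp [Blocked, hu])
  have st := hc.sq t A B hAB (by simp [Blocked, ht])
  have ss := hc.sq s A B hAB (by simp [Blocked, hs])
  generalize c u A B = cu at *
  generalize c t A B = ct at *
  generalize c s A B = cs at *
  generalize c s (insert t.1 (insert u.1 A)) (insert t.2 (insert u.2 B)) = cstu at *
  generalize c t (insert u.1 A) (insert u.2 B) = ctu at *
  generalize c u (insert t.1 A) (insert t.2 B) = cut at *
  generalize c u (insert s.1 (insert t.1 A)) (insert s.2 (insert t.2 B)) = cust at *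
  generalize c t (insert s.1 A) (insert s.2 B) = cts at *
  generalize c s (insert t.1 A) (insert t.2 B) = cst at *
  generalize l s t _ _ = x at *
  generalize l s u _ _ = y at *
  generalize l u t _ _ = z at *
  -- The three terms carry a common unit, the product of the constants along the path that adds `u`,
  -- then `t`, then `s`; commutation rewrites the other paths into this one.
  have e1 : cstu * ctu * x = cstu * ctu * cu * (cu * x) := by
    linear_combination (-cstu * ctu * x) * su
  have e2 : cstu * cut * y = cstu * ctu * cu * (ct * y) := by
    linear_combination (-cstu * cut * y) * st - cstu * ct * y * c1
  have e3 : cust * cts * z = cstu * ctu * cu * (cs * z) := by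
    linear_combination (-cust * cts * z) * ss - cstu * cs * z * c1 - cust * cs * z * c2 -
      ct * cs * z * c3
  rw [e1, e2, e3]
  linear_combination cstu * ctu * cu * h

theorem exists_potential (hc : IsSignSystem c) (hl : IsTwoCocycle c p l) (hp : 1 ≤ p)
    {A : Finset α} {B : Finset β} (hA : A.card = p + 3) (hB : B.card = p + 3) :
    ∃ φ : α × β → k, ∀ s ∈ A ×ˢ B, ∀ t ∈ A ×ˢ B, s.1 ≠ t.1 → s.2 ≠ t.2 →
      c s (A.erase s.1) (B.erase s.2) *
        c t ((A.erase s.1).erase t.1) ((B.erase s.2).erase t.2) *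
        l s t ((A.erase s.1).erase t.1) ((B.erase s.2).erase t.2) = φ s - φ t := by
  have cards : ∀ s t : α × β, s ∈ A ×ˢ B → t ∈ A ×ˢ B → s.1 ≠ t.1 → s.2 ≠ t.2 →
      ((A.erase s.1).erase t.1).card = p + 1 ∧ ((B.erase s.2).erase t.2).card = p + 1 := by
    intro s t hs ht h1 h2
    rw [Finset.mem_product] at hs ht
    rw [Finset.card_erase_of_mem (Finset.mem_erase.2 ⟨h1.symm, ht.1⟩),
      Finset.card_erase_of_mem hs.1, Finset.card_erase_of_mem (Finset.mem_erase.2 ⟨h2.symm, ht.2⟩),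
      Finset.card_erase_of_mem hs.2]
    omega
  -- Extension by zero to attacking or outside pairs keeps `h` skew everywhere, as `board_potential`
  -- demands. The board has `p + 3 ≥ 4` rows and columns.
  set h : α × β → α × β → k := fun s t =>
    if s ∈ A ×ˢ B ∧ t ∈ A ×ˢ B ∧ s.1 ≠ t.1 ∧ s.2 ≠ t.2 then
      c s (A.erase s.1) (B.erase s.2) *
        c t ((A.erase s.1).erase t.1) ((B.erase s.2).erase t.2) *
        l s t ((A.erase s.1).erase t.1) ((B.erase s.2).erase t.2) else 0 with hh
  obtain ⟨φ, hφ⟩ := board_potential (R := A) (Q := B) (by omega) (by omega) h (by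
    intro s t
    by_cases hst : s ∈ A ×ˢ B ∧ t ∈ A ×ˢ B ∧ s.1 ≠ t.1 ∧ s.2 ≠ t.2
    swap
    · have hst' : ¬ (t ∈ A ×ˢ B ∧ s ∈ A ×ˢ B ∧ t.1 ≠ s.1 ∧ t.2 ≠ s.2) :=
        fun h => hst ⟨h.2.1, h.1, h.2.2.1.symm, h.2.2.2.symm⟩
      simp only [hh, if_neg hst, if_neg hst', neg_zero]
    obtain ⟨hs, ht, h1, h2⟩ := hst
    have hst' : t ∈ A ×ˢ B ∧ s ∈ A ×ˢ B ∧ t.1 ≠ s.1 ∧ t.2 ≠ s.2 := ⟨ht, hs, h1.symm, h2.symm⟩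
    obtain ⟨cA, cB⟩ := cards s t hs ht h1 h2
    simp only [hh, if_pos (And.intro hs (And.intro ht (And.intro h1 h2))), if_pos hst']
    rw [Finset.mem_product] at hs ht
    have hcomm := hc.comm s t ((A.erase s.1).erase t.1) ((B.erase s.2).erase t.2)
      (cA.trans cB.symm) (by simp [Blocked]) (by simp [Blocked]) h1 h2
    rw [Finset.insert_erase (Finset.mem_erase.2 ⟨h1.symm, ht.1⟩),
      Finset.insert_erase (Finset.mem_erase.2 ⟨h2.symm, ht.2⟩),
      Finset.erase_right_comm (a := s.1), Finset.erase_right_comm (a := s.2),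
      Finset.insert_erase (Finset.mem_erase.2 ⟨h1, hs.1⟩),
      Finset.insert_erase (Finset.mem_erase.2 ⟨h2, hs.2⟩)] at hcomm
    rw [hl.skew s t, Finset.erase_right_comm (a := s.1), Finset.erase_right_comm (a := s.2)]
    linear_combination (-l t s ((A.erase t.1).erase s.1) ((B.erase t.2).erase s.2)) * hcomm) (by
    intro s hs t ht u hu h1 h2 h3 h4 h5 h6
    simp only [hh, if_pos (And.intro hs (And.intro ht (And.intro h1 h2))),
      if_pos (And.intro hs (And.intro hu (And.intro h3 h4))),
      if_pos (And.intro hu (And.intro ht (And.intro h5.symm h6.symm)))]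
    obtain ⟨cA, cB⟩ := cards s t hs ht h1 h2
    rw [Finset.mem_product] at hs ht hu
    have uA : u.1 ∈ (A.erase s.1).erase t.1 := by simp [h3.symm, h5.symm, hu]
    have uB : u.2 ∈ (B.erase s.2).erase t.2 := by simp [h4.symm, h6.symm, hu]
    have main := untwisted_cocycle (s := s) (t := t) (u := u) hc hl
      (A := ((A.erase s.1).erase t.1).erase u.1) (B := ((B.erase s.2).erase t.2).erase u.2)
      (by rw [Finset.card_erase_of_mem uA, cA]; omega)
      (by rw [Finset.card_erase_of_mem uB, cB]; omega)
      (by simp [Blocked]) (by simp [Blocked]) (by simp [Blocked]) h1 h2 h3 h4 h5 h6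
    have e1 : insert u.1 (((A.erase s.1).erase t.1).erase u.1) = (A.erase s.1).erase t.1 :=
      Finset.insert_erase uA
    have e1' : insert u.2 (((B.erase s.2).erase t.2).erase u.2) = (B.erase s.2).erase t.2 :=
      Finset.insert_erase uB
    have e2 : insert t.1 ((A.erase s.1).erase t.1) = A.erase s.1 :=
      Finset.insert_erase (by simp [h1.symm, ht])
    have e2' : insert t.2 ((B.erase s.2).erase t.2) = B.erase s.2 :=
      Finset.insert_erase (by simp [h2.symm, ht])
    have e3 : insert t.1 (((A.erase s.1).erase t.1).erase u.1) = (A.erase s.1).erase u.1 := by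
      rw [Finset.erase_right_comm (b := u.1), Finset.insert_erase (by simp [h1.symm, h5, ht])]
    have e3' : insert t.2 (((B.erase s.2).erase t.2).erase u.2) = (B.erase s.2).erase u.2 := by
      rw [Finset.erase_right_comm (b := u.2), Finset.insert_erase (by simp [h2.symm, h6, ht])]
    have e4 : insert s.1 ((A.erase s.1).erase u.1) = A.erase u.1 := by
      rw [Finset.erase_right_comm, Finset.insert_erase (by simp [h3, hs])]
    have e4' : insert s.2 ((B.erase s.2).erase u.2) = B.erase u.2 := by
      rw [Finset.erase_right_comm, Finset.insert_erase (by simp [h4, hs])]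
    have e5 : insert s.1 (((A.erase s.1).erase t.1).erase u.1) = (A.erase u.1).erase t.1 := by
      ext x; simp only [Finset.mem_insert, Finset.mem_erase]
      constructor
      · rintro (rfl | h)
        · exact ⟨h1, h3, hs.1⟩
        · exact ⟨h.2.1, h.1, h.2.2.2⟩
      · rintro ⟨a, b, c⟩
        by_cases hx : x = s.1
        · exact Or.inl hx
        · exact Or.inr ⟨b, a, hx, c⟩
    have e5' : insert s.2 (((B.erase s.2).erase t.2).erase u.2) = (B.erase u.2).erase t.2 := by
      ext x; simp only [Finset.mem_insert, Finset.mem_erase]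
      constructor
      · rintro (rfl | h)
        · exact ⟨h2, h4, hs.2⟩
        · exact ⟨h.2.1, h.1, h.2.2.2⟩
      · rintro ⟨a, b, c⟩
        by_cases hx : x = s.2
        · exact Or.inl hx
        · exact Or.inr ⟨b, a, hx, c⟩
    rw [e1, e1', e2, e2', e3, e3', e4, e4', e5, e5'] at main
    exact main)
  refine ⟨φ, fun s hs t ht h1 h2 => ?_⟩
  rw [← hφ s hs t ht h1 h2]
  simp only [hh, if_pos (And.intro hs (And.intro ht (And.intro h1 h2)))]

/-- A `2`-cocycle that vanishes in the exceptional multidegrees is a coboundary. -/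
theorem exists_coboundary (hc : IsSignSystem c) (hl : IsTwoCocycle c p l) (hp : 1 ≤ p)
    (hexc : ∀ s t A B, p = 1 → A.card = 2 → B.card = 2 → IsExceptional s t A B →
      l s t A B = 0) :
    ∃ μ : α × β → Finset α → Finset β → k, ∀ s t A B, A.card = p + 1 → B.card = p + 1 →
      l s t A B = pull c (μ s) t A B - pull c (μ t) s A B := by
  -- If `s` is blocked and `t` is free, the coboundary equation has a single term and so prescribes
  -- `μ s` on the sets enlarged by `t`. By `eq_of_blocked` the prescription does not depend on `t`;
  -- where no such `t` exists, the default 0 is harmless.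
  have hb : ∀ (s : α × β) (A : Finset α) (B : Finset β), ∃ v : k, A.card = p + 2 →
      B.card = p + 2 → ∀ t : α × β, t.1 ∈ A → t.2 ∈ B →
      Blocked s (A.erase t.1) (B.erase t.2) →
      c t (A.erase t.1) (B.erase t.2) * l s t (A.erase t.1) (B.erase t.2) = v := by
    intro s A B
    by_cases h : ∃ t : α × β, t.1 ∈ A ∧ t.2 ∈ B ∧ Blocked s (A.erase t.1) (B.erase t.2)
    · obtain ⟨u, hu₁, hu₂, hu⟩ := h
      exact ⟨_, fun hA hB t ht₁ ht₂ ht =>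
        eq_of_blocked hc hl hp hexc hA hB ht₁ ht₂ hu₁ hu₂ ht hu⟩
    · exact ⟨0, fun _ _ t ht₁ ht₂ ht => absurd ⟨t, ht₁, ht₂, ht⟩ h⟩
  choose μb hμb using hb
  have hu : ∀ (A : Finset α) (B : Finset β), ∃ φ : α × β → k, A.card = p + 3 → B.card = p + 3 →
      ∀ s ∈ A ×ˢ B, ∀ t ∈ A ×ˢ B, s.1 ≠ t.1 → s.2 ≠ t.2 →
      c s (A.erase s.1) (B.erase s.2) *
        c t ((A.erase s.1).erase t.1) ((B.erase s.2).erase t.2) *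
        l s t ((A.erase s.1).erase t.1) ((B.erase s.2).erase t.2) = φ s - φ t := by
    intro A B
    by_cases h : A.card = p + 3 ∧ B.card = p + 3
    · obtain ⟨φ, hφ⟩ := exists_potential hc hl hp h.1 h.2
      exact ⟨φ, fun _ _ => hφ⟩
    · exact ⟨0, fun hA hB => absurd ⟨hA, hB⟩ h⟩
  choose φ hφ using hu
  -- On a free cell, `μ` is the potential of the board enlarged by that cell, with the weight of
  -- `exists_potential` undone.
  set μ : α × β → Finset α → Finset β → k := fun s A B =>
    if Blocked s A B then μb s A B else c s A B * φ (insert s.1 A) (insert s.2 B) s with hμ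
  have half : ∀ (s t : α × β) (A : Finset α) (B : Finset β), A.card = p + 1 → B.card = p + 1 →
      Blocked s A B → ¬ Blocked t A B → pull c (μ s) t A B = l s t A B := by
    intro s t A B hA hB hs ht
    have ht' := ht
    simp only [Blocked, not_or] at ht'
    have hs' : Blocked s (insert t.1 A) (insert t.2 B) :=
      hs.imp Finset.mem_insert_of_mem Finset.mem_insert_of_mem
    have h := hμb s (insert t.1 A) (insert t.2 B)
      (by rw [Finset.card_insert_of_notMem ht'.1, hA])
      (by rw [Finset.card_insert_of_notMem ht'.2, hB]) t (Finset.mem_insert_self _ _)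
      (Finset.mem_insert_self _ _)
    rw [Finset.erase_insert ht'.1, Finset.erase_insert ht'.2] at h
    rw [pull_of_not_blocked ht, hμ]
    simp only [if_pos hs']
    rw [← h hs]
    linear_combination l s t A B * hc.sq t A B (hA.trans hB.symm) ht
  refine ⟨μ, fun s t A B hA hB => ?_⟩
  have hAB := hA.trans hB.symm
  by_cases hs : Blocked s A B
  · by_cases ht : Blocked t A B
    · rw [pull_of_blocked hs, pull_of_blocked ht, eq_zero_of_blocked hc hl hp hexc hA hB hs ht,
        sub_zero]
    · rw [pull_of_blocked hs, half s t A B hA hB hs ht, sub_zero]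
  by_cases ht : Blocked t A B
  · rw [pull_of_blocked ht, half t s A B hA hB ht hs, zero_sub, hl.skew]
  have hs' := hs
  have ht' := ht
  simp only [Blocked, not_or] at hs' ht'
  by_cases hst : s = t
  · subst hst; rw [hl.self, sub_self]
  by_cases hatt : s.1 = t.1 ∨ s.2 = t.2
  -- For free attacking cells, adding `t` blocks `s`, so `μ s` takes its forced value. That value
  -- can also be read off by removing a cell `(z, q)` of `A × B` instead of `t`, after which the
  -- claim is the cocycle identity for `s`, `t`, `(z, q)`.
  · obtain ⟨z, hz⟩ : A.Nonempty := Finset.card_pos.1 (by omega)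
    obtain ⟨q, hq⟩ : B.Nonempty := Finset.card_pos.1 (by omega)
    have cA : (A.erase z).card = p := by rw [Finset.card_erase_of_mem hz]; omega
    have cB : (B.erase q).card = p := by rw [Finset.card_erase_of_mem hq]; omega
    have one : ∀ s t : α × β, ¬ Blocked s A B → ¬ Blocked t A B →
        (s.1 = t.1 ∨ s.2 = t.2) → pull c (μ s) t A B = c (z, q) (A.erase z) (B.erase q) *
        pull c (l s (z, q)) t (A.erase z) (B.erase q) := by
      intro s t hs ht hatt
      have ht' := ht
      simp only [Blocked, not_or] at ht'
      have hs' : Blocked s (insert t.1 A) (insert t.2 B) := by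
        rcases hatt with h | h <;> simp [Blocked, h]
      have zt : z ≠ t.1 := fun h => ht'.1 (h ▸ hz)
      have qt : q ≠ t.2 := fun h => ht'.2 (h ▸ hq)
      have bt : ¬ Blocked t (A.erase z) (B.erase q) := by simp [Blocked, ht']
      have h := hμb s (insert t.1 A) (insert t.2 B)
        (by rw [Finset.card_insert_of_notMem ht'.1, hA])
        (by rw [Finset.card_insert_of_notMem ht'.2, hB]) (z, q) (Finset.mem_insert_of_mem hz)
        (Finset.mem_insert_of_mem hq)
      simp only [Finset.erase_insert_of_ne zt.symm, Finset.erase_insert_of_ne qt.symm] at h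
      have h := h (by rcases hatt with h | h <;> simp [Blocked, h])
      rw [pull_of_not_blocked ht, pull_of_not_blocked bt, hμ]
      simp only [if_pos hs']
      rw [← h]
      have hcomm := hc.comm t (z, q) (A.erase z) (B.erase q) (cA.trans cB.symm) bt
        (by simp [Blocked]) zt.symm qt.symm
      simp only [Finset.insert_erase hz, Finset.insert_erase hq] at hcomm
      have sq := hc.sq (z, q) (A.erase z) (B.erase q) (cA.trans cB.symm) (by simp [Blocked])
      have sq' := hc.sq (z, q) (insert t.1 (A.erase z)) (insert t.2 (B.erase q))
        (by simp [Finset.card_insert_of_notMem, ht', cA, cB])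
        (by simp [Blocked, zt, qt])
      generalize l s (z, q) _ _ = x
      generalize c (z, q) (A.erase z) (B.erase q) = a at *
      generalize c (z, q) (insert t.1 (A.erase z)) (insert t.2 (B.erase q)) = b at *
      generalize c t A B = d at *
      generalize c t (A.erase z) (B.erase q) = e at *
      linear_combination (-d * b * x) * sq + a * b * x * hcomm + a * e * x * sq'
    have h := hl.cocycle s t (z, q) (A.erase z) (B.erase q) cA cB
    rw [pull_erase hz hq] at h
    rw [one s t hs ht hatt, one t s ht hs (hatt.imp Eq.symm Eq.symm)]
    have sq := hc.sq (z, q) (A.erase z) (B.erase q) (cA.trans cB.symm) (by simp [Blocked])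
    linear_combination (-l s t A B) * sq + c (z, q) (A.erase z) (B.erase q) * h
  · simp only [not_or] at hatt
    obtain ⟨h1, h2⟩ := hatt
    have bs : ¬ Blocked s (insert t.1 A) (insert t.2 B) := by simp [Blocked, hs', h1, h2]
    have bt : ¬ Blocked t (insert s.1 A) (insert s.2 B) := by
      simp [Blocked, ht', Ne.symm h1, Ne.symm h2]
    have hφ' := hφ (insert s.1 (insert t.1 A)) (insert s.2 (insert t.2 B))
      (by rw [Finset.card_insert_of_notMem (by simp [h1, hs']),
        Finset.card_insert_of_notMem ht'.1, hA])
      (by rw [Finset.card_insert_of_notMem (by simp [h2, hs']),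
        Finset.card_insert_of_notMem ht'.2, hB]) s (by simp) t (by simp) h1 h2
    rw [Finset.erase_insert (by simp [h1, hs']), Finset.erase_insert (by simp [h2, hs']),
      Finset.erase_insert ht'.1, Finset.erase_insert ht'.2] at hφ'
    rw [pull_of_not_blocked hs, pull_of_not_blocked ht, hμ]
    simp only [if_neg bs, if_neg bt]
    rw [Finset.insert_comm t.1, Finset.insert_comm t.2]
    have hcomm := hc.comm s t A B hAB hs ht h1 h2
    have sq := hc.sq t A B hAB ht
    have sq' := hc.sq s (insert t.1 A) (insert t.2 B)
      (by simp [Finset.card_insert_of_notMem, ht', hA, hB]) bs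
    generalize φ _ _ s = x at *
    generalize φ _ _ t = y at *
    generalize l s t A B = z at *
    generalize c s (insert t.1 A) (insert t.2 B) = a at *
    generalize c t (insert s.1 A) (insert s.2 B) = b at *
    generalize c s A B = d at *
    generalize c t A B = e at *
    linear_combination (-z) * sq - e * e * z * sq' + a * e * hφ' - y * hcomm
end IsTwoCocycle

/-- `1`-cocycles in the Koszul complex of partial matchings are coboundaries. -/
theorem exists_eq_of_one_cocycle {c : α × β → Finset α → Finset β → k} (hc : IsSignSystem c)
    {p : ℕ} (hp : 1 ≤ p) {ρ : α × β → Finset α → Finset β → k}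
    (hρ : ∀ s t A B, A.card = p → B.card = p → pull c (ρ s) t A B = pull c (ρ t) s A B) :
    ∃ κ : Finset α → Finset β → k, ∀ s A B, A.card = p + 1 → B.card = p + 1 →
      ρ s A B = pull c κ s A B := by
  have nz : ∀ u A B, A.card = B.card → ¬ Blocked u A B → c u A B ≠ 0 := by
    intro u A B h hb h0
    have := hc.sq u A B h hb
    simp [h0] at this
  -- The primitive is forced to be `c s * ρ s` after removal of `s`. The cocycle identity gives
  -- independence of `s` for non-attacking cells, and constancy on the board does the rest.
  have adj : ∀ (A : Finset α) (B : Finset β), A.card = p + 2 → B.card = p + 2 →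
      ∀ s t : α × β, s.1 ∈ A → s.2 ∈ B → t.1 ∈ A → t.2 ∈ B → s.1 ≠ t.1 → s.2 ≠ t.2 →
      c s (A.erase s.1) (B.erase s.2) * ρ s (A.erase s.1) (B.erase s.2) =
        c t (A.erase t.1) (B.erase t.2) * ρ t (A.erase t.1) (B.erase t.2) := by
    intro A B hA hB s t hs₁ hs₂ ht₁ ht₂ h1 h2
    have cA : ((A.erase s.1).erase t.1).card = p := by
      rw [Finset.card_erase_of_mem (Finset.mem_erase.2 ⟨h1.symm, ht₁⟩),
        Finset.card_erase_of_mem hs₁]; omega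
    have cB : ((B.erase s.2).erase t.2).card = p := by
      rw [Finset.card_erase_of_mem (Finset.mem_erase.2 ⟨h2.symm, ht₂⟩),
        Finset.card_erase_of_mem hs₂]; omega
    have bs : ¬ Blocked s ((A.erase s.1).erase t.1) ((B.erase s.2).erase t.2) := by simp [Blocked]
    have bt : ¬ Blocked t ((A.erase s.1).erase t.1) ((B.erase s.2).erase t.2) := by simp [Blocked]
    have h := hρ s t _ _ cA cB
    have hcomm := hc.comm s t _ _ (cA.trans cB.symm) bs bt h1 h2
    rw [pull_of_not_blocked bs, pull_of_not_blocked bt] at h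
    have e1 : insert t.1 ((A.erase s.1).erase t.1) = A.erase s.1 :=
      Finset.insert_erase (Finset.mem_erase.2 ⟨h1.symm, ht₁⟩)
    have e2 : insert t.2 ((B.erase s.2).erase t.2) = B.erase s.2 :=
      Finset.insert_erase (Finset.mem_erase.2 ⟨h2.symm, ht₂⟩)
    have e3 : insert s.1 ((A.erase s.1).erase t.1) = A.erase t.1 := by
      rw [Finset.erase_right_comm, Finset.insert_erase (Finset.mem_erase.2 ⟨h1, hs₁⟩)]
    have e4 : insert s.2 ((B.erase s.2).erase t.2) = B.erase t.2 := by
      rw [Finset.erase_right_comm, Finset.insert_erase (Finset.mem_erase.2 ⟨h2, hs₂⟩)]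
    rw [e1, e2, e3, e4] at h hcomm
    have sqs := hc.sq s _ _ (cA.trans cB.symm) bs
    have sqt := hc.sq t _ _ (cA.trans cB.symm) bt
    generalize c s ((A.erase s.1).erase t.1) ((B.erase s.2).erase t.2) = cs at *
    generalize c t ((A.erase s.1).erase t.1) ((B.erase s.2).erase t.2) = ct at *
    generalize c s (A.erase s.1) (B.erase s.2) = a at *
    generalize c t (A.erase t.1) (B.erase t.2) = b at *
    generalize ρ s _ _ = x at *
    generalize ρ t _ _ = y at *
    linear_combination (-a * x) * sqt + ct * x * hcomm + cs * b * h + b * y * sqs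
  have hκ : ∀ (A : Finset α) (B : Finset β), ∃ v : k, A.card = p + 2 → B.card = p + 2 →
      ∀ s : α × β, s.1 ∈ A → s.2 ∈ B →
      c s (A.erase s.1) (B.erase s.2) * ρ s (A.erase s.1) (B.erase s.2) = v := by
    intro A B
    by_cases h : A.card = p + 2 ∧ B.card = p + 2
    swap
    · exact ⟨0, fun hA hB => absurd ⟨hA, hB⟩ h⟩
    obtain ⟨hA, hB⟩ := h
    obtain ⟨z, hz⟩ : A.Nonempty := Finset.card_pos.1 (by omega)
    obtain ⟨q, hq⟩ : B.Nonempty := Finset.card_pos.1 (by omega)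
    refine ⟨c (z, q) (A.erase z) (B.erase q) * ρ (z, q) (A.erase z) (B.erase q),
      fun _ _ s hs₁ hs₂ => ?_⟩
    exact board_const (by omega) (by omega)
      (fun r q => c (r, q) (A.erase r) (B.erase q) * ρ (r, q) (A.erase r) (B.erase q))
      (fun r hr q hq r' hr' q' hq' h h' => adj A B hA hB (r, q) (r', q') hr hq hr' hq' h h')
      s.1 hs₁ s.2 hs₂ z hz q hq
  choose κ hκ using hκ
  refine ⟨κ, fun s A B hA hB => ?_⟩
  by_cases hs : Blocked s A B
  · rw [pull_of_blocked hs]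
    -- A blocked cell must have value zero. As `A` and `B` have at least two elements, some cell can
    -- be removed that leaves it blocked, and the cocycle identity there has one surviving term.
    obtain ⟨z, q, hz, hq, hb⟩ : ∃ z q, z ∈ A ∧ q ∈ B ∧ Blocked s (A.erase z) (B.erase q) := by
      rcases hs with hs | hs
      · obtain ⟨z, hz, hz'⟩ := Finset.exists_mem_ne (s := A) (by omega) s.1
        obtain ⟨q, hq⟩ : B.Nonempty := Finset.card_pos.1 (by omega)
        exact ⟨z, q, hz, hq, Or.inl (Finset.mem_erase.2 ⟨hz'.symm, hs⟩)⟩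
      · obtain ⟨q, hq, hq'⟩ := Finset.exists_mem_ne (s := B) (by omega) s.2
        obtain ⟨z, hz⟩ : A.Nonempty := Finset.card_pos.1 (by omega)
        exact ⟨z, q, hz, hq, Or.inr (Finset.mem_erase.2 ⟨hq'.symm, hs⟩)⟩
    have cA : (A.erase z).card = p := by rw [Finset.card_erase_of_mem hz]; omega
    have cB : (B.erase q).card = p := by rw [Finset.card_erase_of_mem hq]; omega
    have h := hρ s (z, q) _ _ cA cB
    rw [pull_erase hz hq, pull_of_blocked hb] at h
    simpa [nz (z, q) _ _ (cA.trans cB.symm) (by simp [Blocked])] using h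
  · have hs' := hs
    simp only [Blocked, not_or] at hs'
    rw [pull_of_not_blocked hs]
    have h := hκ (insert s.1 A) (insert s.2 B) (by rw [Finset.card_insert_of_notMem hs'.1, hA])
      (by rw [Finset.card_insert_of_notMem hs'.2, hB]) s (Finset.mem_insert_self _ _)
      (Finset.mem_insert_self _ _)
    rw [Finset.erase_insert hs'.1, Finset.erase_insert hs'.2] at h
    rw [← h]
    linear_combination (-ρ s A B) * hc.sq s A B (hA.trans hB.symm) hs

end Matching

/-! ### Minors -/

section Minors

variable {ι k : Type*} [Fintype ι] [DecidableEq ι] [Field k]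

/-- The exponent vector of `∏ i ∈ B, X (τ i, i)`. -/
def permExponent (τ : Equiv.Perm ι) (B : Finset ι) : ι × ι →₀ ℕ :=
  ∑ i ∈ B, Finsupp.single (τ i, i) 1

omit [Fintype ι] in
theorem permExponent_apply (τ : Equiv.Perm ι) (B : Finset ι) (x : ι × ι) :
    permExponent τ B x = if x.2 ∈ B ∧ τ x.2 = x.1 then 1 else 0 := by
  obtain ⟨r, q⟩ := x
  rw [permExponent, Finsupp.finsetSum_apply]
  by_cases h : q ∈ B ∧ τ q = r
  · obtain ⟨h, rfl⟩ := h
    rw [Finset.sum_eq_single q]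
    · simp [h]
    · intro b _ hb; simp [hb]
    · intro h'; exact absurd h h'
  · rw [if_neg h]
    refine Finset.sum_eq_zero fun b hb => ?_
    rw [Finsupp.single_apply, if_neg]
    rintro hbq
    simp only [Prod.mk.injEq] at hbq
    obtain ⟨h1, rfl⟩ := hbq
    exact h ⟨hb, h1⟩

omit [Fintype ι] [DecidableEq ι] in
theorem permExponent_degree (τ : Equiv.Perm ι) (B : Finset ι) :
    (permExponent τ B).degree = B.card := by
  simp [permExponent, map_sum]

omit [Fintype ι] in
theorem eq_of_permExponent_eq {τ π : Equiv.Perm ι} {B C : Finset ι}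
    (h : permExponent τ B = permExponent π C) : B = C ∧ ∀ i ∈ B, τ i = π i := by
  have key : ∀ {τ π : Equiv.Perm ι} {B C : Finset ι}, permExponent τ B = permExponent π C →
      ∀ i ∈ B, i ∈ C ∧ π i = τ i := by
    intro τ π B C h i hi
    have := DFunLike.congr_fun h (τ i, i)
    rw [permExponent_apply, permExponent_apply, if_pos ⟨hi, rfl⟩] at this
    by_contra h'
    rw [if_neg h'] at this
    exact one_ne_zero this
  refine ⟨Finset.Subset.antisymm (fun i hi => (key h i hi).1) (fun i hi => (key h.symm i hi).1),
    fun i hi => (key h i hi).2.symm⟩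

omit [Fintype ι] [DecidableEq ι] in
theorem permExponent_congr {τ π : Equiv.Perm ι} {B : Finset ι} (h : ∀ i ∈ B, τ i = π i) :
    permExponent τ B = permExponent π B :=
  Finset.sum_congr rfl fun i hi => by rw [h i hi]

theorem permExponent_add_compl (τ : Equiv.Perm ι) (B : Finset ι) :
    permExponent τ B + permExponent τ Bᶜ = permExponent τ Finset.univ :=
  Finset.sum_add_sum_compl _ _

variable (χ : Equiv.Perm ι →* ℤˣ)

/-- `∑ τ, χ(τ) ∏ i, X (τ i, i)`, the permanent or the determinant of the generic matrix when `χ`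
is trivial or the sign. -/
def immanant (k : Type*) [Field k] : MvPolynomial (ι × ι) k :=
  ∑ τ : Equiv.Perm ι, monomial (permExponent τ Finset.univ) (((χ τ : ℤˣ) : ℤ) : k)

/-- The functional that sums, with signs, the coefficients of the monomials
`∏ i ∈ B, X (τ i, i)` over the permutations `τ` equal to `π` outside of `B`. -/
def minorFunctional (π : Equiv.Perm ι) (B : Finset ι) : MvPolynomial (ι × ι) k →ₗ[k] k :=
  ∑ τ : Equiv.Perm ι, if ∀ i, i ∉ B → τ i = π i then
    (((χ τ : ℤˣ) : ℤ) : k) • lcoeff k (permExponent τ B) else 0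

theorem minorFunctional_apply (π : Equiv.Perm ι) (B : Finset ι) (p : MvPolynomial (ι × ι) k) :
    minorFunctional χ π B p = ∑ τ : Equiv.Perm ι, if ∀ i, i ∉ B → τ i = π i then
      (((χ τ : ℤˣ) : ℤ) : k) * coeff (permExponent τ B) p else 0 := by
  rw [minorFunctional, LinearMap.sum_apply]
  refine Finset.sum_congr rfl fun τ _ => ?_
  split_ifs <;> simp [lcoeff]

theorem coeff_contract_monomial {σ : Type*} (p : MvPolynomial σ k) (N b : σ →₀ ℕ) (e : k)
    [Decidable (b ≤ N)] :
    coeff b (contract p (monomial N e)) = if b ≤ N then e * coeff (N - b) p else 0 := by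
  classical
  induction p using MvPolynomial.induction_on' with
  | add p q hp hq =>
    rw [map_add, LinearMap.add_apply, coeff_add, hp, hq, coeff_add]
    split_ifs <;> ring
  | monomial a c =>
    rw [contract_monomial_monomial]
    by_cases hb : b ≤ N
    · rw [if_pos hb, coeff_monomial]
      by_cases ha : a ≤ N
      · rw [if_pos ha, coeff_monomial]
        by_cases h : N - a = b
        · have : a = N - b := by rw [← h, tsub_tsub_cancel_of_le ha]
          rw [if_pos h, if_pos this, mul_comm]
        · have : a ≠ N - b := by rintro rfl; exact h (tsub_tsub_cancel_of_le hb)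
          rw [if_neg h, if_neg this, mul_zero]
      · have : a ≠ N - b := by rintro rfl; exact ha tsub_le_self
        rw [if_neg ha, if_neg this, mul_zero, coeff_zero]
    · rw [if_neg hb]
      split_ifs with ha
      · rw [coeff_monomial, if_neg]
        rintro rfl
        exact hb tsub_le_self
      · simp

theorem permExponent_compl_le_iff (τ π : Equiv.Perm ι) (B : Finset ι) :
    permExponent π Bᶜ ≤ permExponent τ Finset.univ ↔ ∀ i, i ∉ B → τ i = π i := by
  constructor
  · intro h i hi
    have := h (π i, i)
    simp only [permExponent_apply, Finset.mem_compl, hi, not_false_eq_true, true_and, if_true,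
      Finset.mem_univ] at this
    by_contra h'
    rw [if_neg h'] at this
    omega
  · intro h
    rw [← permExponent_add_compl τ B, permExponent_congr (τ := π) (π := τ) (B := Bᶜ)
      (fun i hi => (h i (Finset.mem_compl.1 hi)).symm)]
    exact le_add_self

/-- An exponent dividing a term of the immanant is of the form `permExponent π Bᶜ`, where `B` is the
set of columns it misses. Its coefficient in the contraction collects the permutations equal to `π`
off `B`, which is exactly the minor functional. No other exponent occurs. -/
theorem mem_apolarIdeal_immanant (p : MvPolynomial (ι × ι) k) :
    p ∈ apolarIdeal (immanant χ k) ↔ ∀ π B, minorFunctional χ π B p = 0 := by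
  classical
  have key : ∀ π B, coeff (permExponent π Bᶜ) (contract p (immanant χ k)) =
      minorFunctional χ π B p := by
    intro π B
    rw [immanant, map_sum, coeff_sum, minorFunctional_apply]
    refine Finset.sum_congr rfl fun τ _ => ?_
    rw [coeff_contract_monomial]
    simp only [permExponent_compl_le_iff]
    split_ifs with h
    · congr 2
      rw [← permExponent_add_compl τ B, permExponent_congr (τ := π) (π := τ) (B := Bᶜ)
        (fun i hi => (h i (Finset.mem_compl.1 hi)).symm), add_tsub_cancel_right]
    · rfl
  change contract p (immanant χ k) = 0 ↔ _
  constructor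
  · intro h π B
    rw [← key, h, coeff_zero]
  · intro h
    ext b
    rw [coeff_zero]
    by_cases hb : ∃ π : Equiv.Perm ι, b ≤ permExponent π Finset.univ
    · obtain ⟨π, hπ⟩ := hb
      have : b = permExponent π (Finset.univ.filter fun i => b (π i, i) = 0)ᶜ := by
        ext ⟨r, q⟩
        rw [permExponent_apply]
        simp only [Finset.mem_compl, Finset.mem_filter, Finset.mem_univ, true_and]
        have h1 := hπ (r, q)
        rw [permExponent_apply] at h1
        simp only [Finset.mem_univ, true_and] at h1
        by_cases hr : π q = r
        · subst hr
          simp only [if_true] at h1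
          by_cases h0 : b (π q, q) = 0
          · simp [h0]
          · simp [h0]; omega
        · simp only [hr, if_false, and_false] at h1 ⊢; omega
      rw [this, key, h]
    · push Not at hb
      rw [immanant, map_sum, coeff_sum]
      refine Finset.sum_eq_zero fun τ _ => ?_
      rw [coeff_contract_monomial, if_neg (hb τ)]

/-- Dividing by `X (r, q)` selects the `τ` with `τ q = r`. If `r` is available in the image of `B`,
the swap redirects `π` so that it sends `q` to `r` and is unchanged off `B`; the selected `τ` are
then those agreeing with it off `B.erase q`. -/
theorem minorFunctional_X_mul (π : Equiv.Perm ι) (B : Finset ι) (r q : ι)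
    (p : MvPolynomial (ι × ι) k) :
    minorFunctional χ π B (X (r, q) * p) = if q ∈ B ∧ π.symm r ∈ B then
      minorFunctional χ (Equiv.swap (π q) r * π) (B.erase q) p else 0 := by
  classical
  rw [minorFunctional_apply]
  have hsupp : ∀ τ : Equiv.Perm ι, (r, q) ∈ (permExponent τ B).support ↔ q ∈ B ∧ τ q = r := by
    intro τ
    rw [Finsupp.mem_support_iff, permExponent_apply]
    simp
  simp only [coeff_X_mul', hsupp]
  by_cases h : q ∈ B ∧ π.symm r ∈ B
  · rw [if_pos h, minorFunctional_apply]
    refine Finset.sum_congr rfl fun τ _ => ?_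
    have hiff : ((∀ i, i ∉ B → τ i = π i) ∧ τ q = r) ↔
        ∀ i, i ∉ B.erase q → τ i = (Equiv.swap (π q) r * π) i := by
      constructor
      · rintro ⟨h1, h2⟩ i hi
        by_cases hiq : i = q
        · subst hiq; simp [h2]
        · have hiB : i ∉ B := fun h => hi (Finset.mem_erase.2 ⟨hiq, h⟩)
          rw [h1 i hiB, Equiv.Perm.mul_apply, Equiv.swap_apply_of_ne_of_ne]
          · exact fun h => hiq (π.injective h)
          · rintro rfl; exact hiB (by simpa using h.2)
      · intro h1
        refine ⟨fun i hi => ?_, ?_⟩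
        · have hiq : i ≠ q := by rintro rfl; exact hi h.1
          rw [h1 i fun h => hi (Finset.mem_of_mem_erase h), Equiv.Perm.mul_apply,
            Equiv.swap_apply_of_ne_of_ne]
          · exact fun h => hiq (π.injective h)
          · rintro rfl; exact hi (by simpa using h.2)
        · rw [h1 q (Finset.notMem_erase _ _)]; simp
    by_cases h1 : ∀ i, i ∉ B → τ i = π i
    · rw [if_pos h1]
      by_cases h2 : τ q = r
      · rw [if_pos ⟨h.1, h2⟩, if_pos (hiff.1 ⟨h1, h2⟩)]
        congr 2
        rw [permExponent, ← Finset.sum_erase_add _ _ h.1, h2, add_tsub_cancel_right]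
        rfl
      · rw [if_neg fun h => h2 h.2, mul_zero, if_neg fun h => h2 (hiff.2 h).2]
    · rw [if_neg h1, if_neg fun h => h1 (hiff.2 h).1]
  · rw [if_neg h]
    refine Finset.sum_eq_zero fun τ _ => ?_
    by_cases h1 : ∀ i, i ∉ B → τ i = π i
    swap
    · rw [if_neg h1]
    rw [if_pos h1, if_neg, mul_zero]
    rintro ⟨h2, h3⟩
    refine h ⟨h2, ?_⟩
    by_contra h4
    have := h1 _ h4
    rw [Equiv.apply_symm_apply, ← h3] at this
    have h5 := τ.injective this
    rw [h3] at h5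
    exact h4 (h5 ▸ h2)

/-- Right multiplication by the permutation that is the identity on `B` and `π⁻¹ π'` off `B` carries
one index set of the sum onto the other without changing the monomials on `B`. Thus, up to sign,
only `B` and its image matter. -/
theorem exists_minorFunctional_eq_smul {π π' : Equiv.Perm ι} {B : Finset ι}
    (h : B.image π = B.image π') : ∃ ρ : Equiv.Perm ι, ∀ p : MvPolynomial (ι × ι) k,
      minorFunctional χ π' B p = (((χ ρ : ℤˣ) : ℤ) : k) * minorFunctional χ π B p := by
  classical
  have hmem : ∀ i, π.symm (π' i) ∈ B ↔ i ∈ B := by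
    intro i
    have h1 : π' i ∈ B.image π' ↔ i ∈ B := by simp
    have h2 : π' i ∈ B.image π ↔ π.symm (π' i) ∈ B := by
      simp only [Finset.mem_image]
      constructor
      · rintro ⟨a, ha, hh⟩; rw [← hh]; simpa
      · intro h; exact ⟨_, h, by simp⟩
    rw [← h2, h, h1]
  have hinj : Function.Injective fun i => if i ∈ B then i else π.symm (π' i) := by
    intro i j hij
    by_cases hi : i ∈ B <;> by_cases hj : j ∈ B <;> simp only [hi, hj, if_true, if_false] at hij
    · exact hij
    · rw [hij, hmem] at hi; exact absurd hi hj
    · rw [← hij, hmem] at hj; exact absurd hj hi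
    · simpa using hij
  set ρ : Equiv.Perm ι := Equiv.ofBijective _ (Finite.injective_iff_bijective.1 hinj) with hρ
  have hρ1 : ∀ i ∈ B, ρ i = i := fun i hi => by simp [hρ, hi]
  have hρ2 : ∀ i, i ∉ B → ρ i = π.symm (π' i) := fun i hi => by simp [hρ, hi]
  refine ⟨ρ, fun p => ?_⟩
  rw [minorFunctional_apply, minorFunctional_apply, Finset.mul_sum,
    ← Equiv.sum_comp (Equiv.mulRight ρ)]
  refine Finset.sum_congr rfl fun τ _ => ?_
  have hiff : (∀ i, i ∉ B → (τ * ρ) i = π' i) ↔ ∀ i, i ∉ B → τ i = π i := by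
    constructor
    · intro h i hi
      have hi' : ρ.symm i ∉ B := by
        intro h'
        have := hρ1 _ h'
        rw [Equiv.apply_symm_apply] at this
        exact hi (this ▸ h')
      have := h _ hi'
      have h2 := hρ2 _ hi'
      rw [Equiv.Perm.mul_apply] at this
      rw [Equiv.apply_symm_apply] at this h2
      rw [this]
      conv_rhs => rw [h2]
      simp
    · intro h i hi
      rw [Equiv.Perm.mul_apply, hρ2 i hi, h _ (by rwa [hmem]), Equiv.apply_symm_apply]
  simp only [Equiv.coe_mulRight, hiff]
  split_ifs
  · rw [permExponent_congr (τ := τ * ρ) (π := τ) (fun i hi => by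
      rw [Equiv.Perm.mul_apply, hρ1 i hi]), map_mul]
    push_cast
    ring
  · simp

theorem minorFunctional_monomial_of_eq {π τ : Equiv.Perm ι} {B : Finset ι}
    (h : ∀ i, i ∉ B → τ i = π i) :
    minorFunctional χ π B (monomial (permExponent τ B) (1 : k)) = (((χ τ : ℤˣ) : ℤ) : k) := by
  classical
  rw [minorFunctional_apply, Finset.sum_eq_single τ]
  · rw [if_pos h, coeff_monomial, if_pos rfl, mul_one]
  · intro τ' _ hne
    split_ifs with h'
    · rw [coeff_monomial, if_neg, mul_zero]
      intro heq
      refine hne (Equiv.ext fun i => ?_)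
      by_cases hi : i ∈ B
      · exact ((eq_of_permExponent_eq heq).2 i hi).symm
      · rw [h i hi, h' i hi]
    · rfl
  · simp

theorem minorFunctional_monomial_of_ne {π τ : Equiv.Perm ι} {B C : Finset ι}
    (h : ¬ (B = C ∧ B.image π = C.image τ)) :
    minorFunctional χ π B (monomial (permExponent τ C) (1 : k)) = 0 := by
  classical
  rw [minorFunctional_apply]
  refine Finset.sum_eq_zero fun ρ _ => ?_
  split_ifs with hρ
  · rw [coeff_monomial, if_neg, mul_zero]
    intro heq
    obtain ⟨rfl, h2⟩ := eq_of_permExponent_eq heq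
    refine h ⟨rfl, ?_⟩
    rw [Finset.image_congr (g := ρ) (fun i hi => h2 i hi)]
    refine Finset.eq_of_subset_of_card_le (fun x hx => ?_)
      (by simp [Finset.card_image_of_injective _ (Equiv.injective _)])
    obtain ⟨i, hi, rfl⟩ := Finset.mem_image.1 hx
    refine Finset.mem_image.2 ⟨ρ.symm (π i), ?_, by simp⟩
    by_contra h'
    have h3 := hρ _ h'
    rw [Equiv.apply_symm_apply] at h3
    exact h' (π.injective h3 ▸ hi)
  · rfl

theorem exists_perm_image {A B : Finset ι} (h : A.card = B.card) :
    ∃ π : Equiv.Perm ι, B.image π = A := by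
  classical
  have e : {x // x ∈ B} ≃ {x // x ∈ A} := Fintype.equivOfCardEq (by simp [h])
  refine ⟨e.extendSubtype, Finset.eq_of_subset_of_card_le ?_ ?_⟩
  · intro x hx
    rw [Finset.mem_image] at hx
    obtain ⟨y, hy, rfl⟩ := hx
    exact e.extendSubtype_mem y hy
  · rw [Finset.card_image_of_injective _ (Equiv.injective _), h]

end Minors

/-! ### Bases of `S / I` indexed by pairs of row and column sets -/

section MinorSystem

variable {ι k : Type*} [Fintype ι] [DecidableEq ι] [Field k]

/-- A basis of `S / I` indexed by pairs of sets of rows and columns of the same size, on which the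
variables act by `X u • [A, B] = sgn u A B • [insert u.1 A, insert u.2 B]` if `u` is not blocked by
`A`, `B`, and by `0` otherwise: `ev A B` is the coordinate function, and `mon A B` represents
`[A, B]`. -/
structure MinorSystem (I : Ideal (MvPolynomial (ι × ι) k)) where
  sgn : ι × ι → Finset ι → Finset ι → k
  ev : Finset ι → Finset ι → MvPolynomial (ι × ι) k →ₗ[k] k
  mon : Finset ι → Finset ι → MvPolynomial (ι × ι) k
  sq : ∀ u A B, A.card = B.card → ¬ Blocked u A B → sgn u A B * sgn u A B = 1
  mem_iff : ∀ p, p ∈ I ↔ ∀ A B, A.card = B.card → ev A B p = 0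
  ev_X : ∀ u A B p, A.card = B.card → ¬ Blocked u A B →
    ev (insert u.1 A) (insert u.2 B) (X u * p) = sgn u A B * ev A B p
  ev_X_zero : ∀ u A B p, A.card = B.card → u.1 ∉ A ∨ u.2 ∉ B → ev A B (X u * p) = 0
  ev_homog : ∀ A B p d, A.card = B.card → p.IsHomogeneous d → d ≠ A.card → ev A B p = 0
  mon_homog : ∀ A B, A.card = B.card → (mon A B).IsHomogeneous A.card
  ev_mon : ∀ A B A' B', A.card = B.card → A'.card = B'.card →
    ev A' B' (mon A B) = if A' = A ∧ B' = B then 1 else 0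

namespace MinorSystem

variable {I : Ideal (MvPolynomial (ι × ι) k)} (Φ : MinorSystem I)

omit [Fintype ι] in
theorem ev_X_mul_eq (u : ι × ι) (A B : Finset ι) (p : MvPolynomial (ι × ι) k)
    (h : A.card = B.card) (hu : u.1 ∈ A ∧ u.2 ∈ B) :
    Φ.ev A B (X u * p) = Φ.sgn u (A.erase u.1) (B.erase u.2) *
      Φ.ev (A.erase u.1) (B.erase u.2) p := by
  rw [← Φ.ev_X u _ _ p (by rw [Finset.card_erase_of_mem hu.1, Finset.card_erase_of_mem hu.2, h])
    (by simp [Blocked]), Finset.insert_erase hu.1, Finset.insert_erase hu.2]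

omit [Fintype ι] in
theorem isSignSystem : IsSignSystem Φ.sgn where
  sq := Φ.sq
  comm t u A B hAB ht hu h1 h2 := by
    have ht' := ht
    have hu' := hu
    simp only [Blocked, not_or] at ht' hu'
    have hm : Φ.ev A B (Φ.mon A B) = 1 := by rw [Φ.ev_mon A B A B hAB hAB]; simp
    -- Both sides are the same coordinate of `X t * X u * mon A B`, expanded in the two orders.
    have e1 := Φ.ev_X t (insert u.1 A) (insert u.2 B) (X u * Φ.mon A B)
      (by simp [Finset.card_insert_of_notMem, hu', hAB]) (by simp [Blocked, h1, h2, ht'])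
    have e2 := Φ.ev_X u (insert t.1 A) (insert t.2 B) (X t * Φ.mon A B)
      (by simp [Finset.card_insert_of_notMem, ht', hAB])
      (by simp [Blocked, h1.symm, h2.symm, hu'])
    rw [Φ.ev_X u A B _ hAB hu, hm, mul_one] at e1
    rw [Φ.ev_X t A B _ hAB ht, hm, mul_one, Finset.insert_comm, Finset.insert_comm u.2,
      mul_left_comm, e1] at e2
    linear_combination e2

omit [Fintype ι] in
theorem ev_homogeneousComponent (A B : Finset ι) (p : MvPolynomial (ι × ι) k)
    (h : A.card = B.card) (d : ℕ) :
    Φ.ev A B (homogeneousComponent d p) = if d = A.card then Φ.ev A B p else 0 := by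
  split_ifs with hd
  · conv_rhs => rw [← sum_homogeneousComponent p]
    rw [map_sum]
    subst hd
    by_cases hd' : A.card ∈ Finset.range (p.totalDegree + 1)
    · rw [Finset.sum_eq_single_of_mem _ hd']
      intro b _ hb
      exact Φ.ev_homog A B _ b h (homogeneousComponent_isHomogeneous b p) hb
    · rw [Finset.sum_eq_zero, homogeneousComponent_eq_zero, map_zero]
      · simpa using hd'
      · intro b hb
        refine Φ.ev_homog A B _ b h (homogeneousComponent_isHomogeneous b p) ?_
        rintro rfl; exact hd' hb
  · exact Φ.ev_homog A B _ d h (homogeneousComponent_isHomogeneous d p) hd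

omit [Fintype ι] in
include Φ in
theorem homogeneousComponent_mem {p : MvPolynomial (ι × ι) k} (hp : p ∈ I) (d : ℕ) :
    homogeneousComponent d p ∈ I := by
  rw [Φ.mem_iff] at hp ⊢
  intro A B h
  rw [Φ.ev_homogeneousComponent A B p h, hp A B h, ite_self]

/-- The pairs of sets of `d` rows and `d` columns. -/
def _root_.minorIndex (ι : Type*) [Fintype ι] (d : ℕ) : Finset (Finset ι × Finset ι) :=
  Finset.powersetCard d Finset.univ ×ˢ Finset.powersetCard d Finset.univ

omit [DecidableEq ι] in
theorem _root_.mem_minorIndex {d : ℕ} {x : Finset ι × Finset ι} :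
    x ∈ minorIndex ι d ↔ x.1.card = d ∧ x.2.card = d := by
  simp [minorIndex, Finset.mem_powersetCard]

theorem ev_sum_mon (g : Finset ι → Finset ι → k) (A B : Finset ι) (h : A.card = B.card) (d : ℕ) :
    Φ.ev A B (∑ x ∈ minorIndex ι d, g x.1 x.2 • Φ.mon x.1 x.2) =
      if A.card = d then g A B else 0 := by
  rw [map_sum]
  have hterm : ∀ x ∈ minorIndex ι d, Φ.ev A B (g x.1 x.2 • Φ.mon x.1 x.2) =
      if x = (A, B) then g A B else 0 := by
    intro x hx
    rw [mem_minorIndex] at hx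
    rw [map_smul, Φ.ev_mon x.1 x.2 A B (hx.1.trans hx.2.symm) h, smul_eq_mul]
    by_cases hxe : x = (A, B)
    · subst hxe; simp
    · rw [if_neg hxe, if_neg, mul_zero]
      rintro ⟨rfl, rfl⟩; exact hxe rfl
  rw [Finset.sum_congr rfl hterm, Finset.sum_ite_eq']
  simp only [mem_minorIndex]
  by_cases hd : A.card = d
  · rw [if_pos ⟨hd, h ▸ hd⟩, if_pos hd]
  · rw [if_neg fun hh => hd hh.1, if_neg hd]

omit [Fintype ι] in
theorem mem_of_ev {p : MvPolynomial (ι × ι) k} {d : ℕ} (hp : p.IsHomogeneous d)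
    (h : ∀ A B, A.card = d → B.card = d → Φ.ev A B p = 0) : p ∈ I := by
  rw [Φ.mem_iff]
  intro A B hAB
  by_cases hd : A.card = d
  · exact h A B hd (hAB ▸ hd)
  · exact Φ.ev_homog A B p d hAB hp (Ne.symm hd)

theorem sub_sum_mon_mem {p : MvPolynomial (ι × ι) k} {d : ℕ} (hp : p.IsHomogeneous d) :
    p - ∑ x ∈ minorIndex ι d, Φ.ev x.1 x.2 p • Φ.mon x.1 x.2 ∈ I := by
  rw [Φ.mem_iff]
  intro A B h
  rw [map_sub, Φ.ev_sum_mon (fun A B => Φ.ev A B p) A B h]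
  split_ifs with hd
  · rw [sub_self]
  · rw [Φ.ev_homog A B p d h hp (Ne.symm hd), sub_zero]

theorem sum_mon_isHomogeneous (g : Finset ι → Finset ι → k) (d : ℕ) :
    (∑ x ∈ minorIndex ι d, g x.1 x.2 • Φ.mon x.1 x.2).IsHomogeneous d := by
  refine IsHomogeneous.sum _ _ _ fun x hx => ?_
  rw [mem_minorIndex] at hx
  have := Φ.mon_homog x.1 x.2 (hx.1.trans hx.2.symm)
  rw [hx.1] at this
  rw [smul_eq_C_mul]
  simpa using (isHomogeneous_C _ (g x.1 x.2)).mul this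

/-- Two functionals that agree on `I` and on the monomials `mon A B` agree, in a given degree. -/
theorem functional_ext {d : ℕ} {f g : MvPolynomial (ι × ι) k →ₗ[k] k}
    (hI : ∀ p ∈ I, p.IsHomogeneous d → f p = g p)
    (hm : ∀ A B, A.card = d → B.card = d → f (Φ.mon A B) = g (Φ.mon A B))
    {p : MvPolynomial (ι × ι) k} (hp : p.IsHomogeneous d) : f p = g p := by
  have h1 := hI _ (Φ.sub_sum_mon_mem hp)
    (hp.sub (Φ.sum_mon_isHomogeneous (fun A B => Φ.ev A B p) d))
  have h2 : f (∑ x ∈ minorIndex ι d, Φ.ev x.1 x.2 p • Φ.mon x.1 x.2) =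
      g (∑ x ∈ minorIndex ι d, Φ.ev x.1 x.2 p • Φ.mon x.1 x.2) := by
    simp only [map_sum, map_smul]
    refine Finset.sum_congr rfl fun x hx => ?_
    rw [mem_minorIndex] at hx
    rw [hm x.1 x.2 hx.1 hx.2]
  rw [map_sub, map_sub, h2] at h1
  exact sub_left_injective h1

/-- The functional on `S / I` with given values on the basis in degree `d`. -/
def toFunctional (d : ℕ) (g : Finset ι → Finset ι → k) : MvPolynomial (ι × ι) k →ₗ[k] k :=
  ∑ x ∈ minorIndex ι d, g x.1 x.2 • Φ.ev x.1 x.2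

theorem toFunctional_of_mem {d : ℕ} {g : Finset ι → Finset ι → k}
    {p : MvPolynomial (ι × ι) k} (hp : p ∈ I) : Φ.toFunctional d g p = 0 := by
  rw [toFunctional, LinearMap.sum_apply]
  refine Finset.sum_eq_zero fun x hx => ?_
  rw [mem_minorIndex] at hx
  rw [LinearMap.smul_apply, (Φ.mem_iff p).1 hp _ _ (hx.1.trans hx.2.symm), smul_zero]

theorem toFunctional_mon {d : ℕ} {g : Finset ι → Finset ι → k} {A B : Finset ι}
    (hA : A.card = d) (hB : B.card = d) : Φ.toFunctional d g (Φ.mon A B) = g A B := by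
  rw [toFunctional, LinearMap.sum_apply, Finset.sum_eq_single (A, B)]
  · simp [Φ.ev_mon A B A B (hA.trans hB.symm) (hA.trans hB.symm)]
  · intro x hx hne
    rw [mem_minorIndex] at hx
    rw [LinearMap.smul_apply, Φ.ev_mon A B _ _ (hA.trans hB.symm) (hx.1.trans hx.2.symm), if_neg,
      smul_zero]
    rintro ⟨rfl, rfl⟩; exact hne rfl
  · intro h; exact absurd (mem_minorIndex.2 ⟨hA, hB⟩) h

theorem toFunctional_X_mul_mon {d : ℕ} {g : Finset ι → Finset ι → k} {A B : Finset ι} (u : ι × ι)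
    (hA : A.card = d) (hB : B.card = d) :
    Φ.toFunctional (d + 1) g (X u * Φ.mon A B) = pull Φ.sgn g u A B := by
  have hAB := hA.trans hB.symm
  rw [toFunctional, LinearMap.sum_apply]
  by_cases hu : Blocked u A B
  · rw [pull_of_blocked hu]
    refine Finset.sum_eq_zero fun x hx => ?_
    rw [mem_minorIndex] at hx
    rw [LinearMap.smul_apply]
    by_cases hux : u.1 ∈ x.1 ∧ u.2 ∈ x.2
    · rw [Φ.ev_X_mul_eq u _ _ _ (hx.1.trans hx.2.symm) hux, Φ.ev_mon A B _ _ hAB, if_neg, mul_zero,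
        smul_zero]
      · rintro ⟨rfl, rfl⟩
        simp [Blocked] at hu
      · rw [Finset.card_erase_of_mem hux.1, Finset.card_erase_of_mem hux.2, hx.1, hx.2]
    · rw [Φ.ev_X_zero u _ _ _ (hx.1.trans hx.2.symm) (by tauto), smul_zero]
  · rw [pull_of_not_blocked hu]
    have hu' := hu
    simp only [Blocked, not_or] at hu'
    rw [Finset.sum_eq_single (insert u.1 A, insert u.2 B)]
    · rw [LinearMap.smul_apply, Φ.ev_X u A B _ hAB hu, Φ.ev_mon A B A B hAB hAB]
      simp [mul_comm]
    · intro x hx hne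
      rw [mem_minorIndex] at hx
      rw [LinearMap.smul_apply]
      by_cases hux : u.1 ∈ x.1 ∧ u.2 ∈ x.2
      · rw [Φ.ev_X_mul_eq u _ _ _ (hx.1.trans hx.2.symm) hux, Φ.ev_mon A B _ _ hAB, if_neg,
          mul_zero, smul_zero]
        · rintro ⟨rfl, rfl⟩
          rw [Finset.insert_erase hux.1, Finset.insert_erase hux.2] at hne
          exact hne rfl
        · rw [Finset.card_erase_of_mem hux.1, Finset.card_erase_of_mem hux.2, hx.1, hx.2]
      · rw [Φ.ev_X_zero u _ _ _ (hx.1.trans hx.2.symm) (by tauto), smul_zero]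
    · intro h
      refine absurd (mem_minorIndex.2 ⟨?_, ?_⟩) h
      · simp [Finset.card_insert_of_notMem hu'.1, hA]
      · simp [Finset.card_insert_of_notMem hu'.2, hB]

/-- A functional on `S / I` evaluated on a product `X u * mon A B`. -/
theorem functional_X_mul_mon {d : ℕ} {f : MvPolynomial (ι × ι) k →ₗ[k] k}
    (hI : ∀ p ∈ I, p.IsHomogeneous (d + 1) → f p = 0) {A B : Finset ι} (u : ι × ι)
    (hA : A.card = d) (hB : B.card = d) :
    f (X u * Φ.mon A B) = pull Φ.sgn (fun A B => f (Φ.mon A B)) u A B := by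
  rw [← Φ.toFunctional_X_mul_mon u hA hB]
  refine Φ.functional_ext (d := d + 1) ?_ ?_ ?_
  · intro p hp hpd; rw [hI p hp hpd, Φ.toFunctional_of_mem hp]
  · intro A B hA hB; rw [Φ.toFunctional_mon hA hB]
  · have := (isHomogeneous_X k u).mul (Φ.mon_homog A B (hA.trans hB.symm))
    rwa [hA, add_comm] at this

end MinorSystem

variable (χ : Equiv.Perm ι →* ℤˣ)

/-- A permutation that maps `B` to `A`, if the two sets have the same size. -/
def minorPerm (A B : Finset ι) : Equiv.Perm ι :=
  if h : A.card = B.card then (exists_perm_image h).choose else 1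

theorem image_minorPerm {A B : Finset ι} (h : A.card = B.card) :
    B.image (minorPerm A B) = A := by
  rw [minorPerm, dif_pos h]
  exact (exists_perm_image h).choose_spec

/-- The coordinate functions of `S / I` for the apolar ideal of an immanant. -/
def minorEv (A B : Finset ι) : MvPolynomial (ι × ι) k →ₗ[k] k :=
  (((χ (minorPerm A B) : ℤˣ) : ℤ) : k) • minorFunctional χ (minorPerm A B) B

theorem intCast_units_mul_self (e : ℤˣ) : ((e : ℤ) : k) * ((e : ℤ) : k) = 1 := by
  rw [← Int.cast_mul, ← Units.val_mul, Int.units_mul_self]; simp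

theorem exists_minorEv_eq {π : Equiv.Perm ι} {A B : Finset ι} (h : B.image π = A) :
    ∃ ρ : Equiv.Perm ι, ∀ p : MvPolynomial (ι × ι) k,
      minorFunctional χ π B p = (((χ ρ : ℤˣ) : ℤ) : k) * minorEv χ A B p := by
  have hAB : A.card = B.card := by
    rw [← h, Finset.card_image_of_injective _ (Equiv.injective _)]
  obtain ⟨ρ, hρ⟩ := exists_minorFunctional_eq_smul (k := k) χ
    ((image_minorPerm hAB).trans h.symm)
  refine ⟨ρ * minorPerm A B, fun p => ?_⟩
  rw [hρ, minorEv, LinearMap.smul_apply, smul_eq_mul, map_mul, Units.val_mul, Int.cast_mul]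
  linear_combination (-(((χ ρ : ℤˣ) : ℤ) : k) * minorFunctional χ (minorPerm A B) B p) *
    intCast_units_mul_self (k := k) (χ (minorPerm A B))

/-- Expanding the larger minor along `u` leaves a permutation that maps `B` onto `A`. It can be
replaced by `minorPerm A B` at the cost of a sign independent of `p`, and this sign is the structure
constant. -/
theorem exists_minorEv_X_mul {u : ι × ι} {A B : Finset ι} (hAB : A.card = B.card)
    (hu : ¬ Blocked u A B) :
    ∃ ρ : Equiv.Perm ι, ∀ p : MvPolynomial (ι × ι) k,
      minorEv χ (insert u.1 A) (insert u.2 B) (X u * p) =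
        (((χ ρ : ℤˣ) : ℤ) : k) * minorEv χ A B p := by
  obtain ⟨r, q⟩ := u
  simp only [Blocked, not_or] at hu
  simp only
  have hcard : (insert r A).card = (insert q B).card := by
    rw [Finset.card_insert_of_notMem hu.1, Finset.card_insert_of_notMem hu.2, hAB]
  set π := minorPerm (insert r A) (insert q B) with hπ
  have him := image_minorPerm hcard
  rw [← hπ] at him
  have hr : π.symm r ∈ insert q B := by
    have : r ∈ (insert q B).image π := him ▸ Finset.mem_insert_self _ _
    obtain ⟨i, hi, hir⟩ := Finset.mem_image.1 this
    rw [← hir]; simpa using hi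
  have him' : B.image (Equiv.swap (π q) r * π) = A := by
    refine Finset.eq_of_subset_of_card_le ?_
      (by rw [Finset.card_image_of_injective _ (Equiv.injective _), hAB])
    intro x hx
    obtain ⟨i, hi, rfl⟩ := Finset.mem_image.1 hx
    have hiq : i ≠ q := by rintro rfl; exact hu.2 hi
    have h1 : ∀ j ∈ insert q B, π j ∈ insert r A := fun j hj =>
      him ▸ Finset.mem_image_of_mem _ hj
    rw [Equiv.Perm.mul_apply]
    by_cases hir : π i = r
    · rw [hir, Equiv.swap_apply_right]
      refine Finset.mem_of_mem_insert_of_ne (h1 q (Finset.mem_insert_self _ _)) ?_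
      rw [← hir]
      exact fun h => hiq (π.injective h.symm)
    · rw [Equiv.swap_apply_of_ne_of_ne (fun h => hiq (π.injective h)) hir]
      exact Finset.mem_of_mem_insert_of_ne (h1 i (Finset.mem_insert_of_mem hi)) hir
  obtain ⟨ρ, hρ⟩ := exists_minorEv_eq (k := k) χ him'
  refine ⟨π * ρ, fun p => ?_⟩
  rw [minorEv, LinearMap.smul_apply, ← hπ, minorFunctional_X_mul,
    if_pos ⟨Finset.mem_insert_self _ _, hr⟩, Finset.erase_insert hu.2, hρ, map_mul, Units.val_mul,
    Int.cast_mul, smul_eq_mul, mul_assoc]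

theorem minorEv_mon {A B A' B' : Finset ι} (h : A.card = B.card) (h' : A'.card = B'.card) :
    minorEv χ A' B' (monomial (permExponent (minorPerm A B) B) (1 : k)) =
      if A' = A ∧ B' = B then 1 else 0 := by
  rw [minorEv, LinearMap.smul_apply, smul_eq_mul]
  split_ifs with hh
  · obtain ⟨rfl, rfl⟩ := hh
    rw [minorFunctional_monomial_of_eq χ fun _ _ => rfl, intCast_units_mul_self]
  · rw [minorFunctional_monomial_of_ne, mul_zero]
    rw [image_minorPerm h, image_minorPerm h']
    tauto

/-- The basis of `S / I` given by minors, for the apolar ideal of an immanant. -/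
def immanantMinorSystem : MinorSystem (apolarIdeal (immanant χ k)) where
  sgn u A B := minorEv χ (insert u.1 A) (insert u.2 B)
    (X u * monomial (permExponent (minorPerm A B) B) (1 : k))
  ev := minorEv χ
  mon A B := monomial (permExponent (minorPerm A B) B) 1
  sq u A B hAB hu := by
    obtain ⟨ρ, hρ⟩ := exists_minorEv_X_mul (k := k) χ hAB hu
    rw [hρ, minorEv_mon χ hAB hAB]
    simp [intCast_units_mul_self]
  mem_iff p := by
    rw [mem_apolarIdeal_immanant]
    constructor
    · intro h A B _
      rw [minorEv, LinearMap.smul_apply, h, smul_zero]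
    · intro h π B
      obtain ⟨ρ, hρ⟩ := exists_minorEv_eq (k := k) χ (rfl : B.image π = B.image π)
      rw [hρ, h _ _ (Finset.card_image_of_injective _ (Equiv.injective _)), mul_zero]
  ev_X u A B p hAB hu := by
    obtain ⟨ρ, hρ⟩ := exists_minorEv_X_mul (k := k) χ hAB hu
    rw [hρ, hρ, minorEv_mon χ hAB hAB]
    simp
  ev_X_zero u A B p hAB hu := by
    obtain ⟨r, q⟩ := u
    rw [minorEv, LinearMap.smul_apply, minorFunctional_X_mul, if_neg, smul_zero]
    rintro ⟨h1, h2⟩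
    rcases hu with hu | hu
    · have : r ∈ B.image (minorPerm A B) := Finset.mem_image.2 ⟨_, h2, by simp⟩
      rw [image_minorPerm hAB] at this
      exact hu this
    · exact hu h1
  ev_homog A B p d hAB hp hd := by
    rw [minorEv, LinearMap.smul_apply, minorFunctional_apply, Finset.sum_eq_zero, smul_zero]
    intro τ _
    rw [hp.coeff_eq_zero, mul_zero, ite_self]
    rw [permExponent_degree, ← hAB]
    exact Ne.symm hd
  mon_homog A B hAB := by
    refine isHomogeneous_monomial _ ?_
    rw [permExponent_degree, hAB]
  ev_mon A B A' B' h h' := minorEv_mon χ h h'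

theorem immanantMinorSystem_ev_empty : (immanantMinorSystem (k := k) χ).ev ∅ ∅ 1 = 1 := by
  have := (immanantMinorSystem (k := k) χ).ev_mon ∅ ∅ ∅ ∅ rfl rfl
  simpa [immanantMinorSystem, permExponent] using this

theorem immanantMinorSystem_sgn_one {u : ι × ι} {A B : Finset ι} (hAB : A.card = B.card)
    (hu : ¬ Blocked u A B) : (immanantMinorSystem (k := k) (1 : Equiv.Perm ι →* ℤˣ)).sgn u A B = 1 := by
  obtain ⟨ρ, hρ⟩ := exists_minorEv_X_mul (k := k) (1 : Equiv.Perm ι →* ℤˣ) hAB hu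
  change minorEv _ _ _ (X u * _) = 1
  rw [hρ, minorEv_mon _ hAB hAB]
  simp

/-- Both products are values of one coordinate on the two monomials of a `2 × 2` minor, whose
permutations differ by the swap of columns. This is where the determinant and the permanent part
ways. -/
theorem immanantMinorSystem_sgn_swap {i j q e : ι} (hij : i ≠ j) (hqe : q ≠ e) :
    (immanantMinorSystem (k := k) χ).sgn (i, q) {j} {e} *
        (immanantMinorSystem (k := k) χ).sgn (j, e) ∅ ∅ =
      (((χ (Equiv.swap q e) : ℤˣ) : ℤ) : k) *
        ((immanantMinorSystem (k := k) χ).sgn (i, e) {j} {q} *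
          (immanantMinorSystem (k := k) χ).sgn (j, q) ∅ ∅) := by
  set Φ := immanantMinorSystem (k := k) χ
  have key : ∀ q e : ι, q ≠ e → Φ.sgn (i, q) {j} {e} * Φ.sgn (j, e) ∅ ∅ =
      Φ.ev {i, j} {q, e} (X (i, q) * (X (j, e) * 1)) := by
    intro q e hqe
    have h1 := Φ.ev_X (i, q) {j} {e} (X (j, e) * 1) rfl (by simp [Blocked, hij, hqe])
    have h2 := Φ.ev_X (j, e) ∅ ∅ 1 rfl (by simp [Blocked])
    simp only [insert_empty_eq] at h1 h2
    rw [h1, h2, immanantMinorSystem_ev_empty, mul_one]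
  rw [key q e hqe, key e q hqe.symm, Finset.pair_comm e q]
  have hcard : ({i, j} : Finset ι).card = ({q, e} : Finset ι).card := by
    rw [Finset.card_pair hij, Finset.card_pair hqe]
  set π := minorPerm {i, j} {q, e} with hπ
  have him := image_minorPerm hcard
  rw [← hπ] at him
  have hexp : ∀ (τ : Equiv.Perm ι), permExponent τ {q, e} =
      Finsupp.single (τ q, q) 1 + Finsupp.single (τ e, e) 1 := by
    intro τ; rw [permExponent, Finset.sum_pair hqe]
  have hval : ∀ τ : Equiv.Perm ι, (∀ x, x ∉ ({q, e} : Finset ι) → τ x = π x) →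
      Φ.ev {i, j} {q, e} (monomial (permExponent τ {q, e}) 1) =
        (((χ π : ℤˣ) : ℤ) : k) * (((χ τ : ℤˣ) : ℤ) : k) := by
    intro τ hτ
    change minorEv χ _ _ _ = _
    rw [minorEv, LinearMap.smul_apply, ← hπ, minorFunctional_monomial_of_eq χ hτ, smul_eq_mul]
  have hX : ∀ a b a' b' : ι, (X (a, b) * (X (a', b') * 1) : MvPolynomial (ι × ι) k) =
      monomial (Finsupp.single (a, b) 1 + Finsupp.single (a', b') 1) 1 := by
    intro a b a' b'
    rw [mul_one, X, X, monomial_mul, one_mul]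
  -- Since `π` maps `{q, e}` onto `{i, j}`, either `π` or its product with the swap has the required
  -- values.
  have hτ : ∃ τ : Equiv.Perm ι, (∀ x, x ∉ ({q, e} : Finset ι) → τ x = π x) ∧ τ q = i ∧ τ e = j := by
    have hi : i ∈ ({q, e} : Finset ι).image π := him ▸ by simp
    have hj : j ∈ ({q, e} : Finset ι).image π := him ▸ by simp
    simp only [Finset.image_insert, Finset.image_singleton, Finset.mem_insert,
      Finset.mem_singleton] at hi hj
    rcases hi with hi | hi
    · refine ⟨π, fun _ _ => rfl, hi.symm, ?_⟩
      rcases hj with hj | hj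
      · exact absurd (hi.trans hj.symm) hij
      · exact hj.symm
    · refine ⟨π * Equiv.swap q e, fun x hx => ?_, by simp [hi], ?_⟩
      · simp only [Finset.mem_insert, Finset.mem_singleton, not_or] at hx
        rw [Equiv.Perm.mul_apply, Equiv.swap_apply_of_ne_of_ne hx.1 hx.2]
      · rcases hj with hj | hj
        · simp [hj]
        · exact absurd (hi.trans hj.symm) hij
  obtain ⟨τ, hτ1, hτq, hτe⟩ := hτ
  have h1 := hval τ hτ1
  have h2 := hval (τ * Equiv.swap q e) (fun x hx => by
    have hx' := hx
    simp only [Finset.mem_insert, Finset.mem_singleton, not_or] at hx'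
    rw [Equiv.Perm.mul_apply, Equiv.swap_apply_of_ne_of_ne hx'.1 hx'.2, hτ1 x hx])
  rw [hexp] at h1 h2
  simp only [Equiv.Perm.mul_apply, Equiv.swap_apply_left, Equiv.swap_apply_right, hτq, hτe] at h1 h2
  rw [hX, hX, h1, add_comm (Finsupp.single (i, e) 1), h2, map_mul, Units.val_mul, Int.cast_mul]
  linear_combination (-(((χ π : ℤˣ) : ℤ) : k) * (((χ τ : ℤˣ) : ℤ) : k)) *
    intCast_units_mul_self (k := k) (χ (Equiv.swap q e))

end MinorSystem

/-! ### Graded tools -/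

section Graded

variable {σ k : Type*} [Field k]

/-- The homogeneous component of integer degree `e`. -/
def intComponent (e : ℤ) : MvPolynomial σ k →ₗ[k] MvPolynomial σ k :=
  if 0 ≤ e then homogeneousComponent e.toNat else 0

theorem coeff_intComponent (e : ℤ) (p : MvPolynomial σ k) (a : σ →₀ ℕ) :
    coeff a (intComponent e p) = if (a.degree : ℤ) = e then coeff a p else 0 := by
  rw [intComponent]
  split_ifs with h1 h2 h2
  · rw [coeff_homogeneousComponent, if_pos (by omega)]
  · rw [coeff_homogeneousComponent, if_neg (by omega)]
  · omega
  · simp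

theorem isHomogeneousOfIntDegree_iff {p : MvPolynomial σ k} {e : ℤ} :
    IsHomogeneousOfIntDegree p e ↔ ∀ a, coeff a p ≠ 0 → (a.degree : ℤ) = e := by
  simp [IsHomogeneousOfIntDegree, mem_support_iff]

theorem isHomogeneousOfIntDegree_natCast {p : MvPolynomial σ k} {m : ℕ} :
    IsHomogeneousOfIntDegree p m ↔ p.IsHomogeneous m := by
  rw [isHomogeneousOfIntDegree_iff]
  constructor
  · intro h a ha
    have : Finsupp.degree a = m := by exact_mod_cast h a ha
    rwa [Finsupp.degree_eq_weight_one] at this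
  · intro h a ha
    have : Finsupp.degree a = m := by rw [Finsupp.degree_eq_weight_one]; exact h ha
    exact_mod_cast this

theorem intComponent_natCast (m : ℕ) (p : MvPolynomial σ k) :
    intComponent m p = homogeneousComponent m p := by
  simp [intComponent]

theorem intComponent_isHomogeneous (e : ℤ) (p : MvPolynomial σ k) :
    IsHomogeneousOfIntDegree (intComponent e p) e := by
  rw [isHomogeneousOfIntDegree_iff]
  intro a ha
  rw [coeff_intComponent] at ha
  by_contra h
  rw [if_neg h] at ha
  exact ha rfl

theorem IsHomogeneousOfIntDegree.intComponent_eq {p : MvPolynomial σ k} {e : ℤ}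
    (h : IsHomogeneousOfIntDegree p e) (e' : ℤ) :
    intComponent e' p = if e' = e then p else 0 := by
  rw [isHomogeneousOfIntDegree_iff] at h
  ext a
  rw [coeff_intComponent]
  have := h a
  split_ifs with h1 h2 h2
  · rfl
  · rw [coeff_zero]; by_contra h3; exact h2 (h1 ▸ this h3)
  · by_contra h3; exact h1 (h2 ▸ this (Ne.symm h3))
  · simp

theorem intComponent_mul (e j : ℤ) (p g : MvPolynomial σ k) (hg : IsHomogeneousOfIntDegree g j) :
    intComponent e (p * g) = intComponent (e - j) p * g := by
  classical
  rw [isHomogeneousOfIntDegree_iff] at hg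
  ext a
  rw [coeff_intComponent, coeff_mul, coeff_mul]
  have : ∀ x ∈ Finset.HasAntidiagonal.antidiagonal a, coeff x.1 (intComponent (e - j) p) * coeff x.2 g =
      if (a.degree : ℤ) = e then coeff x.1 p * coeff x.2 g else 0 := by
    intro x hx
    rw [Finset.HasAntidiagonal.mem_antidiagonal] at hx
    by_cases h0 : coeff x.2 g = 0
    · simp [h0]
    have h1 := hg _ h0
    have h2 : (a.degree : ℤ) = x.1.degree + x.2.degree := by
      rw [← hx, map_add]; push_cast; rfl
    rw [coeff_intComponent]
    by_cases h3 : (a.degree : ℤ) = e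
    · rw [if_pos (by omega), if_pos h3]
    · rw [if_neg (by omega), if_neg h3, zero_mul]
  rw [Finset.sum_congr rfl this]
  split_ifs <;> simp

theorem IsHomogeneousOfIntDegree.constantCoeff_eq_zero {p : MvPolynomial σ k} {e : ℤ}
    (hp : IsHomogeneousOfIntDegree p e) (he : e ≠ 0) : constantCoeff p = 0 := by
  rw [isHomogeneousOfIntDegree_iff] at hp
  by_contra h
  have := hp 0 h
  simp at this
  exact he this.symm

theorem isHomogeneousOfIntDegree_zero_iff {p : MvPolynomial σ k} :
    IsHomogeneousOfIntDegree p 0 ↔ p = C (constantCoeff p) := by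
  classical
  rw [isHomogeneousOfIntDegree_iff]
  constructor
  · intro h
    ext a
    rw [coeff_C, constantCoeff_eq]
    split_ifs with ha
    · rw [ha]
    · by_contra h'
      have := h a h'
      refine ha ?_
      have h2 : a.degree = 0 := by exact_mod_cast this
      exact ((Finsupp.degree_eq_zero_iff a).1 h2).symm
  · intro h a ha
    rw [h, coeff_C] at ha
    by_cases h0 : 0 = a
    · simp [← h0]
    · rw [if_neg h0] at ha; exact absurd rfl ha

theorem IsHomogeneousOfIntDegree.eq_zero_of_neg {p : MvPolynomial σ k} {e : ℤ}
    (hp : IsHomogeneousOfIntDegree p e) (he : e < 0) : p = 0 := by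
  have := hp.intComponent_eq e
  rw [if_pos rfl] at this
  rw [← this, intComponent, if_neg (by omega), LinearMap.zero_apply]

theorem homogeneousComponent_add_mul (m j : ℕ) (p g : MvPolynomial σ k) (hg : g.IsHomogeneous j) :
    homogeneousComponent (m + j) (p * g) = homogeneousComponent m p * g := by
  rw [← intComponent_natCast, intComponent_mul _ j p g (isHomogeneousOfIntDegree_natCast.2 hg),
    ← intComponent_natCast]
  push_cast
  rw [add_sub_cancel_right]

theorem functional_eq_of_monomials {M : Type*} [AddCommGroup M] [Module k M]
    {f g : MvPolynomial σ k →ₗ[k] M} {d : ℕ}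
    (h : ∀ a : σ →₀ ℕ, a.degree = d → f (monomial a 1) = g (monomial a 1))
    {p : MvPolynomial σ k} (hp : p.IsHomogeneous d) : f p = g p := by
  rw [p.as_sum, map_sum, map_sum]
  refine Finset.sum_congr rfl fun a ha => ?_
  have hd : a.degree = d := by
    rw [Finsupp.degree_eq_weight_one]; exact hp (mem_support_iff.1 ha)
  have : (monomial a (coeff a p) : MvPolynomial σ k) = coeff a p • monomial a 1 := by
    rw [smul_monomial, smul_eq_mul, mul_one]
  rw [this, map_smul, map_smul, h a hd]

theorem X_mul_monomial_sub {a : σ →₀ ℕ} {s : σ} (h : s ∈ a.support) :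
    (X s * monomial (a - Finsupp.single s 1) 1 : MvPolynomial σ k) = monomial a 1 := by
  rw [X, monomial_mul, one_mul, add_tsub_cancel_of_le]
  rw [Finsupp.single_le_iff]
  exact Nat.one_le_iff_ne_zero.2 (Finsupp.mem_support_iff.1 h)

theorem degree_sub_single {a : σ →₀ ℕ} {s : σ} (h : s ∈ a.support) :
    (a - Finsupp.single s 1).degree + 1 = a.degree := by
  have : a - Finsupp.single s 1 + Finsupp.single s 1 = a := by
    refine tsub_add_cancel_of_le ?_
    rw [Finsupp.single_le_iff]
    exact Nat.one_le_iff_ne_zero.2 (Finsupp.mem_support_iff.1 h)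
  conv_rhs => rw [← this, map_add, Finsupp.degree_single]

theorem exists_mem_support_of_degree {a : σ →₀ ℕ} {e : ℕ} (h : a.degree = e + 1) :
    ∃ s, s ∈ a.support := by
  by_contra h'
  push Not at h'
  have : a = 0 := by ext s; simpa using h' s
  rw [this, map_zero] at h
  omega

/-- A compatible family of functionals comes from a functional in the next degree. -/
theorem exists_functional_of_symm {ν : σ → MvPolynomial σ k →ₗ[k] k} {e : ℕ}
    (h : ∀ s t w, w.IsHomogeneous e → ν s (X t * w) = ν t (X s * w)) :
    ∃ κ : MvPolynomial σ k →ₗ[k] k, ∀ s p, p.IsHomogeneous (e + 1) → κ (X s * p) = ν s p := by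
  classical
  -- `κ` strips an arbitrarily chosen variable from each monomial; in degree `e + 2` the symmetry
  -- hypothesis makes the choice irrelevant.
  set κ : MvPolynomial σ k →ₗ[k] k := (basisMonomials σ k).constr k fun a =>
    if h : ∃ s, s ∈ a.support then ν h.choose (monomial (a - Finsupp.single h.choose 1) 1) else 0
    with hκ
  refine ⟨κ, fun s p hp => ?_⟩
  refine functional_eq_of_monomials (f := κ.comp (LinearMap.mulLeft k (X s))) (g := ν s) ?_ hp
  intro a ha
  have hX : (X s * monomial a 1 : MvPolynomial σ k) = basisMonomials σ k (Finsupp.single s 1 + a) := by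
    rw [coe_basisMonomials, X, monomial_mul, one_mul]
  rw [LinearMap.comp_apply, LinearMap.mulLeft_apply, hX, hκ, Module.Basis.constr_basis]
  have hex : ∃ t, t ∈ (Finsupp.single s 1 + a).support := ⟨s, by simp⟩
  rw [dif_pos hex]
  obtain ht := hex.choose_spec
  set t := hex.choose
  by_cases hts : t = s
  · rw [hts, add_tsub_cancel_left]
  have hta : t ∈ a.support := by
    rw [Finsupp.mem_support_iff] at ht ⊢
    simpa [Finsupp.single_apply, Ne.symm hts] using ht
  have e1 : Finsupp.single s 1 + a - Finsupp.single t 1 =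
      Finsupp.single s 1 + (a - Finsupp.single t 1) := by
    refine add_tsub_assoc_of_le ?_ _
    rw [Finsupp.single_le_iff]
    exact Nat.one_le_iff_ne_zero.2 (Finsupp.mem_support_iff.1 hta)
  have hw : (monomial (a - Finsupp.single t 1) (1 : k)).IsHomogeneous e := by
    refine isHomogeneous_monomial _ ?_
    have := degree_sub_single hta
    omega
  have := h t s _ hw
  rw [X_mul_monomial_sub hta] at this
  rw [← this, e1, X, monomial_mul, one_mul]

theorem exists_eq_sum_X_mul [Fintype σ] {m : ℕ} {p : MvPolynomial σ k}
    (hp : p.IsHomogeneous (m + 1)) :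
    ∃ q : σ → MvPolynomial σ k, (∀ s, (q s).IsHomogeneous m) ∧ p = ∑ s, X s * q s := by
  classical
  have key : ∀ a : σ →₀ ℕ, ∃ q : σ → MvPolynomial σ k, a.degree = m + 1 →
      (∀ s, (q s).IsHomogeneous m) ∧ monomial a 1 = ∑ s, X s * q s := by
    intro a
    by_cases ha : a.degree = m + 1
    swap
    · exact ⟨0, fun h => absurd h ha⟩
    obtain ⟨s, hs⟩ := exists_mem_support_of_degree ha
    refine ⟨Pi.single s (monomial (a - Finsupp.single s 1) 1), fun _ => ⟨fun t => ?_, ?_⟩⟩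
    · by_cases hts : t = s
      · subst hts
        rw [Pi.single_eq_same]
        refine isHomogeneous_monomial _ ?_
        have := degree_sub_single hs
        omega
      · rw [Pi.single_eq_of_ne hts]; exact isHomogeneous_zero _ _ _
    · rw [Finset.sum_eq_single s, Pi.single_eq_same, X_mul_monomial_sub hs]
      · intro t _ hts; rw [Pi.single_eq_of_ne hts, mul_zero]
      · simp
  choose q hq using key
  have hdeg : ∀ a ∈ p.support, a.degree = m + 1 := by
    intro a ha
    rw [Finsupp.degree_eq_weight_one]; exact hp (mem_support_iff.1 ha)
  refine ⟨fun s => ∑ a ∈ p.support, coeff a p • q a s, fun s => ?_, ?_⟩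
  · refine IsHomogeneous.sum _ _ _ fun a ha => ?_
    rw [smul_eq_C_mul]
    exact ((hq a (hdeg a ha)).1 s).C_mul _
  · conv_lhs => rw [p.as_sum]
    simp only [Finset.mul_sum]
    rw [Finset.sum_comm]
    refine Finset.sum_congr rfl fun a ha => ?_
    have : (monomial a (coeff a p) : MvPolynomial σ k) = coeff a p • monomial a 1 := by
      rw [smul_monomial, smul_eq_mul, mul_one]
    rw [this, (hq a (hdeg a ha)).2, Finset.smul_sum]
    exact Finset.sum_congr rfl fun s _ => by rw [mul_smul_comm]

theorem exists_eq_sum_X_smul [Fintype σ] {r m : ℕ} {v : Fin r → MvPolynomial σ k}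
    (hv : ∀ b, (v b).IsHomogeneous (m + 1)) :
    ∃ y : σ → Fin r → MvPolynomial σ k, (∀ s b, (y s b).IsHomogeneous m) ∧
      v = ∑ s, (X s : MvPolynomial σ k) • y s := by
  choose q hq hq' using fun b => exists_eq_sum_X_mul (hv b)
  refine ⟨fun s b => q b s, fun s b => hq b s, ?_⟩
  ext1 b
  rw [Finset.sum_apply, hq' b]
  rfl

end Graded

/-! ### Syzygies of quadrics -/

section Presentation

variable {σ k : Type*} [Field k]

/-- A system of `r` quadrics generating the ideal `I`, as a map `S^r → S`. -/
structure QuadricPresentation (I : Ideal (MvPolynomial σ k)) (r : ℕ) where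
  D : (Fin r → MvPolynomial σ k) →ₗ[MvPolynomial σ k] MvPolynomial σ k
  homog : ∀ b, (D (Pi.single b 1)).IsHomogeneous 2
  mem_iff : ∀ p, p ∈ I ↔ ∃ v, D v = p

namespace QuadricPresentation

variable {I : Ideal (MvPolynomial σ k)} {r : ℕ} (P : QuadricPresentation I r)

theorem D_apply (v : Fin r → MvPolynomial σ k) :
    P.D v = ∑ b, v b * P.D (Pi.single b 1) := by
  conv_lhs => rw [pi_eq_sum_univ' v]
  rw [map_sum]
  refine Finset.sum_congr rfl fun b _ => ?_
  rw [map_smul, smul_eq_mul]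

theorem D_mem (v : Fin r → MvPolynomial σ k) : P.D v ∈ I := (P.mem_iff _).2 ⟨v, rfl⟩

theorem D_isHomogeneous {v : Fin r → MvPolynomial σ k} {m : ℕ} (hv : ∀ b, (v b).IsHomogeneous m) :
    (P.D v).IsHomogeneous (m + 2) := by
  rw [P.D_apply]
  exact IsHomogeneous.sum _ _ _ fun b _ => (hv b).mul (P.homog b)

theorem D_homogeneousComponent (v : Fin r → MvPolynomial σ k) (m : ℕ) :
    P.D (fun b => homogeneousComponent m (v b)) = homogeneousComponent (m + 2) (P.D v) := by
  rw [P.D_apply, P.D_apply v, map_sum]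
  exact Finset.sum_congr rfl fun b _ => (homogeneousComponent_add_mul m 2 _ _ (P.homog b)).symm

/-- The relations whose coefficients are homogeneous of degree `m`. -/
def rel (m : ℕ) : Submodule k (Fin r → MvPolynomial σ k) where
  carrier := {v | P.D v = 0 ∧ ∀ a, (v a).IsHomogeneous m}
  zero_mem' := ⟨map_zero _, fun _ => isHomogeneous_zero _ _ _⟩
  add_mem' {v w} hv hw := ⟨by rw [map_add, hv.1, hw.1, add_zero],
    fun a => (hv.2 a).add (hw.2 a)⟩
  smul_mem' c v hv := by
    refine ⟨?_, fun a => ?_⟩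
    · rw [LinearMap.map_smul_of_tower, hv.1, smul_zero]
    · rw [Pi.smul_apply, smul_eq_C_mul]
      exact (hv.2 a).C_mul c

theorem exists_homogeneous_lift {p : MvPolynomial σ k} {m : ℕ} (hp : p ∈ I)
    (hm : p.IsHomogeneous (m + 2)) : ∃ v, P.D v = p ∧ ∀ b, (v b).IsHomogeneous m := by
  obtain ⟨v, hv⟩ := (P.mem_iff p).1 hp
  refine ⟨fun b => homogeneousComponent m (v b), ?_,
    fun b => homogeneousComponent_isHomogeneous _ _⟩
  rw [P.D_homogeneousComponent, hv, homogeneousComponent_of_mem hm, if_pos rfl]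

/-- Vectors with homogeneous entries of degree `m`. -/
def _root_.homogeneousVectors (σ k : Type*) [Field k] (r m : ℕ) :
    Submodule k (Fin r → MvPolynomial σ k) :=
  Submodule.pi Set.univ fun _ => homogeneousSubmodule σ k m

theorem _root_.mem_homogeneousVectors {m : ℕ} {v : Fin r → MvPolynomial σ k} :
    v ∈ homogeneousVectors σ k r m ↔ ∀ b, (v b).IsHomogeneous m := by
  simp [homogeneousVectors, Submodule.mem_pi]

/-- Lifts from `I` to `S^r` must be chosen linearly, since functionals will be composed with them. A
vector space section on the image is extended to all polynomials, with no claim about lifting off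
`I`. -/
theorem exists_section (m : ℕ) : ∃ ψ : MvPolynomial σ k →ₗ[k] (Fin r → MvPolynomial σ k),
    (∀ p b, (ψ p b).IsHomogeneous m) ∧ ∀ p ∈ I, p.IsHomogeneous (m + 2) → P.D (ψ p) = p := by
  set Dm : homogeneousVectors σ k r m →ₗ[k] MvPolynomial σ k :=
    (P.D.restrictScalars k).comp (homogeneousVectors σ k r m).subtype with hDm
  obtain ⟨g, hg⟩ := Dm.rangeRestrict.exists_rightInverse_of_surjective Dm.range_rangeRestrict
  obtain ⟨ψ, hψ⟩ := LinearMap.exists_extend g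
  refine ⟨(homogeneousVectors σ k r m).subtype.comp ψ,
    fun p => mem_homogeneousVectors.1 (ψ p).2, fun p hp hm => ?_⟩
  obtain ⟨v, hv, hv'⟩ := P.exists_homogeneous_lift hp hm
  have hmem : p ∈ LinearMap.range Dm := ⟨⟨v, mem_homogeneousVectors.2 hv'⟩, hv⟩
  have h1 : ψ p = g ⟨p, hmem⟩ := LinearMap.congr_fun hψ ⟨p, hmem⟩
  have h2 := LinearMap.congr_fun hg ⟨p, hmem⟩
  have h3 : Dm (g ⟨p, hmem⟩) = p := congrArg Subtype.val h2
  rw [LinearMap.comp_apply, h1]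
  exact h3

end QuadricPresentation

end Presentation

/-! ### Koszul cocycles attached to functionals -/

section Vanishing

variable {ι k : Type*} [Fintype ι] [DecidableEq ι] [Field k]
  {I : Ideal (MvPolynomial (ι × ι) k)} {r : ℕ}

/-- A functional on relations that vanishes on the relations generated in lower degree, in
exceptional multidegrees, is zero. -/
theorem QuadricPresentation.functional_eq_zero (P : QuadricPresentation I r) (Φ : MinorSystem I)
    {p : ℕ} (hp : 1 ≤ p) (θ : (Fin r → MvPolynomial (ι × ι) k) →ₗ[k] k)
    (hθ : ∀ s, ∀ y ∈ P.rel p, θ ((X s : MvPolynomial (ι × ι) k) • y) = 0)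
    (hexc : p = 1 → ∀ l, IsTwoCocycle Φ.sgn 1 l →
      (∀ s t A B, A.card = 2 → B.card = 2 → IsExceptional s t A B →
        ∀ y y' : Fin r → MvPolynomial (ι × ι) k, (∀ b, (y b).IsHomogeneous 1) →
          (∀ b, (y' b).IsHomogeneous 1) → P.D y = X t * Φ.mon A B → P.D y' = X s * Φ.mon A B →
          l s t A B =
            θ ((X s : MvPolynomial (ι × ι) k) • y - (X t : MvPolynomial (ι × ι) k) • y')) →
      ∀ s t A B, A.card = 2 → B.card = 2 → IsExceptional s t A B → l s t A B = 0)
    {z : Fin r → MvPolynomial (ι × ι) k} (hz : z ∈ P.rel (p + 1)) : θ z = 0 := by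
  obtain ⟨ψ, hψ, hψD⟩ := P.exists_section p
  set mv : ι × ι → (Fin r → MvPolynomial (ι × ι) k) →ₗ[k] (Fin r → MvPolynomial (ι × ι) k) :=
    fun s => DistribSMul.toLinearMap k (Fin r → MvPolynomial (ι × ι) k)
      (X s : MvPolynomial (ι × ι) k)
    with hmv
  have mv_apply : ∀ s v, mv s v = (X s : MvPolynomial (ι × ι) k) • v := fun _ _ => rfl
  set mp : ι × ι → MvPolynomial (ι × ι) k →ₗ[k] MvPolynomial (ι × ι) k :=
    fun s => LinearMap.mulLeft k (X s) with hmp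
  -- `Λ` measures, through `θ`, the failure of `ψ` to commute with multiplication by variables.
  set Λ : ι × ι → ι × ι → MvPolynomial (ι × ι) k →ₗ[k] k := fun s t =>
    θ.comp ((mv s).comp (ψ.comp (mp t)) - (mv t).comp (ψ.comp (mp s))) with hΛ
  have Λ_apply : ∀ s t w, Λ s t w = θ ((X s : MvPolynomial (ι × ι) k) • ψ (X t * w)) -
      θ ((X t : MvPolynomial (ι × ι) k) • ψ (X s * w)) := by
    intro s t w
    rw [← map_sub]; rfl
  have hXI : ∀ s, ∀ w ∈ I, X s * w ∈ I := fun s w hw => I.mul_mem_left _ hw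
  have hXh : ∀ (s : ι × ι) (w : MvPolynomial (ι × ι) k) (d : ℕ), w.IsHomogeneous d →
      (X s * w).IsHomogeneous (d + 1) := by
    intro s w d hw
    have := (isHomogeneous_X k s).mul hw
    rwa [add_comm] at this
  have ΛI : ∀ s t, ∀ w ∈ I, w.IsHomogeneous (p + 1) → Λ s t w = 0 := by
    intro s t w hw hwh
    -- Because `p ≥ 1`, the form `w` has degree at least two and lifts to some `y`. Then `X t • y`
    -- can replace `ψ (X t * w)`, since they differ by a relation of degree `p` whose multiples `θ`
    -- kills; the result is symmetric in `s` and `t`. Hence `Λ` descends to `S / I`.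
    obtain ⟨p', rfl⟩ : ∃ p', p = p' + 1 := ⟨p - 1, by omega⟩
    obtain ⟨y, hy, hyh⟩ := P.exists_homogeneous_lift hw hwh
    have key : ∀ s t, θ ((X s : MvPolynomial (ι × ι) k) • ψ (X t * w)) =
        θ ((X s : MvPolynomial (ι × ι) k) • (X t : MvPolynomial (ι × ι) k) • y) := by
      intro s t
      rw [← sub_eq_zero, ← map_sub, ← smul_sub]
      refine hθ s _ ⟨?_, fun b => ?_⟩
      · rw [map_sub, hψD _ (hXI t w hw) (hXh t w _ hwh), map_smul, hy, smul_eq_mul, sub_self]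
      · exact (hψ _ b).sub (hXh t _ _ (hyh b))
    rw [Λ_apply, key, key, smul_comm, sub_self]
  set l : ι × ι → ι × ι → Finset ι → Finset ι → k := fun s t A B => Λ s t (Φ.mon A B) with hl
  have hpull : ∀ s t u A B, A.card = p → B.card = p →
      pull Φ.sgn (l s t) u A B = Λ s t (X u * Φ.mon A B) := fun s t u A B hA hB =>
    (Φ.functional_X_mul_mon (ΛI s t) u hA hB).symm
  have hcoc : IsTwoCocycle Φ.sgn p l :=
    { self := fun s A B => by simp only [hl, Λ_apply, sub_self]
      skew := fun s t A B => by simp only [hl, Λ_apply, neg_sub]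
      cocycle := fun s t u A B hA hB => by
        rw [hpull _ _ _ _ _ hA hB, hpull _ _ _ _ _ hA hB, hpull _ _ _ _ _ hA hB, Λ_apply, Λ_apply,
          Λ_apply, mul_left_comm (X t) (X u), mul_left_comm (X s) (X u), mul_left_comm (X t) (X s)]
        ring }
  obtain ⟨μ, hμ⟩ := hcoc.exists_coboundary Φ.isSignSystem hp (by
    intro s t A B hp1 hA hB hst
    subst hp1
    refine hexc rfl l hcoc ?_ s t A B hA hB hst
    intro s t A B hA hB hst y y' hy hy' hDy hDy'
    have key : ∀ u v : ι × ι, ∀ y : Fin r → MvPolynomial (ι × ι) k, (∀ b, (y b).IsHomogeneous 1) →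
        P.D y = X v * Φ.mon A B → θ ((X u : MvPolynomial (ι × ι) k) • ψ (X v * Φ.mon A B)) =
          θ ((X u : MvPolynomial (ι × ι) k) • y) := by
      intro u v y hy hDy
      rw [← sub_eq_zero, ← map_sub, ← smul_sub]
      refine hθ u _ ⟨?_, fun b => (hψ _ b).sub (hy b)⟩
      have hmem := P.D_mem y
      have hhom := P.D_isHomogeneous hy
      rw [hDy] at hmem hhom
      rw [map_sub, hψD _ hmem hhom, hDy, sub_self]
    simp only [hl, Λ_apply]
    rw [key s t y hy hDy, key t s y' hy' hDy', map_sub])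
  -- The primitive `μ` becomes a family of functionals vanishing on `I`. Subtracting it makes `θ (X
  -- s • ψ ·)` a compatible family, which integrates to a single `κ`.
  set M : ι × ι → MvPolynomial (ι × ι) k →ₗ[k] k := fun s => Φ.toFunctional (p + 2) (μ s) with hM
  set ν : ι × ι → MvPolynomial (ι × ι) k →ₗ[k] k := fun s => θ.comp ((mv s).comp ψ) - M s with hν
  have ν_apply : ∀ s q, ν s q = θ ((X s : MvPolynomial (ι × ι) k) • ψ q) - M s q :=
    fun _ _ => rfl
  have hsymm : ∀ s t w, w.IsHomogeneous (p + 1) → ν s (X t * w) = ν t (X s * w) := by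
    intro s t w hw
    have : Λ s t w = ((M s).comp (mp t) - (M t).comp (mp s)) w := by
      refine Φ.functional_ext (d := p + 1) ?_ ?_ hw
      · intro q hq hqh
        rw [ΛI s t q hq hqh]
        change 0 = M s (X t * q) - M t (X s * q)
        simp only [hM]
        rw [Φ.toFunctional_of_mem (hXI t q hq), Φ.toFunctional_of_mem (hXI s q hq), sub_zero]
      · intro A B hA hB
        change l s t A B = M s (X t * _) - M t (X s * _)
        simp only [hM]
        rw [Φ.toFunctional_X_mul_mon t hA hB, Φ.toFunctional_X_mul_mon s hA hB, hμ s t A B hA hB]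
    rw [Λ_apply] at this
    have h2 : ((M s).comp (mp t) - (M t).comp (mp s)) w = M s (X t * w) - M t (X s * w) := rfl
    rw [h2] at this
    rw [ν_apply, ν_apply]
    linear_combination this
  obtain ⟨κ, hκ⟩ := exists_functional_of_symm hsymm
  obtain ⟨y, hy, hzy⟩ := exists_eq_sum_X_smul hz.2
  -- On `P.D (y s) ∈ I` the correction vanishes, and `θ` does not see whether `ψ` or `y s` is used
  -- as the lift. Summing over `s` gives `θ z = κ (P.D z) = 0`.
  have hterm : ∀ s, θ ((X s : MvPolynomial (ι × ι) k) • y s) = κ (X s * P.D (y s)) := by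
    intro s
    have hDI := P.D_mem (y s)
    have hDh := P.D_isHomogeneous (hy s)
    rw [hκ s _ hDh, ν_apply]
    have : M s (P.D (y s)) = 0 := by
      simp only [hM]; exact Φ.toFunctional_of_mem hDI
    rw [this, sub_zero, ← sub_eq_zero, ← map_sub, ← smul_sub]
    refine hθ s _ ⟨?_, fun b => (hy s b).sub (hψ _ b)⟩
    rw [map_sub, hψD _ hDI hDh, sub_self]
  have hD := hz.1
  rw [hzy, map_sum] at hD
  simp only [map_smul, smul_eq_mul] at hD
  rw [hzy, map_sum, Finset.sum_congr rfl fun s _ => hterm s, ← map_sum, hD, map_zero]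

/-- In degrees at least `3`, an ideal with a minor system is generated by lower degrees. -/
theorem MinorSystem.mem_span_X_mul (Φ : MinorSystem I) {p : ℕ} (hp : 1 ≤ p)
    {q : MvPolynomial (ι × ι) k} (hq : q ∈ I) (hqh : q.IsHomogeneous (p + 2)) :
    q ∈ Submodule.span k {x | ∃ s, ∃ y ∈ I, y.IsHomogeneous (p + 1) ∧ x = X s * y} := by
  by_contra hcon
  obtain ⟨θ, hθq, hθ⟩ := Submodule.exists_le_ker_of_notMem hcon
  refine hθq ?_
  have hθ' : ∀ s, ∀ y ∈ I, y.IsHomogeneous (p + 1) → θ (X s * y) = 0 := fun s y hy hyh =>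
    hθ (Submodule.subset_span ⟨s, y, hy, hyh, rfl⟩)
  set θs : ι × ι → MvPolynomial (ι × ι) k →ₗ[k] k := fun s => θ.comp (LinearMap.mulLeft k (X s))
    with hθs
  have θs_apply : ∀ s w, θs s w = θ (X s * w) := fun _ _ => rfl
  -- The functionals `w ↦ θ (X s * w)` vanish on `I` in the relevant degree and form a 1-cocycle on
  -- `S / I`. Its primitive is a functional on `S / I` that agrees with `θ` on products with
  -- variables, so `θ q = 0`.
  obtain ⟨κ, hκ⟩ := exists_eq_of_one_cocycle Φ.isSignSystem hp
    (ρ := fun s A B => θs s (Φ.mon A B)) (by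
      intro s t A B hA hB
      rw [← Φ.functional_X_mul_mon (hθ' s) t hA hB, ← Φ.functional_X_mul_mon (hθ' t) s hA hB,
        θs_apply, θs_apply, mul_left_comm])
  obtain ⟨y, hy, hqy⟩ := exists_eq_sum_X_mul hqh
  have hterm : ∀ s, θ (X s * y s) = Φ.toFunctional (p + 2) κ (X s * y s) := by
    intro s
    refine Φ.functional_ext (d := p + 1) (f := θs s)
      (g := (Φ.toFunctional (p + 2) κ).comp (LinearMap.mulLeft k (X s))) ?_ ?_ (hy s)
    · intro w hw hwh
      rw [θs_apply, hθ' s w hw hwh, LinearMap.comp_apply, LinearMap.mulLeft_apply,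
        Φ.toFunctional_of_mem (I.mul_mem_left _ hw)]
    · intro A B hA hB
      change θs s (Φ.mon A B) = Φ.toFunctional (p + 1 + 1) κ (X s * Φ.mon A B)
      rw [Φ.toFunctional_X_mul_mon s hA hB, hκ s A B hA hB]
  rw [hqy, map_sum, Finset.sum_congr rfl fun s _ => hterm s, ← map_sum, ← hqy,
    Φ.toFunctional_of_mem hq]

end Vanishing

/-! ### The first steps of a minimal resolution -/

section MinorSystem

variable {ι k : Type*} [Fintype ι] [DecidableEq ι] [Field k]
  {I : Ideal (MvPolynomial (ι × ι) k)}

omit [Fintype ι] in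
theorem MinorSystem.ev_empty_C_ne_zero (Φ : MinorSystem I) {c : k} (hc : c ≠ 0) :
    Φ.ev ∅ ∅ (C c) ≠ 0 := by
  have h1 := isHomogeneousOfIntDegree_natCast.2 (Φ.mon_homog ∅ ∅ rfl)
  rw [Finset.card_empty, Nat.cast_zero, isHomogeneousOfIntDegree_zero_iff] at h1
  have h2 := Φ.ev_mon ∅ ∅ ∅ ∅ rfl rfl
  rw [h1, if_pos ⟨rfl, rfl⟩] at h2
  intro h
  set a := constantCoeff (Φ.mon ∅ ∅)
  have : (C a : MvPolynomial (ι × ι) k) = (a * c⁻¹) • C c := by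
    rw [smul_eq_C_mul, ← C_mul, inv_mul_cancel_right₀ hc]
  rw [this, map_smul, h, smul_zero] at h2
  exact zero_ne_one h2

/-- A constant is detected by the coordinate of the empty sets, and the coefficient of `X s` in a
linear form by the coordinate of the single cell `s`. -/
theorem MinorSystem.eq_zero_of_mem_of_lt (Φ : MinorSystem I) {p : MvPolynomial (ι × ι) k} {d : ℕ}
    (hd : d < 2) (hp : p ∈ I) (hpd : p.IsHomogeneous d) : p = 0 := by
  have hzero : ∀ q : MvPolynomial (ι × ι) k, q.IsHomogeneous 0 → Φ.ev ∅ ∅ q = 0 → q = 0 := by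
    intro q hq hev
    have h1 := isHomogeneousOfIntDegree_natCast.2 hq
    rw [Nat.cast_zero, isHomogeneousOfIntDegree_zero_iff] at h1
    by_contra hne
    rw [h1] at hev
    refine Φ.ev_empty_C_ne_zero ?_ hev
    intro h0
    rw [h0, C_0] at h1
    exact hne h1
  obtain rfl | rfl : d = 0 ∨ d = 1 := by omega
  · exact hzero p hpd ((Φ.mem_iff p).1 hp ∅ ∅ rfl)
  · obtain ⟨q, hq, rfl⟩ := exists_eq_sum_X_mul hpd
    refine Finset.sum_eq_zero fun s _ => ?_
    rw [hzero (q s) (hq s), mul_zero]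
    have h1 := (Φ.mem_iff _).1 hp {s.1} {s.2} rfl
    rw [map_sum, Finset.sum_eq_single s] at h1
    · have h2 := Φ.ev_X s ∅ ∅ (q s) rfl (by simp [Blocked])
      simp only [insert_empty_eq] at h2
      rw [h2] at h1
      have h3 := Φ.sq s ∅ ∅ rfl (by simp [Blocked])
      have h4 : Φ.sgn s ∅ ∅ ≠ 0 := fun h0 => by simp [h0] at h3
      simpa [h4] using h1
    · intro t _ hts
      refine Φ.ev_X_zero t _ _ _ rfl ?_
      by_contra hcon
      push Not at hcon
      simp only [Finset.mem_singleton] at hcon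
      exact hts (Prod.ext hcon.1 hcon.2)
    · simp

end MinorSystem

section Resolution

variable {σ k : Type*} [Field k] {I : Ideal (MvPolynomial σ k)}

/-- A homogeneous ideal generated by quadrics. -/
structure IsQuadratic (I : Ideal (MvPolynomial σ k)) : Prop where
  component_mem : ∀ p ∈ I, ∀ d, homogeneousComponent d p ∈ I
  eq_zero : ∀ p ∈ I, ∀ d < 2, p.IsHomogeneous d → p = 0
  mem_span : ∀ p ∈ I, ∀ d, p.IsHomogeneous (d + 3) →
    p ∈ Submodule.span k {x | ∃ s, ∃ y ∈ I, y.IsHomogeneous (d + 2) ∧ x = X s * y}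

theorem MinorSystem.isQuadratic {ι k : Type*} [Fintype ι] [DecidableEq ι] [Field k]
    {I : Ideal (MvPolynomial (ι × ι) k)} (Φ : MinorSystem I) : IsQuadratic I where
  component_mem _ hp d := Φ.homogeneousComponent_mem hp d
  eq_zero _ hp _ hd hpd := Φ.eq_zero_of_mem_of_lt hd hp hpd
  mem_span _ hp d hpd := Φ.mem_span_X_mul (p := d + 1) (by omega) hp hpd

theorem IsQuadratic.constantCoeff_eq_zero (hI : IsQuadratic I) {p : MvPolynomial σ k}
    (hp : p ∈ I) : constantCoeff p = 0 := by
  have h1 := hI.eq_zero _ (hI.component_mem p hp 0) 0 (by omega)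
    (homogeneousComponent_isHomogeneous 0 p)
  rw [homogeneousComponent_zero] at h1
  exact C_injective _ _ (h1.trans C_0.symm)

namespace MinimalGradedFreeResolution

variable (F : MinimalGradedFreeResolution I)

theorem constantCoeff_of_d_eq_zero (i : ℕ) {v : Fin (F.rank (i + 1)) → MvPolynomial σ k}
    (hv : F.d i v = 0) (b : Fin (F.rank (i + 1))) : constantCoeff (v b) = 0 := by
  obtain ⟨w, rfl⟩ := (F.exact_d i v).1 hv
  exact F.minimal (i + 1) w b

/-- Otherwise the difference would be a cycle with constant coefficient 1 at `b`. All later uses of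
minimality of generators and syzygies take this form. -/
theorem ne_of_constantCoeff (i : ℕ) (b : Fin (F.rank (i + 1)))
    {u : Fin (F.rank (i + 1)) → MvPolynomial σ k} (hu : ∀ a, constantCoeff (u a) = 0) :
    F.d i (Pi.single b 1) ≠ F.d i u := by
  intro h
  rw [← sub_eq_zero, ← map_sub] at h
  have := F.constantCoeff_of_d_eq_zero i h b
  simp [hu] at this

/-- To reach 1 modulo `I`, some basis vector must map to a unit, and it then has degree 0. Any other
basis vector, corrected by a multiple of this one, would lie in the kernel with a coefficient 1,
against minimality. -/
theorem exists_generator (hI : IsQuadratic I) :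
    ∃ a₀ : Fin (F.rank 0), (∀ a, a = a₀) ∧ F.deg 0 a₀ = 0 ∧
      ∃ c : k, c ≠ 0 ∧ F.aug (Pi.single a₀ 1) = Ideal.Quotient.mk I (C c) := by
  choose p hp hp' using F.aug_graded
  have haug : ∀ w, F.aug w = Ideal.Quotient.mk I (∑ a, w a * p a) := by
    intro w
    conv_lhs => rw [pi_eq_sum_univ' w]
    rw [map_sum, map_sum]
    refine Finset.sum_congr rfl fun a _ => ?_
    rw [map_smul, hp', map_mul]
    rfl
  obtain ⟨w, hw⟩ := F.aug_surjective (Ideal.Quotient.mk I 1)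
  rw [haug, Ideal.Quotient.eq] at hw
  have h1 := hI.constantCoeff_eq_zero hw
  rw [map_sub, map_sum, map_one, sub_eq_zero] at h1
  obtain ⟨a₀, -, ha₀⟩ := Finset.exists_ne_zero_of_sum_ne_zero (h1.trans_ne one_ne_zero)
  rw [map_mul] at ha₀
  have hc := right_ne_zero_of_mul ha₀
  have hdeg : F.deg 0 a₀ = 0 := by
    by_contra hne
    exact hc ((hp a₀).constantCoeff_eq_zero hne)
  have hpa := hp a₀
  rw [hdeg, isHomogeneousOfIntDegree_zero_iff] at hpa
  set c := constantCoeff (p a₀)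
  refine ⟨a₀, fun a => ?_, hdeg, c, hc, by rw [hp', hpa]⟩
  by_contra hne
  have hker : F.aug (Pi.single a 1 - (C c⁻¹ * p a) • Pi.single a₀ 1) = 0 := by
    have hsmul : ∀ x y : MvPolynomial σ k, x • Ideal.Quotient.mk I y = Ideal.Quotient.mk I (x * y) :=
      fun _ _ => rfl
    rw [map_sub, map_smul, hp', hp', hpa, hsmul, ← map_sub,
      show p a - C c⁻¹ * p a * C c = 0 by
        rw [mul_right_comm, ← C_mul, inv_mul_cancel₀ hc, C_1, one_mul, sub_self], map_zero]
  obtain ⟨v, hv⟩ := (F.exact_aug _).1 hker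
  have := F.minimal 0 v a
  rw [hv] at this
  simp [Pi.single_eq_of_ne hne] at this

/-- The minimal generators of an ideal generated by quadrics are quadrics. -/
theorem exists_presentation (hI : IsQuadratic I) :
    (∀ b, F.deg 1 b = 2) ∧
      ∃ P : QuadricPresentation I (F.rank 1), ∀ v, P.D v = 0 ↔ F.d 0 v = 0 := by
  obtain ⟨a₀, ha₀, hdeg, c, hc, hcaug⟩ := F.exists_generator hI
  set D : (Fin (F.rank 1) → MvPolynomial σ k) →ₗ[MvPolynomial σ k] MvPolynomial σ k :=
    (LinearMap.proj a₀).comp (F.d 0) with hD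
  have D_apply : ∀ v, D v = F.d 0 v a₀ := fun _ => rfl
  have hD0 : ∀ v, D v = 0 ↔ F.d 0 v = 0 := by
    intro v
    rw [D_apply]
    refine ⟨fun h => funext fun a => by rw [ha₀ a, h]; rfl, fun h => by rw [h]; rfl⟩
  have haug : ∀ w, F.aug w = 0 ↔ w a₀ ∈ I := by
    intro w
    have hw : w = w a₀ • Pi.single a₀ 1 := by
      funext a; rw [ha₀ a]; simp
    have hsmul : ∀ x y : MvPolynomial σ k, x • Ideal.Quotient.mk I y = Ideal.Quotient.mk I (x * y) :=
      fun _ _ => rfl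
    have e : F.aug w = Ideal.Quotient.mk I (w a₀ * C c) := by
      conv_lhs => rw [hw]
      rw [map_smul, hcaug, hsmul]
    rw [e, Ideal.Quotient.eq_zero_iff_mem]
    refine ⟨fun h => ?_, fun h => I.mul_mem_right _ h⟩
    have := I.mul_mem_right (C c⁻¹) h
    rwa [mul_assoc, ← C_mul, mul_inv_cancel₀ hc, C_1, mul_one] at this
  have hmem : ∀ p, p ∈ I ↔ ∃ v, D v = p := by
    intro p
    constructor
    · intro hp
      have : F.aug (Pi.single a₀ p) = 0 := by rw [haug]; simpa using hp
      obtain ⟨v, hv⟩ := (F.exact_aug _).1 this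
      exact ⟨v, by rw [D_apply, hv]; simp⟩
    · rintro ⟨v, rfl⟩
      rw [D_apply, ← haug]
      exact (F.exact_aug _).2 ⟨v, rfl⟩
  have hhom : ∀ b, IsHomogeneousOfIntDegree (D (Pi.single b 1)) (F.deg 1 b) := by
    intro b
    have := F.d_graded 0 b a₀
    rwa [hdeg, sub_zero] at this
  have hne : ∀ b, ∀ u : Fin (F.rank 1) → MvPolynomial σ k, (∀ a, constantCoeff (u a) = 0) →
      D (Pi.single b 1) ≠ D u := by
    intro b u hu h
    rw [← sub_eq_zero, ← map_sub, hD0, map_sub, sub_eq_zero] at h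
    exact F.ne_of_constantCoeff 0 b hu h
  have hne0 : ∀ b, D (Pi.single b 1) ≠ 0 := by
    intro b h
    exact hne b 0 (by simp) (by rw [h, map_zero])
  have hdeg1 : ∀ b, F.deg 1 b = 2 := by
    intro b
    have hb := hhom b
    have hbI : D (Pi.single b 1) ∈ I := (hmem _).2 ⟨_, rfl⟩
    rcases lt_or_ge (F.deg 1 b) 0 with h | h
    · exact absurd (hb.eq_zero_of_neg h) (hne0 b)
    obtain ⟨d, hd⟩ := Int.eq_ofNat_of_zero_le h
    rw [hd] at hb ⊢
    have hb' := isHomogeneousOfIntDegree_natCast.1 hb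
    rcases lt_trichotomy d 2 with h2 | h2 | h2
    · exact absurd (hI.eq_zero _ hbI d h2 hb') (hne0 b)
    · rw [h2]; rfl
    -- A generator of degree at least three is a sum of variables times elements of `I`, hence the
    -- image of a vector without constant terms, which minimality forbids.
    · exfalso
      obtain ⟨e, rfl⟩ : ∃ e, d = e + 3 := ⟨d - 3, by omega⟩
      have key : ∀ x ∈ Submodule.span k {x | ∃ s, ∃ y ∈ I, y.IsHomogeneous (e + 2) ∧ x = X s * y},
          ∃ u, (∀ a, constantCoeff (u a) = 0) ∧ x = D u := by
        intro x hx
        induction hx using Submodule.span_induction with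
        | mem x hx =>
          obtain ⟨s, y, hy, -, rfl⟩ := hx
          obtain ⟨v, rfl⟩ := (hmem y).1 hy
          exact ⟨(X s : MvPolynomial σ k) • v, by simp, by rw [map_smul, smul_eq_mul]⟩
        | zero => exact ⟨0, by simp, by simp⟩
        | add x y _ _ hx hy =>
          obtain ⟨u, hu, rfl⟩ := hx
          obtain ⟨u', hu', rfl⟩ := hy
          exact ⟨u + u', by simp [hu, hu'], by rw [map_add]⟩
        | smul a x _ hx =>
          obtain ⟨u, hu, rfl⟩ := hx
          refine ⟨(C a : MvPolynomial σ k) • u, by simp [hu], ?_⟩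
          rw [map_smul, smul_eq_mul, smul_eq_C_mul]
      obtain ⟨u, hu, hu'⟩ := key _ (hI.mem_span _ hbI e hb')
      exact hne b u hu hu'
  refine ⟨hdeg1, ⟨D, fun b => ?_, hmem⟩, hD0⟩
  have := hhom b
  rw [hdeg1] at this
  exact isHomogeneousOfIntDegree_natCast.1 (by exact_mod_cast this)

/-- The span of the products of the variables with the relations of degree `m`. -/
def decomposableRelations (m : ℕ) : Submodule k (Fin (F.rank 1) → MvPolynomial σ k) :=
  Submodule.span k {x | ∃ s, ∃ y ∈ F.relations m, x = (X s : MvPolynomial σ k) • y}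

theorem smul_mem_relations {m e : ℕ} {v : Fin (F.rank 1) → MvPolynomial σ k}
    (hv : v ∈ F.relations m) {p : MvPolynomial σ k} (hp : p.IsHomogeneous e) :
    p • v ∈ F.relations (e + m) :=
  ⟨by rw [map_smul, hv.1, smul_zero], fun a => hp.mul (hv.2 a)⟩

theorem smul_mem_decomposableRelations [Fintype σ] {m j e : ℕ} (hm : m = e + j)
    {v : Fin (F.rank 1) → MvPolynomial σ k} (hv : v ∈ F.relations j) {p : MvPolynomial σ k}
    (hp : p.IsHomogeneous (e + 1)) : p • v ∈ F.decomposableRelations m := by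
  obtain ⟨q, hq, rfl⟩ := exists_eq_sum_X_mul hp
  rw [Finset.sum_smul]
  refine Submodule.sum_mem _ fun s _ => Submodule.subset_span ⟨s, q s • v, ?_, ?_⟩
  · rw [hm]; exact F.smul_mem_relations hv (hq s)
  · rw [mul_smul]

/-- Each factor `y` is itself an image from `F₂`, so the variable in front can be kept in the lift.
Comparison with minimality then detects genuinely new relations. -/
theorem decomposableRelations_eq_d {m : ℕ} {x : Fin (F.rank 1) → MvPolynomial σ k}
    (hx : x ∈ F.decomposableRelations m) :
    ∃ u : Fin (F.rank 2) → MvPolynomial σ k, (∀ a, constantCoeff (u a) = 0) ∧ x = F.d 1 u := by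
  induction hx using Submodule.span_induction with
  | mem x hx =>
    obtain ⟨s, y, hy, rfl⟩ := hx
    obtain ⟨v, rfl⟩ := (F.exact_d 0 y).1 hy.1
    exact ⟨(X s : MvPolynomial σ k) • v, by simp, by rw [map_smul]⟩
  | zero => exact ⟨0, by simp, by simp⟩
  | add x y _ _ hx hy =>
    obtain ⟨u, hu, rfl⟩ := hx
    obtain ⟨u', hu', rfl⟩ := hy
    exact ⟨u + u', by simp [hu, hu'], by rw [map_add]⟩
  | smul a x _ hx =>
    obtain ⟨u, hu, rfl⟩ := hx
    refine ⟨(C a : MvPolynomial σ k) • u, by simp [hu], ?_⟩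
    rw [map_smul, algebra_compatible_smul (MvPolynomial σ k) a, algebraMap_eq]

/-- The image of a basis vector of `F_2` in `F_1`. -/
def syz (b : Fin (F.rank 2)) : Fin (F.rank 1) → MvPolynomial σ k := F.d 1 (Pi.single b 1)

theorem d_syz (b : Fin (F.rank 2)) : F.d 0 (F.syz b) = 0 :=
  (F.exact_d 0 _).2 ⟨_, rfl⟩

theorem syz_graded (hI : IsQuadratic I) (b : Fin (F.rank 2)) (a : Fin (F.rank 1)) :
    IsHomogeneousOfIntDegree (F.syz b a) (F.deg 2 b - 2) := by
  have := F.d_graded 1 b a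
  rwa [(F.exists_presentation hI).1] at this

theorem syz_ne_zero (b : Fin (F.rank 2)) : F.syz b ≠ 0 := by
  intro h
  refine F.ne_of_constantCoeff 1 b (u := 0) (by simp) ?_
  rw [map_zero]; exact h

/-- All generators have degree two, so a basis vector of `F₂` of smaller degree than 3 would map to
a vector of constants. Minimality makes these zero, and no basis vector maps to zero. -/
theorem three_le_deg (hI : IsQuadratic I) (b : Fin (F.rank 2)) : 3 ≤ F.deg 2 b := by
  by_contra hlt
  refine F.syz_ne_zero b (funext fun a => ?_)
  have h := F.syz_graded hI b a
  rcases lt_or_ge (F.deg 2 b) 2 with h2 | h2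
  · exact h.eq_zero_of_neg (by omega)
  · rw [show F.deg 2 b - 2 = 0 by omega, isHomogeneousOfIntDegree_zero_iff] at h
    rw [h, show constantCoeff (F.syz b a) = 0 from F.minimal 1 _ a, C_0]
    rfl

theorem syz_mem_relations (hI : IsQuadratic I) {b : Fin (F.rank 2)} {m : ℕ}
    (hb : F.deg 2 b = (m : ℤ) + 3) : F.syz b ∈ F.relations (m + 1) := by
  refine ⟨F.d_syz b, fun a => ?_⟩
  have := F.syz_graded hI b a
  rw [hb] at this
  refine isHomogeneousOfIntDegree_natCast.1 ?_
  convert this using 1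
  push_cast; ring

theorem betti_two_eq_zero_of_le (hI : IsQuadratic I) {m : ℕ}
    (h : F.relations (m + 1) ≤ F.decomposableRelations m) : F.betti 2 ((m : ℤ) + 3) = 0 := by
  rw [betti, Nat.card_eq_zero]
  refine Or.inl ⟨fun ⟨b, hb⟩ => ?_⟩
  obtain ⟨u, hu, hu'⟩ := F.decomposableRelations_eq_d (h (F.syz_mem_relations hI hb))
  exact F.ne_of_constantCoeff 1 b hu hu'

theorem betti_two_eq_zero_of_lt (hI : IsQuadratic I) {j : ℤ} (hj : j < 3) : F.betti 2 j = 0 := by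
  rw [betti, Nat.card_eq_zero]
  refine Or.inl ⟨fun ⟨b, hb⟩ => ?_⟩
  have := F.three_le_deg hI b
  omega

/-- The graded Betti number as the number of new relations of a given degree. -/
theorem finrank_relations_quotient [Fintype σ] (hI : IsQuadratic I) (m : ℕ) :
    Module.finrank k (F.relations (m + 1) ⧸
      (F.decomposableRelations m).comap (F.relations (m + 1)).subtype) =
      F.betti 2 ((m : ℤ) + 3) := by
  classical
  set U := (F.decomposableRelations m).comap (F.relations (m + 1)).subtype with hU
  set z : {b : Fin (F.rank 2) // F.deg 2 b = (m : ℤ) + 3} → F.relations (m + 1) :=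
    fun b => ⟨F.syz b.1, F.syz_mem_relations hI b.2⟩ with hz
  have hli : LinearIndependent k fun b => U.mkQ (z b) := by
    rw [Fintype.linearIndependent_iff]
    intro g hg b
    simp only [← map_smul, ← map_sum] at hg
    rw [Submodule.mkQ_apply, Submodule.Quotient.mk_eq_zero, hU, Submodule.mem_comap] at hg
    -- A decomposable combination of basis syzygies lifts without constant terms; by minimality its
    -- coefficients vanish.
    obtain ⟨u, hu, hu'⟩ := F.decomposableRelations_eq_d hg
    have h1 : ((F.relations (m + 1)).subtype (∑ b, g b • z b)) =
        F.d 1 (∑ b, (C (g b) : MvPolynomial σ k) • Pi.single b.1 1) := by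
      rw [map_sum, map_sum]
      refine Finset.sum_congr rfl fun b _ => ?_
      rw [map_smul, map_smul, algebra_compatible_smul (MvPolynomial σ k) (g b), algebraMap_eq]
      rfl
    rw [h1, ← sub_eq_zero, ← map_sub] at hu'
    have h2 := F.constantCoeff_of_d_eq_zero 1 hu' b.1
    rw [Pi.sub_apply, map_sub, hu, sub_zero, Finset.sum_apply, map_sum, Finset.sum_eq_single b] at h2
    · simpa using h2
    · intro b' _ hne
      have : b.1 ≠ b'.1 := fun h => hne (Subtype.ext h.symm)
      simp [Pi.single_eq_of_ne this]
    · simp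
  have hsp : ⊤ ≤ Submodule.span k (Set.range fun b => U.mkQ (z b)) := by
    rintro x -
    obtain ⟨⟨y, hy⟩, rfl⟩ := U.mkQ_surjective x
    obtain ⟨v, hv⟩ := (F.exact_d 0 y).1 hy.1
    set w : Fin (F.rank 2) → Fin (F.rank 1) → MvPolynomial σ k := fun b =>
      intComponent ((m : ℤ) + 3 - F.deg 2 b) (v b) • F.syz b with hw
    have hyw : y = ∑ b, w b := by
      funext a
      have h1 : y a = ∑ b, v b * F.syz b a := by
        rw [← hv]
        conv_lhs => rw [pi_eq_sum_univ' v]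
        rw [map_sum, Finset.sum_apply]
        refine Finset.sum_congr rfl fun b _ => ?_
        rw [map_smul]; rfl
      have h2 := isHomogeneousOfIntDegree_natCast.2 (hy.2 a)
      have h3 := h2.intComponent_eq ((m + 1 : ℕ) : ℤ)
      rw [if_pos rfl] at h3
      rw [← h3, h1, map_sum, Finset.sum_apply]
      refine Finset.sum_congr rfl fun b _ => ?_
      rw [intComponent_mul _ _ _ _ (F.syz_graded hI b a), hw]
      simp only [Pi.smul_apply, smul_eq_mul]
      congr 3
      push_cast; ring
    -- Basis vectors of degree below `m + 3` contribute decomposable relations, those of degree `m +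
    -- 3` scalar multiples of their syzygies, and those above nothing, since the coefficient would
    -- have negative degree.
    have hwb : ∀ b, w b ∈ F.relations (m + 1) ∧ ∀ h : w b ∈ F.relations (m + 1),
        U.mkQ ⟨w b, h⟩ ∈ Submodule.span k (Set.range fun b => U.mkQ (z b)) := by
      intro b
      have h3 := F.three_le_deg hI b
      rcases lt_trichotomy (F.deg 2 b) ((m : ℤ) + 3) with hlt | heq | hgt
      · obtain ⟨j, hj⟩ : ∃ j : ℕ, F.deg 2 b = (j : ℤ) + 3 := ⟨(F.deg 2 b - 3).toNat, by omega⟩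
        obtain ⟨e, he⟩ : ∃ e : ℕ, m = e + (j + 1) := ⟨m - (j + 1), by omega⟩
        have hz' := F.syz_mem_relations hI hj
        have hp : (intComponent ((m : ℤ) + 3 - F.deg 2 b) (v b)).IsHomogeneous (e + 1) := by
          refine isHomogeneousOfIntDegree_natCast.1 ?_
          convert intComponent_isHomogeneous ((m : ℤ) + 3 - F.deg 2 b) (v b) using 1
          rw [hj, he]; push_cast; ring
        have hmem : w b ∈ F.relations (m + 1) := by
          have := F.smul_mem_relations hz' hp
          rwa [show e + 1 + (j + 1) = m + 1 by omega] at this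
        refine ⟨hmem, fun h => ?_⟩
        have : U.mkQ ⟨w b, h⟩ = 0 := by
          rw [Submodule.mkQ_apply, Submodule.Quotient.mk_eq_zero, hU, Submodule.mem_comap]
          exact F.smul_mem_decomposableRelations he hz' hp
        rw [this]
        exact Submodule.zero_mem _
      · have hc := intComponent_isHomogeneous ((m : ℤ) + 3 - F.deg 2 b) (v b)
        rw [heq, sub_self, isHomogeneousOfIntDegree_zero_iff] at hc
        have hwz : w b = constantCoeff (intComponent 0 (v b)) • F.syz b := by
          simp only [hw]
          rw [heq, sub_self, hc]
          ext1 a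
          simp [smul_eq_C_mul]
        have hmem : w b ∈ F.relations (m + 1) := by
          rw [hwz]; exact Submodule.smul_mem _ _ (F.syz_mem_relations hI heq)
        refine ⟨hmem, fun h => ?_⟩
        have : (⟨w b, h⟩ : F.relations (m + 1)) =
            constantCoeff (intComponent 0 (v b)) • z ⟨b, heq⟩ := Subtype.ext hwz
        rw [this, map_smul]
        exact Submodule.smul_mem _ _ (Submodule.subset_span ⟨⟨b, heq⟩, rfl⟩)
      · have hw0 : w b = 0 := by
          simp only [hw]
          rw [(intComponent_isHomogeneous ((m : ℤ) + 3 - F.deg 2 b) (v b)).eq_zero_of_neg (by omega),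
            zero_smul]
        refine ⟨hw0 ▸ Submodule.zero_mem _, fun h => ?_⟩
        have : (⟨w b, h⟩ : F.relations (m + 1)) = 0 := Subtype.ext hw0
        rw [this, map_zero]
        exact Submodule.zero_mem _
    have : (⟨y, hy⟩ : F.relations (m + 1)) = ∑ b, ⟨w b, (hwb b).1⟩ := by
      refine Subtype.ext ?_
      rw [AddSubmonoidClass.coe_finsetSum]
      exact hyw
    rw [this, map_sum]
    exact Submodule.sum_mem _ fun b _ => (hwb b).2 _
  rw [Module.finrank_eq_nat_card_basis (Module.Basis.mk hli hsp), betti]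

theorem relations_zero_eq_bot : F.relations 0 = ⊥ := by
  rw [eq_bot_iff]
  intro v hv
  rw [Submodule.mem_bot]
  funext a
  have h := isHomogeneousOfIntDegree_natCast.2 (hv.2 a)
  rw [Nat.cast_zero, isHomogeneousOfIntDegree_zero_iff] at h
  rw [h, F.constantCoeff_of_d_eq_zero 0 hv.1, C_0]
  rfl

theorem finrank_relations_one [Fintype σ] (hI : IsQuadratic I) :
    Module.finrank k (F.relations 1) = F.betti 2 3 := by
  have h := F.finrank_relations_quotient hI 0
  rw [Nat.cast_zero, zero_add] at h
  refine Eq.trans ?_ h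
  have hbot : (F.decomposableRelations 0).comap (F.relations (0 + 1)).subtype = ⊥ := by
    have : F.decomposableRelations 0 = ⊥ := by
      rw [decomposableRelations, Submodule.span_eq_bot]
      rintro x ⟨s, y, hy, rfl⟩
      rw [relations_zero_eq_bot, Submodule.mem_bot] at hy
      rw [hy, smul_zero]
    rw [this, Submodule.comap_bot, Submodule.ker_subtype]
  exact (Submodule.quotEquivOfEqBot _ hbot).finrank_eq.symm

/-- In an `S`-combination of linear relations only the linear parts of the coefficients affect the
part of degree two. So the `S`-submodule and the vector space span of variables times linear
relations agree in that degree. -/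
theorem quadraticFromLinear_eq [Fintype σ] :
    F.quadraticFromLinear = (F.decomposableRelations 1).comap (F.relations 2).subtype := by
  have key : ∀ x ∈ Submodule.span (MvPolynomial σ k)
      (F.relations 1 : Set (Fin (F.rank 1) → MvPolynomial σ k)),
      (fun a => homogeneousComponent 2 (x a)) ∈ F.decomposableRelations 1 := by
    intro x hx
    induction hx using Submodule.closure_induction with
    | zero =>
      simp only [Pi.zero_apply, map_zero]
      exact Submodule.zero_mem _
    | add x y _ _ hx hy =>
      simp only [Pi.add_apply, map_add]
      exact Submodule.add_mem _ hx hy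
    | smul_mem p x hx =>
      have : (fun a => homogeneousComponent 2 ((p • x) a)) = homogeneousComponent 1 p • x := by
        funext a
        exact homogeneousComponent_add_mul 1 1 p (x a) (hx.2 a)
      rw [this]
      exact F.smul_mem_decomposableRelations (e := 0) (j := 1) rfl hx
        (homogeneousComponent_isHomogeneous 1 p)
  ext ⟨x, hx⟩
  rw [quadraticFromLinear, Submodule.mem_comap, Submodule.mem_comap,
    Submodule.restrictScalars_mem]
  constructor
  · intro h
    have h1 := key _ h
    have : (fun a => homogeneousComponent 2 (x a)) = x := by
      funext a
      rw [homogeneousComponent_of_mem (hx.2 a), if_pos rfl]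
    simp only [Submodule.subtype_apply] at h1 ⊢
    rwa [this] at h1
  · intro h
    have hle : F.decomposableRelations 1 ≤ (Submodule.span (MvPolynomial σ k)
        (F.relations 1 : Set (Fin (F.rank 1) → MvPolynomial σ k))).restrictScalars k := by
      refine Submodule.span_le.2 ?_
      rintro x ⟨s, y, hy, rfl⟩
      exact Submodule.smul_mem _ _ (Submodule.subset_span hy)
    exact hle h

theorem finrank_relations_two [Fintype σ] (hI : IsQuadratic I) :
    Module.finrank k (F.relations 2 ⧸ F.quadraticFromLinear) = F.betti 2 4 := by
  rw [quadraticFromLinear_eq]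
  exact F.finrank_relations_quotient hI 1

end MinimalGradedFreeResolution

end Resolution

/-! ### Existence of minimal graded free resolutions -/

section Existence

variable {σ k : Type*} [Field k]

/-- The component of degree `e` of a vector in a graded free module. -/
def vectorComponent {r : ℕ} (deg : Fin r → ℤ) (e : ℤ) (v : Fin r → MvPolynomial σ k) :
    Fin r → MvPolynomial σ k :=
  fun a => intComponent (e - deg a) (v a)

/-- Homogeneous vectors in a graded free module. -/
def IsHomogeneousVector {r : ℕ} (deg : Fin r → ℤ) (e : ℤ) (v : Fin r → MvPolynomial σ k) : Prop :=
  ∀ a, IsHomogeneousOfIntDegree (v a) (e - deg a)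

theorem vectorComponent_isHomogeneous {r : ℕ} (deg : Fin r → ℤ) (e : ℤ)
    (v : Fin r → MvPolynomial σ k) : IsHomogeneousVector deg e (vectorComponent deg e v) :=
  fun _ => intComponent_isHomogeneous _ _

theorem vectorComponent_smul {r : ℕ} {deg : Fin r → ℤ} {j : ℤ} {g : Fin r → MvPolynomial σ k}
    (hg : IsHomogeneousVector deg j g) (e : ℤ) (p : MvPolynomial σ k) :
    vectorComponent deg e (p • g) = intComponent (e - j) p • g := by
  funext a
  change intComponent _ (p * g a) = _ * g a
  rw [intComponent_mul _ _ _ _ (hg a)]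
  congr 2
  congr 1
  ring

theorem vectorComponent_sum {r : ℕ} (deg : Fin r → ℤ) (e : ℤ) {τ : Type*} (s : Finset τ)
    (v : τ → Fin r → MvPolynomial σ k) :
    vectorComponent deg e (∑ i ∈ s, v i) = ∑ i ∈ s, vectorComponent deg e (v i) := by
  funext a
  simp [vectorComponent, Finset.sum_apply, map_sum]

theorem exists_sum_vectorComponent {r : ℕ} (deg : Fin r → ℤ) (v : Fin r → MvPolynomial σ k) :
    ∃ E : Finset ℤ, v = ∑ e ∈ E, vectorComponent deg e v := by
  classical
  refine ⟨Finset.univ.biUnion fun a => (Finset.range ((v a).totalDegree + 1)).image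
    fun m : ℕ => (m : ℤ) + deg a, ?_⟩
  funext a
  rw [Finset.sum_apply]
  ext x
  rw [coeff_sum]
  simp only [vectorComponent, coeff_intComponent]
  by_cases h0 : coeff x (v a) = 0
  · simp [h0]
  rw [Finset.sum_eq_single ((x.degree : ℤ) + deg a)]
  · rw [if_pos (by ring)]
  · intro e _ he
    rw [if_neg]
    intro h; exact he (by omega)
  · intro h
    refine absurd ?_ h
    rw [Finset.mem_biUnion]
    refine ⟨a, Finset.mem_univ _, Finset.mem_image.2 ⟨x.degree, ?_, rfl⟩⟩
    rw [Finset.mem_range, Nat.lt_succ_iff]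
    exact le_totalDegree (mem_support_iff.2 h0)

/-- A graded submodule of a graded free module, contained in the product of the latter with the
ideal of the variables. -/
structure GradedRelations (σ k : Type*) [Field k] where
  rank : ℕ
  deg : Fin rank → ℤ
  carrier : Submodule (MvPolynomial σ k) (Fin rank → MvPolynomial σ k)
  graded : ∀ v ∈ carrier, ∀ e, vectorComponent deg e v ∈ carrier
  minimal : ∀ v ∈ carrier, ∀ a, constantCoeff (v a) = 0

namespace GradedRelations

variable (N : GradedRelations σ k)

/-- A finite set of homogeneous generators. -/
def IsGeneratingSet (T : Finset (Fin N.rank → MvPolynomial σ k)) : Prop :=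
  (∀ v ∈ T, ∃ e, IsHomogeneousVector N.deg e v) ∧
    Submodule.span (MvPolynomial σ k) (T : Set (Fin N.rank → MvPolynomial σ k)) = N.carrier

theorem exists_isGeneratingSet [Finite σ] : ∃ T, N.IsGeneratingSet T := by
  classical
  obtain ⟨S, hS⟩ := IsNoetherian.noetherian N.carrier
  choose E hE using exists_sum_vectorComponent (σ := σ) (k := k) N.deg
  refine ⟨S.biUnion fun v => (E v).image fun e => vectorComponent N.deg e v, ?_, ?_⟩
  · intro w hw
    rw [Finset.mem_biUnion] at hw
    obtain ⟨v, -, hw⟩ := hw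
    obtain ⟨e, -, rfl⟩ := Finset.mem_image.1 hw
    exact ⟨e, vectorComponent_isHomogeneous _ _ _⟩
  · refine le_antisymm (Submodule.span_le.2 ?_) ?_
    · intro w hw
      rw [Finset.mem_coe, Finset.mem_biUnion] at hw
      obtain ⟨v, hv, hw⟩ := hw
      obtain ⟨e, -, rfl⟩ := Finset.mem_image.1 hw
      exact N.graded v (hS ▸ Submodule.subset_span hv) e
    · rw [← hS]
      refine Submodule.span_le.2 fun v hv => ?_
      rw [SetLike.mem_coe, hE v]
      refine Submodule.sum_mem _ fun e he => Submodule.subset_span ?_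
      rw [Finset.mem_coe, Finset.mem_biUnion]
      exact ⟨v, hv, Finset.mem_image_of_mem _ he⟩

/-- Take a homogeneous generating set of least cardinality. A syzygy with nonzero constant
coefficient at `b`, restricted to the degree of `g b`, would express `g b` through the other
generators. -/
theorem exists_cover [Finite σ] : ∃ (r : ℕ) (deg : Fin r → ℤ)
    (d : (Fin r → MvPolynomial σ k) →ₗ[MvPolynomial σ k] (Fin N.rank → MvPolynomial σ k)),
    LinearMap.range d = N.carrier ∧
    (∀ b, IsHomogeneousVector N.deg (deg b) (d (Pi.single b 1))) ∧
    ∀ v, d v = 0 → ∀ b, constantCoeff (v b) = 0 := by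
  classical
  have hex : ∃ t, ∃ T, N.IsGeneratingSet T ∧ T.card = t := by
    obtain ⟨T, hT⟩ := N.exists_isGeneratingSet
    exact ⟨_, T, hT, rfl⟩
  obtain ⟨T, hT, hcard⟩ := Nat.find_spec hex
  have hmin : ∀ T', N.IsGeneratingSet T' → T.card ≤ T'.card := by
    intro T' hT'
    rw [hcard]
    exact Nat.find_min' hex ⟨T', hT', rfl⟩
  set g : Fin T.card → Fin N.rank → MvPolynomial σ k := fun i => (T.equivFin.symm i).1 with hg
  have hgT : ∀ i, g i ∈ T := fun i => (T.equivFin.symm i).2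
  have hginj : Function.Injective g := fun i j h => T.equivFin.symm.injective (Subtype.ext h)
  have hgsurj : ∀ v ∈ T, ∃ i, g i = v := fun v hv => ⟨T.equivFin ⟨v, hv⟩, by simp [hg]⟩
  choose deg hdeg using fun i => hT.1 (g i) (hgT i)
  refine ⟨T.card, deg, Fintype.linearCombination (MvPolynomial σ k) g, ?_, ?_, ?_⟩
  · rw [Fintype.range_linearCombination, ← hT.2]
    congr 1
    ext v
    exact ⟨by rintro ⟨i, rfl⟩; exact hgT i, fun hv => hgsurj v hv⟩
  · intro b
    rw [Fintype.linearCombination_apply_single, one_smul]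
    exact hdeg b
  · intro v hv b
    by_contra hc
    rw [Fintype.linearCombination_apply] at hv
    have h1 := congrArg (vectorComponent N.deg (deg b)) hv
    rw [vectorComponent_sum] at h1
    have h2 : vectorComponent N.deg (deg b) (0 : Fin N.rank → MvPolynomial σ k) = 0 := by
      funext a; simp [vectorComponent]
    rw [h2, ← Finset.add_sum_erase _ _ (Finset.mem_univ b)] at h1
    simp only [vectorComponent_smul (hdeg _)] at h1
    have h3 := intComponent_isHomogeneous 0 (v b)
    rw [isHomogeneousOfIntDegree_zero_iff] at h3
    have h4 : constantCoeff (intComponent 0 (v b)) = constantCoeff (v b) := by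
      rw [constantCoeff_eq, coeff_intComponent]; simp
    rw [sub_self, h3, h4] at h1
    set c := constantCoeff (v b)
    have hmem : g b ∈ Submodule.span (MvPolynomial σ k)
        ((T.erase (g b) : Finset _) : Set (Fin N.rank → MvPolynomial σ k)) := by
      have h5 : (C c⁻¹ : MvPolynomial σ k) • (C c : MvPolynomial σ k) • g b ∈
          Submodule.span (MvPolynomial σ k)
            ((T.erase (g b) : Finset _) : Set (Fin N.rank → MvPolynomial σ k)) := by
        rw [eq_neg_of_add_eq_zero_left h1]
        refine Submodule.smul_mem _ _ (Submodule.neg_mem _ (Submodule.sum_mem _ fun i hi =>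
          Submodule.smul_mem _ _ (Submodule.subset_span ?_)))
        rw [Finset.mem_coe, Finset.mem_erase]
        exact ⟨fun h => (Finset.mem_erase.1 hi).1 (hginj h), hgT i⟩
      rwa [smul_smul, ← C_mul, inv_mul_cancel₀ hc, C_1, one_smul] at h5
    have hT' : N.IsGeneratingSet (T.erase (g b)) := by
      refine ⟨fun w hw => hT.1 w (Finset.mem_of_mem_erase hw), ?_⟩
      rw [← hT.2]
      refine le_antisymm (Submodule.span_mono (by simp)) (Submodule.span_le.2 fun w hw => ?_)
      by_cases hwb : w = g b
      · rw [hwb]; exact hmem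
      · exact Submodule.subset_span (Finset.mem_coe.2 (Finset.mem_erase.2 ⟨hwb, hw⟩))
    have h6 := hmin _ hT'
    rw [Finset.card_erase_of_mem (hgT b)] at h6
    have h7 : 0 < T.card := Finset.card_pos.2 ⟨_, hgT b⟩
    omega

variable [Finite σ]

/-- The rank of a minimal free cover of a graded submodule. -/
def coverRank : ℕ := N.exists_cover.choose

/-- The degrees of a minimal free cover of a graded submodule. -/
def coverDeg : Fin N.coverRank → ℤ := N.exists_cover.choose_spec.choose

/-- A minimal free cover of a graded submodule. -/
def coverMap : (Fin N.coverRank → MvPolynomial σ k) →ₗ[MvPolynomial σ k]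
    (Fin N.rank → MvPolynomial σ k) :=
  N.exists_cover.choose_spec.choose_spec.choose

theorem range_coverMap : LinearMap.range N.coverMap = N.carrier :=
  N.exists_cover.choose_spec.choose_spec.choose_spec.1

theorem coverMap_graded (b : Fin N.coverRank) :
    IsHomogeneousVector N.deg (N.coverDeg b) (N.coverMap (Pi.single b 1)) :=
  N.exists_cover.choose_spec.choose_spec.choose_spec.2.1 b

theorem coverMap_minimal (v : Fin N.coverRank → MvPolynomial σ k) (hv : N.coverMap v = 0)
    (b : Fin N.coverRank) : constantCoeff (v b) = 0 :=
  N.exists_cover.choose_spec.choose_spec.choose_spec.2.2 v hv b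

/-- The kernel of a minimal free cover. -/
def next : GradedRelations σ k where
  rank := N.coverRank
  deg := N.coverDeg
  carrier := LinearMap.ker N.coverMap
  graded v hv e := by
    have key : ∀ v, N.coverMap v = ∑ b, v b • N.coverMap (Pi.single b 1) := by
      intro v
      conv_lhs => rw [pi_eq_sum_univ' v]
      rw [map_sum]
      exact Finset.sum_congr rfl fun b _ => by rw [map_smul]
    rw [LinearMap.mem_ker] at hv ⊢
    have h1 := congrArg (vectorComponent N.deg e) hv
    rw [key, vectorComponent_sum] at h1
    simp only [vectorComponent_smul (N.coverMap_graded _)] at h1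
    rw [key]
    refine h1.trans ?_
    funext a; simp [vectorComponent]
  minimal v hv b := N.coverMap_minimal v hv b

end GradedRelations

/-- The graded submodule of `S` given by a proper homogeneous ideal. -/
def IsQuadratic.gradedRelations {I : Ideal (MvPolynomial σ k)} (hI : IsQuadratic I) :
    GradedRelations σ k where
  rank := 1
  deg _ := 0
  carrier := Submodule.comap (LinearMap.proj 0) I
  graded v hv e := by
    rw [Submodule.mem_comap] at hv ⊢
    change intComponent (e - 0) (v 0) ∈ I
    rw [sub_zero, intComponent]
    split_ifs
    · exact hI.component_mem _ hv _
    · exact I.zero_mem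
  minimal v hv a := by
    obtain rfl : a = 0 := Subsingleton.elim _ _
    exact hI.constantCoeff_eq_zero hv

/-- A homogeneous ideal generated by quadrics has a minimal graded free resolution. -/
theorem IsQuadratic.nonempty_resolution [Finite σ] {I : Ideal (MvPolynomial σ k)}
    (hI : IsQuadratic I) : Nonempty (MinimalGradedFreeResolution I) := by
  -- `N i` lies inside `F_i` and is the image of `d i`; thus `N 0` is `I` inside `S`, and each later
  -- one is the kernel of the preceding cover.
  set N : ℕ → GradedRelations σ k := fun i => Nat.rec hI.gradedRelations (fun _ M => M.next) i
    with hN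
  have hrange : ∀ i, LinearMap.range (N i).coverMap = (N i).carrier := fun i =>
    (N i).range_coverMap
  refine ⟨{
    rank := fun i => (N i).rank
    deg := fun i => (N i).deg
    d := fun i => (N i).coverMap
    aug := (Ideal.Quotient.mkₐ (MvPolynomial σ k) I).toLinearMap.comp
      (LinearMap.proj (0 : Fin 1))
    d_graded := fun i b a => (N i).coverMap_graded b a
    aug_graded := ?_
    aug_surjective := ?_
    exact_aug := ?_
    exact_d := ?_
    minimal := ?_ }⟩
  · intro a
    obtain rfl : a = (0 : Fin 1) := Subsingleton.elim (α := Fin 1) _ _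
    refine ⟨1, isHomogeneousOfIntDegree_natCast.2 (isHomogeneous_one σ k), ?_⟩
    change Ideal.Quotient.mk I ((Pi.single (0 : Fin 1) 1 : Fin 1 → MvPolynomial σ k) 0) = _
    rw [Pi.single_eq_same]
  · intro x
    obtain ⟨p, rfl⟩ := Ideal.Quotient.mk_surjective x
    exact ⟨fun _ => p, rfl⟩
  · intro y
    change Ideal.Quotient.mk I (y (0 : Fin 1)) = 0 ↔ y ∈ LinearMap.range (N 0).coverMap
    rw [hrange, Ideal.Quotient.eq_zero_iff_mem]
    rfl
  · exact fun i y => (SetLike.ext_iff.1 (hrange (i + 1)) y).symm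
  · intro i v a
    refine (N i).minimal _ ?_ a
    rw [← hrange]
    exact ⟨v, rfl⟩

end Existence

/-! ### Exceptional multidegrees -/

section Exceptional

variable {α β k : Type*} [DecidableEq α] [DecidableEq β] [Field k]
  {c : α × β → Finset α → Finset β → k} {l : α × β → α × β → Finset α → Finset β → k}

/-- This is the cocycle identity for `(i, a)`, `(j, b)`, `(i, q)` on `{j}`, `{e}`. The term of `(j,
b)` drops out because row `j` is occupied; in the other two, `a` and `q` have exchanged places. -/
theorem IsTwoCocycle.exceptional_row (hl : IsTwoCocycle c 1 l) {i j : α} {a q e b : β} (hij : i ≠ j)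
    (hae : a ≠ e) (hqe : q ≠ e) :
    c (i, q) {j} {e} * l (i, a) (j, b) {i, j} {q, e} =
      c (i, a) {j} {e} * l (i, q) (j, b) {i, j} {a, e} := by
  have h := hl.cocycle (i, a) (j, b) (i, q) {j} {e} rfl rfl
  rw [pull_of_not_blocked (by simp [Blocked, hij, hqe]), pull_of_blocked (by simp [Blocked]),
    pull_of_not_blocked (by simp [Blocked, hij, hae]), hl.skew (j, b)] at h
  linear_combination h

theorem IsTwoCocycle.exceptional_col (hl : IsTwoCocycle c 1 l) {i j : β} {a q e b : α} (hij : i ≠ j)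
    (hae : a ≠ e) (hqe : q ≠ e) :
    c (q, i) {e} {j} * l (a, i) (b, j) {q, e} {i, j} =
      c (a, i) {e} {j} * l (q, i) (b, j) {a, e} {i, j} := by
  have h := hl.cocycle (a, i) (b, j) (q, i) {e} {j} rfl rfl
  rw [pull_of_not_blocked (by simp [Blocked, hij, hqe]), pull_of_blocked (by simp [Blocked]),
    pull_of_not_blocked (by simp [Blocked, hij, hae]), hl.skew (b, j)] at h
  linear_combination h

theorem IsExceptional.cases {s t : α × β} {A : Finset α} {B : Finset β} (hA : A.card = 2)
    (hB : B.card = 2) (h : IsExceptional s t A B) :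
    (∃ i j a b q e, i ≠ j ∧ a ≠ b ∧ a ≠ q ∧ a ≠ e ∧ b ≠ q ∧ b ≠ e ∧ q ≠ e ∧ s = (i, a) ∧
      t = (j, b) ∧ A = {i, j} ∧ B = {q, e}) ∨
    (∃ i j a b q e, i ≠ j ∧ a ≠ b ∧ a ≠ q ∧ a ≠ e ∧ b ≠ q ∧ b ≠ e ∧ q ≠ e ∧ s = (a, i) ∧
      t = (b, j) ∧ B = {i, j} ∧ A = {q, e}) := by
  obtain ⟨h1, h2, ⟨h3, h4, h5⟩ | ⟨h3, h4, h5⟩⟩ := h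
  · obtain ⟨q, e, hqe, rfl⟩ := Finset.card_eq_two.1 hB
    simp only [Finset.mem_insert, Finset.mem_singleton, not_or] at h4 h5
    exact Or.inl ⟨s.1, t.1, s.2, t.2, q, e, h1, h2, h4.1, h4.2, h5.1, h5.2, hqe, rfl, rfl, h3, rfl⟩
  · obtain ⟨q, e, hqe, rfl⟩ := Finset.card_eq_two.1 hA
    simp only [Finset.mem_insert, Finset.mem_singleton, not_or] at h4 h5
    exact Or.inr ⟨s.2, t.2, s.1, t.1, q, e, h2, h1, h4.1, h4.2, h5.1, h5.2, hqe, rfl, rfl, h3, rfl⟩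

/-- If exchanging two columns changes signs, cocycles vanish in the exceptional multidegrees. -/
theorem IsTwoCocycle.exceptional_eq_zero (hc : IsSignSystem c) (hl : IsTwoCocycle c 1 l)
    (h2 : (2 : k) ≠ 0)
    (hsw : ∀ i j q e, i ≠ j → q ≠ e →
      c (i, q) {j} {e} * c (j, e) ∅ ∅ = - (c (i, e) {j} {q} * c (j, q) ∅ ∅))
    {s t : α × β} {A : Finset α} {B : Finset β} (hA : A.card = 2) (hB : B.card = 2)
    (h : IsExceptional s t A B) : l s t A B = 0 := by
  have nz : ∀ u A B, A.card = B.card → ¬ Blocked u A B → c u A B ≠ 0 := by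
    intro u A B h hb h0
    have := hc.sq u A B h hb
    simp [h0] at this
  -- The `H`'s are the values with three columns permuted cyclically. Three moves return to the
  -- start, and the three sign changes multiply to `-1`, so twice a unit times `H₁` is zero.
  have final : ∀ C₁ C₂ C₃ C₁' C₂' C₃' d₁ d₂ d₃ H₁ H₂ H₃ : k, C₁' ≠ 0 → C₂' ≠ 0 → C₃' ≠ 0 →
      d₁ ≠ 0 → d₂ ≠ 0 → d₃ ≠ 0 → C₁ * d₁ = -(C₁' * d₃) → C₂ * d₂ = -(C₂' * d₁) →
      C₃ * d₃ = -(C₃' * d₂) → C₁ * H₁ = C₂' * H₂ → C₂ * H₂ = C₃' * H₃ → C₃ * H₃ = C₁' * H₁ →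
      H₁ = 0 := by
    intro C₁ C₂ C₃ C₁' C₂' C₃' d₁ d₂ d₃ H₁ H₂ H₃ n1 n2 n3 m1 m2 m3 e1 e2 e3 r1 r2 r3
    have p1 : C₁ * C₂ * C₃ * (d₁ * d₂ * d₃) = -(C₁' * C₂' * C₃') * (d₁ * d₂ * d₃) := by
      linear_combination (C₂ * d₂ * C₃ * d₃) * e1 - (C₁' * d₃ * C₃ * d₃) * e2 +
        (C₁' * d₃ * C₂' * d₁) * e3
    have p2 := mul_right_cancel₀ (mul_ne_zero (mul_ne_zero m1 m2) m3) p1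
    have p3 : C₁ * C₂ * C₃ * H₁ = C₁' * C₂' * C₃' * H₁ := by
      linear_combination (C₂ * C₃) * r1 + C₂' * C₃ * r2 + C₂' * C₃' * r3
    have p4 : 2 * (C₁' * C₂' * C₃') * H₁ = 0 := by
      rw [p2] at p3; linear_combination -p3
    have p5 : (2 * (C₁' * C₂' * C₃')) ≠ 0 :=
      mul_ne_zero h2 (mul_ne_zero (mul_ne_zero n1 n2) n3)
    exact (mul_eq_zero.1 p4).resolve_left p5
  rcases h.cases hA hB with ⟨i, j, a, b, q, e, hij, hab, haq, hae, hbq, hbe, hqe, rfl, rfl, rfl,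
    rfl⟩ | ⟨i, j, a, b, q, e, hij, hab, haq, hae, hbq, hbe, hqe, rfl, rfl, rfl, rfl⟩
  · have r1 := hl.exceptional_row (a := a) (q := q) (e := e) (b := b) hij hae hqe
    have r2 := hl.exceptional_row (a := q) (q := e) (e := a) (b := b) hij haq.symm hae.symm
    have r3 := hl.exceptional_row (a := e) (q := a) (e := q) (b := b) hij hqe.symm haq
    rw [Finset.pair_comm e a, Finset.pair_comm q a] at r2
    rw [Finset.pair_comm e q] at r3
    refine final _ _ _ (c (i, e) {j} {q}) (c (i, a) {j} {e}) (c (i, q) {j} {a}) (c (j, e) ∅ ∅)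
      (c (j, a) ∅ ∅) (c (j, q) ∅ ∅) _ _ _ ?_ ?_ ?_ ?_ ?_ ?_ (hsw i j q e hij hqe)
      (hsw i j e a hij hae.symm) (hsw i j a q hij haq) r1 r2 r3
    all_goals exact nz _ _ _ rfl (by simp [Blocked, hij, hae, haq.symm, hqe.symm])
  -- Commuting the two cells turns the sign rule for columns into one for rows.
  · have hsw' : ∀ x y : α, x ≠ y → c (x, i) {y} {j} * c (y, j) ∅ ∅ =
        - (c (y, i) {x} {j} * c (x, j) ∅ ∅) := by
      intro x y hxy
      rw [hsw x y i j hxy hij]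
      have := hc.comm (y, i) (x, j) ∅ ∅ rfl (by simp [Blocked]) (by simp [Blocked]) hxy.symm hij
      simp only [insert_empty_eq] at this
      linear_combination this
    have r1 := hl.exceptional_col (a := a) (q := q) (e := e) (b := b) hij hae hqe
    have r2 := hl.exceptional_col (a := q) (q := e) (e := a) (b := b) hij haq.symm hae.symm
    have r3 := hl.exceptional_col (a := e) (q := a) (e := q) (b := b) hij hqe.symm haq
    rw [Finset.pair_comm e a, Finset.pair_comm q a] at r2
    rw [Finset.pair_comm e q] at r3
    refine final _ _ _ (c (e, i) {q} {j}) (c (a, i) {e} {j}) (c (q, i) {a} {j}) (c (e, j) ∅ ∅)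
      (c (a, j) ∅ ∅) (c (q, j) ∅ ∅) _ _ _ ?_ ?_ ?_ ?_ ?_ ?_ (hsw' q e hqe)
      (hsw' e a hae.symm) (hsw' a q haq) r1 r2 r3
    all_goals exact nz _ _ _ rfl (by simp [Blocked, hij, hae, haq.symm, hqe.symm])

omit [DecidableEq α] in
/-- A function on ordered pairs of distinct elements of a set of four elements that does not
change when one entry is moved vanishes if it vanishes once. -/
theorem pair_function_eq_zero {Q : Finset β} (hQ : Q.card = 4) {H : β → β → k}
    (h1 : ∀ a ∈ Q, ∀ b ∈ Q, ∀ q ∈ Q, a ≠ b → q ≠ b → H a b = H q b)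
    (h2 : ∀ a ∈ Q, ∀ b ∈ Q, ∀ q ∈ Q, a ≠ b → a ≠ q → H a b = H a q)
    {a₀ b₀ : β} (ha₀ : a₀ ∈ Q) (hb₀ : b₀ ∈ Q) (hab₀ : a₀ ≠ b₀) (h0 : H a₀ b₀ = 0) {a b : β}
    (ha : a ∈ Q) (hb : b ∈ Q) (hab : a ≠ b) : H a b = 0 := by
  by_cases h : a = b₀
  -- Moving the entries directly could make them coincide, so a spare element is used for a detour.
  · obtain ⟨x, hx, hxa, hxb⟩ := Finset.exists_mem_ne_ne (R := Q) (by omega) a₀ b₀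
    subst h
    rw [h2 a ha b hb x hx hab hxb.symm, h1 a ha x hx a₀ ha₀ hxb.symm hxa.symm,
      h2 a₀ ha₀ x hx a ha hxa.symm hab₀, h0]
  · rw [h2 a ha b hb b₀ hb₀ hab h, h1 a ha b₀ hb₀ a₀ ha₀ h hab₀, h0]

end Exceptional

/-! ### Vanishing of second Betti numbers -/

section Resolution

variable {ι k : Type*} [Fintype ι] [DecidableEq ι] [Field k]
  {I : Ideal (MvPolynomial (ι × ι) k)}

namespace MinimalGradedFreeResolution

variable (F : MinimalGradedFreeResolution I)

omit [Fintype ι] [DecidableEq ι] in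
theorem rel_eq_relations {P : QuadricPresentation I (F.rank 1)}
    (hP : ∀ v, P.D v = 0 ↔ F.d 0 v = 0) (m : ℕ) : P.rel m = F.relations m := by
  ext v
  exact and_congr_left' (hP v)

theorem relations_le_of_exceptional (Φ : MinorSystem I) {p : ℕ} (hp : 1 ≤ p)
    (hexc : p = 1 → ∀ l, IsTwoCocycle Φ.sgn 1 l → ∀ s t A B, A.card = 2 → B.card = 2 →
      IsExceptional s t A B → l s t A B = 0) :
    F.relations (p + 1) ≤ F.decomposableRelations p := by
  obtain ⟨-, P, hP⟩ := F.exists_presentation Φ.isQuadratic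
  intro z hz
  by_contra hcon
  obtain ⟨θ, hθz, hθ⟩ := Submodule.exists_le_ker_of_notMem hcon
  refine hθz (P.functional_eq_zero Φ hp θ ?_ (fun h l hl _ => hexc h l hl) ?_)
  · intro s y hy
    rw [F.rel_eq_relations hP] at hy
    exact hθ (Submodule.subset_span ⟨s, y, hy, rfl⟩)
  · rwa [F.rel_eq_relations hP]

theorem betti_two_eq_zero (Φ : MinorSystem I) {j : ℤ} (h3 : j ≠ 3) (h4 : j ≠ 4) :
    F.betti 2 j = 0 := by
  rcases lt_or_ge j 3 with hj | hj
  · exact F.betti_two_eq_zero_of_lt Φ.isQuadratic hj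
  obtain ⟨p, rfl⟩ : ∃ p : ℕ, j = (p : ℤ) + 3 := ⟨(j - 3).toNat, by omega⟩
  -- Here `p ≥ 2`, so the condition on exceptional multidegrees, which concerns `p = 1`, is vacuous.
  exact F.betti_two_eq_zero_of_le Φ.isQuadratic
    (F.relations_le_of_exceptional Φ (by omega) fun h => by omega)

theorem betti_two_four_eq_zero (Φ : MinorSystem I) (h2 : (2 : k) ≠ 0)
    (hsw : ∀ i j q e, i ≠ j → q ≠ e → Φ.sgn (i, q) {j} {e} * Φ.sgn (j, e) ∅ ∅ =
      - (Φ.sgn (i, e) {j} {q} * Φ.sgn (j, q) ∅ ∅)) : F.betti 2 4 = 0 :=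
  F.betti_two_eq_zero_of_le Φ.isQuadratic (m := 1)
    (F.relations_le_of_exceptional Φ le_rfl fun _ _ hl _ _ _ _ hA hB h =>
      hl.exceptional_eq_zero Φ.isSignSystem h2 hsw hA hB h)

end MinimalGradedFreeResolution

end Resolution

/-! ### Exceptional multidegrees without signs -/

section Exceptional

variable {α β k : Type*} [DecidableEq α] [DecidableEq β] [Field k]
  {c : α × β → Finset α → Finset β → k} {l : α × β → α × β → Finset α → Finset β → k}

theorem Finset.erase_erase_of_four {a b q e : β} (haq : a ≠ q) (hae : a ≠ e)
    (hbq : b ≠ q) (hbe : b ≠ e) : (({a, b, q, e} : Finset β).erase a).erase b = {q, e} := by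
  ext x
  simp only [Finset.mem_erase, Finset.mem_insert, Finset.mem_singleton]
  constructor
  · rintro ⟨h1, h2, h3⟩; tauto
  · rintro (rfl | rfl)
    · exact ⟨hbq.symm, haq.symm, by tauto⟩
    · exact ⟨hbe.symm, hae.symm, by tauto⟩

theorem Finset.exists_eq_four {Q : Finset β} (hQ : Q.card = 4) {a b q : β} (ha : a ∈ Q)
    (hb : b ∈ Q) (hq : q ∈ Q) (hab : a ≠ b) (haq : a ≠ q) (hbq : b ≠ q) :
    ∃ e, e ≠ a ∧ e ≠ b ∧ e ≠ q ∧ Q = {a, b, q, e} := by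
  obtain ⟨e, he, h1, h2, h3⟩ := Finset.exists_mem_ne_ne_ne (R := Q) (by omega) a b q
  refine ⟨e, h1, h2, h3, (Finset.eq_of_subset_of_card_le ?_ ?_).symm⟩
  · intro x hx
    simp only [Finset.mem_insert, Finset.mem_singleton] at hx
    rcases hx with rfl | rfl | rfl | rfl <;> assumption
  · simp [Finset.card_insert_of_notMem, hab, haq, hbq, h1.symm, h2.symm, h3.symm, hQ]

/-- If exchanging two columns does not change signs, the values of a cocycle in an exceptional
multidegree are determined by one of them. -/
theorem IsTwoCocycle.exceptional_row_eq_zero (hl : IsTwoCocycle c 1 l)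
    (hc : ∀ u A B, A.card = B.card → ¬ Blocked u A B → c u A B = 1) {i j : α} (hij : i ≠ j)
    {Q : Finset β} (hQ : Q.card = 4) {a₀ b₀ : β} (ha₀ : a₀ ∈ Q) (hb₀ : b₀ ∈ Q) (hab₀ : a₀ ≠ b₀)
    (h0 : l (i, a₀) (j, b₀) {i, j} ((Q.erase a₀).erase b₀) = 0) {a b : β} (ha : a ∈ Q)
    (hb : b ∈ Q) (hab : a ≠ b) : l (i, a) (j, b) {i, j} ((Q.erase a).erase b) = 0 := by
  -- With all constants equal to 1, the column of the first cell moves freely; skew-symmetry later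
  -- gives the same for the second cell.
  have key : ∀ i j : α, i ≠ j → ∀ a ∈ Q, ∀ b ∈ Q, ∀ q ∈ Q, a ≠ b → q ≠ b →
      l (i, a) (j, b) {i, j} ((Q.erase a).erase b) =
        l (i, q) (j, b) {i, j} ((Q.erase q).erase b) := by
    intro i j hij a ha b hb q hq hab hqb
    by_cases haq : a = q
    · rw [haq]
    obtain ⟨e, h1, h2, h3, rfl⟩ := Finset.exists_eq_four hQ ha hb hq hab haq hqb.symm
    have h := hl.exceptional_row (a := a) (q := q) (e := e) (b := b) hij h1.symm h3.symm
    rw [hc _ _ _ rfl (by simp [Blocked, hij, h3.symm]),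
      hc _ _ _ rfl (by simp [Blocked, hij, h1.symm]), one_mul, one_mul] at h
    rw [Finset.erase_erase_of_four haq h1.symm hqb.symm h2.symm, h,
      show ({a, b, q, e} : Finset β) = {q, b, a, e} by ext x; simp; tauto,
      Finset.erase_erase_of_four (Ne.symm haq) h3.symm hab.symm h2.symm]
  refine pair_function_eq_zero hQ
    (H := fun a b => l (i, a) (j, b) {i, j} ((Q.erase a).erase b)) (key i j hij) ?_ ha₀ hb₀ hab₀ h0
    ha hb hab
  intro a ha b hb q hq hab haq
  have h := key j i hij.symm b hb a ha q hq hab.symm haq.symm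
  rw [hl.skew (i, a), hl.skew (i, a), Finset.erase_right_comm, Finset.erase_right_comm (a := a),
    Finset.pair_comm i j, h]

theorem IsTwoCocycle.exceptional_col_eq_zero (hl : IsTwoCocycle c 1 l)
    (hc : ∀ u A B, A.card = B.card → ¬ Blocked u A B → c u A B = 1) {i j : β} (hij : i ≠ j)
    {Q : Finset α} (hQ : Q.card = 4) {a₀ b₀ : α} (ha₀ : a₀ ∈ Q) (hb₀ : b₀ ∈ Q) (hab₀ : a₀ ≠ b₀)
    (h0 : l (a₀, i) (b₀, j) ((Q.erase a₀).erase b₀) {i, j} = 0) {a b : α} (ha : a ∈ Q)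
    (hb : b ∈ Q) (hab : a ≠ b) : l (a, i) (b, j) ((Q.erase a).erase b) {i, j} = 0 := by
  have key : ∀ i j : β, i ≠ j → ∀ a ∈ Q, ∀ b ∈ Q, ∀ q ∈ Q, a ≠ b → q ≠ b →
      l (a, i) (b, j) ((Q.erase a).erase b) {i, j} =
        l (q, i) (b, j) ((Q.erase q).erase b) {i, j} := by
    intro i j hij a ha b hb q hq hab hqb
    by_cases haq : a = q
    · rw [haq]
    obtain ⟨e, h1, h2, h3, rfl⟩ := Finset.exists_eq_four hQ ha hb hq hab haq hqb.symm
    have h := hl.exceptional_col (a := a) (q := q) (e := e) (b := b) hij h1.symm h3.symm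
    rw [hc _ _ _ rfl (by simp [Blocked, hij, h3.symm]),
      hc _ _ _ rfl (by simp [Blocked, hij, h1.symm]), one_mul, one_mul] at h
    rw [Finset.erase_erase_of_four haq h1.symm hqb.symm h2.symm, h,
      show ({a, b, q, e} : Finset α) = {q, b, a, e} by ext x; simp; tauto,
      Finset.erase_erase_of_four (Ne.symm haq) h3.symm hab.symm h2.symm]
  refine pair_function_eq_zero hQ
    (H := fun a b => l (a, i) (b, j) ((Q.erase a).erase b) {i, j}) (key i j hij) ?_ ha₀ hb₀ hab₀ h0
    ha hb hab
  intro a ha b hb q hq hab haq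
  have h := key j i hij.symm b hb a ha q hq hab.symm haq.symm
  rw [hl.skew (a, i), hl.skew (a, i), Finset.erase_right_comm, Finset.erase_right_comm (a := a),
    Finset.pair_comm i j, h]

end Exceptional

/-! ### Multidegrees -/

section Multidegree

variable {ι k : Type*} [DecidableEq ι] [Field k]

/-- The indicator vector of a finite set. -/
def indicatorVector (A : Finset ι) : ι →₀ ℕ := ∑ x ∈ A, Finsupp.single x 1

theorem indicatorVector_apply (A : Finset ι) (x : ι) :
    indicatorVector A x = if x ∈ A then 1 else 0 := by
  simp [indicatorVector, Finsupp.finsetSum_apply, Finsupp.single_apply]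

theorem indicatorVector_injective {A B : Finset ι} (h : indicatorVector A = indicatorVector B) :
    A = B := by
  ext x
  have := DFunLike.congr_fun h x
  rw [indicatorVector_apply, indicatorVector_apply] at this
  by_cases h1 : x ∈ A <;> by_cases h2 : x ∈ B <;> simp_all

theorem indicatorVector_add_single {A : Finset ι} {x : ι} (hx : x ∈ A) :
    Finsupp.single x 1 + indicatorVector (A.erase x) = indicatorVector A :=
  Finset.add_sum_erase A (fun x => Finsupp.single x 1) hx

theorem indicatorVector_sub_single {A : Finset ι} {x : ι} (hx : x ∈ A) :
    indicatorVector A - Finsupp.single x 1 = indicatorVector (A.erase x) := by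
  rw [← indicatorVector_add_single hx, add_tsub_cancel_left]

/-- The sum of the coefficients of the monomials with given row and column degrees. -/
def multidegreeSum (k : Type*) [Field k] (a b : ι →₀ ℕ) : MvPolynomial (ι × ι) k →ₗ[k] k :=
  (basisMonomials (ι × ι) k).constr k fun m =>
    if m.mapDomain Prod.fst = a ∧ m.mapDomain Prod.snd = b then 1 else 0

theorem multidegreeSum_monomial (a b : ι →₀ ℕ) (m : ι × ι →₀ ℕ) :
    multidegreeSum k a b (monomial m 1) =
      if m.mapDomain Prod.fst = a ∧ m.mapDomain Prod.snd = b then 1 else 0 := by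
  have h : (monomial m 1 : MvPolynomial (ι × ι) k) = basisMonomials (ι × ι) k m := by
    rw [coe_basisMonomials]
  rw [multidegreeSum, h, Module.Basis.constr_basis]

theorem linearMap_ext_monomial {σ M : Type*} [AddCommGroup M] [Module k M]
    {f g : MvPolynomial σ k →ₗ[k] M} (h : ∀ m, f (monomial m 1) = g (monomial m 1)) : f = g :=
  (basisMonomials σ k).ext fun m => by rw [coe_basisMonomials]; exact h m

theorem multidegreeSum_X_mul (a b : ι →₀ ℕ) (s : ι × ι) (p : MvPolynomial (ι × ι) k) :
    multidegreeSum k a b (X s * p) = if a s.1 ≠ 0 ∧ b s.2 ≠ 0 then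
      multidegreeSum k (a - Finsupp.single s.1 1) (b - Finsupp.single s.2 1) p else 0 := by
  have hiff : ∀ (a m : ι →₀ ℕ) (x : ι), Finsupp.single x 1 + m = a ↔
      a x ≠ 0 ∧ m = a - Finsupp.single x 1 := by
    intro a m x
    constructor
    · rintro rfl; simp
    · rintro ⟨h, rfl⟩
      refine add_tsub_cancel_of_le ?_
      rw [Finsupp.single_le_iff]
      exact Nat.one_le_iff_ne_zero.2 h
  have hm : ∀ m, multidegreeSum k a b (X s * monomial m 1) = if a s.1 ≠ 0 ∧ b s.2 ≠ 0 then
      multidegreeSum k (a - Finsupp.single s.1 1) (b - Finsupp.single s.2 1) (monomial m 1)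
      else 0 := by
    intro m
    rw [X, monomial_mul, one_mul, multidegreeSum_monomial, multidegreeSum_monomial,
      Finsupp.mapDomain_add, Finsupp.mapDomain_add, Finsupp.mapDomain_single,
      Finsupp.mapDomain_single]
    simp only [hiff]
    split_ifs <;> first | rfl | tauto
  split_ifs with h
  · refine LinearMap.congr_fun (f := (multidegreeSum k a b).comp (LinearMap.mulLeft k (X s)))
      (linearMap_ext_monomial fun m => ?_) p
    exact (hm m).trans (if_pos h)
  · refine LinearMap.congr_fun (f := (multidegreeSum k a b).comp (LinearMap.mulLeft k (X s)))
      (g := 0) (linearMap_ext_monomial fun m => ?_) p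
    exact (hm m).trans (if_neg h)

/-- Without signs, variables act alike on both functionals, so induction on the polynomial
identifies them. Unlike `ev`, the coefficient sum also makes sense in multidegrees with repeated
lines, which the exceptional functionals require. -/
theorem MinorSystem.multidegreeSum_eq_ev {I : Ideal (MvPolynomial (ι × ι) k)} (Φ : MinorSystem I)
    (h1 : Φ.ev ∅ ∅ 1 = 1) (hsgn : ∀ u A B, A.card = B.card → ¬ Blocked u A B → Φ.sgn u A B = 1)
    (p : MvPolynomial (ι × ι) k) : ∀ A B : Finset ι, A.card = B.card →
      multidegreeSum k (indicatorVector A) (indicatorVector B) p = Φ.ev A B p := by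
  induction p using MvPolynomial.induction_on with
  | C c =>
    intro A B hAB
    have hC : (C c : MvPolynomial (ι × ι) k) = c • monomial 0 1 := by
      rw [smul_monomial, smul_eq_mul, mul_one]; rfl
    rw [hC, map_smul, map_smul, multidegreeSum_monomial]
    congr 1
    simp only [Finsupp.mapDomain_zero]
    by_cases hA : A = ∅
    · subst hA
      have hB : B = ∅ := by simpa using hAB.symm
      subst hB
      simpa [indicatorVector] using h1.symm
    · rw [if_neg]
      · refine (Φ.ev_homog A B _ 0 hAB (isHomogeneous_monomial _ (map_zero _)) ?_).symm
        intro h0; exact hA (Finset.card_eq_zero.1 h0.symm)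
      · rintro ⟨h0, -⟩
        refine hA (indicatorVector_injective ?_)
        rw [← h0]; simp [indicatorVector]
  | add p q hp hq =>
    intro A B hAB
    rw [map_add, map_add, hp A B hAB, hq A B hAB]
  | mul_X p s hp =>
    intro A B hAB
    rw [mul_comm, multidegreeSum_X_mul, indicatorVector_apply, indicatorVector_apply]
    by_cases hs : s.1 ∈ A ∧ s.2 ∈ B
    · have hc : (A.erase s.1).card = (B.erase s.2).card := by
        rw [Finset.card_erase_of_mem hs.1, Finset.card_erase_of_mem hs.2, hAB]
      rw [if_pos (by simp [hs]), Φ.ev_X_mul_eq s A B p hAB hs, hsgn _ _ _ hc (by simp [Blocked]),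
        one_mul, indicatorVector_sub_single hs.1, indicatorVector_sub_single hs.2, hp _ _ hc]
    · rw [Φ.ev_X_zero s A B p hAB (by tauto), if_neg]
      intro h
      refine hs ⟨?_, ?_⟩
      · by_contra h'; simp [h'] at h
      · by_contra h'; simp [h'] at h

theorem MinorSystem.X_mul_mon_mem {I : Ideal (MvPolynomial (ι × ι) k)} (Φ : MinorSystem I)
    {s : ι × ι} {A B : Finset ι} (hAB : A.card = B.card) (hs : Blocked s A B) :
    X s * Φ.mon A B ∈ I := by
  rw [Φ.mem_iff]
  intro A' B' h'
  by_cases hsA : s.1 ∈ A' ∧ s.2 ∈ B'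
  · rw [Φ.ev_X_mul_eq _ _ _ _ h' hsA, Φ.ev_mon A B _ _ hAB, if_neg, mul_zero]
    · rintro ⟨rfl, rfl⟩; simp [Blocked] at hs
    · rw [Finset.card_erase_of_mem hsA.1, Finset.card_erase_of_mem hsA.2, h']
  · exact Φ.ev_X_zero _ _ _ _ h' (by tauto)

omit [DecidableEq ι] in
theorem mapDomain_fst_permExponent [DecidableEq ι] (π : Equiv.Perm ι) (B : Finset ι) :
    (permExponent π B).mapDomain Prod.fst = indicatorVector (B.image π) := by
  rw [permExponent, Finsupp.mapDomain_finsetSum, indicatorVector,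
    Finset.sum_image fun x _ y _ h => π.injective h]
  exact Finset.sum_congr rfl fun i _ => Finsupp.mapDomain_single

omit [DecidableEq ι] in
theorem mapDomain_snd_permExponent (π : Equiv.Perm ι) (B : Finset ι) :
    (permExponent π B).mapDomain Prod.snd = indicatorVector B := by
  rw [permExponent, Finsupp.mapDomain_finsetSum, indicatorVector]
  exact Finset.sum_congr rfl fun i _ => Finsupp.mapDomain_single

end Multidegree

section Functional

variable {σ k : Type*} [Field k]

/-- A converse to the passage from functionals to compatible families: integrate each coordinate
separately against its generator. As the generators lie in `I`, compatibility is needed only on the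
quadrics of `I`. -/
theorem QuadricPresentation.exists_functional {I : Ideal (MvPolynomial σ k)} {r : ℕ}
    (P : QuadricPresentation I r) {ν : σ → MvPolynomial σ k →ₗ[k] k}
    (hν : ∀ s t, ∀ g ∈ I, g.IsHomogeneous 2 → ν s (X t * g) = ν t (X s * g)) :
    ∃ θ : (Fin r → MvPolynomial σ k) →ₗ[k] k, ∀ s y, (∀ b, (y b).IsHomogeneous 1) →
      θ ((X s : MvPolynomial σ k) • y) = ν s (P.D y) := by
  set g : Fin r → MvPolynomial σ k := fun b => P.D (Pi.single b 1) with hg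
  have key : ∀ b, ∃ κ : MvPolynomial σ k →ₗ[k] k, ∀ s p, p.IsHomogeneous (0 + 1) →
      κ (X s * p) = ((ν s).comp (LinearMap.mulRight k (g b))) p := by
    intro b
    refine exists_functional_of_symm fun s t w hw => ?_
    change ν s (X t * w * g b) = ν t (X s * w * g b)
    rw [mul_assoc, mul_assoc]
    refine hν s t _ (I.mul_mem_left _ (P.D_mem _)) ?_
    have := hw.mul (P.homog b)
    rwa [zero_add] at this
  choose κ hκ using key
  refine ⟨∑ b, (κ b).comp (LinearMap.proj b), fun s y hy => ?_⟩
  rw [LinearMap.sum_apply, P.D_apply, map_sum]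
  exact Finset.sum_congr rfl fun b _ => hκ b s (y b) (hy b)

end Functional

/-! ### Labels and degrees of exceptional multidegrees -/

section Exceptional

variable {ι k : Type*} [DecidableEq ι] [Field k]

/-- The cells `s`, `t` and the sets `A`, `B` have row degree `2` on `R` and column degree `1`
on `Q`. -/
def IsRowExceptional (R Q : Finset ι) (s t : ι × ι) (A B : Finset ι) : Prop :=
  ∃ i j a b, i ≠ j ∧ a ≠ b ∧ a ∈ Q ∧ b ∈ Q ∧ R = {i, j} ∧ s = (i, a) ∧ t = (j, b) ∧ A = {i, j} ∧
    B = (Q.erase a).erase b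

/-- The exceptional multidegree labelled by `x`: the sets `x.2.1`, `x.2.2` are sets of rows and
columns if `x.1` is true, and of columns and rows otherwise. -/
def HasExceptionalType (x : Bool × Finset ι × Finset ι) (s t : ι × ι) (A B : Finset ι) : Prop :=
  if x.1 then IsRowExceptional x.2.1 x.2.2 s t A B
  else IsRowExceptional x.2.1 x.2.2 s.swap t.swap B A

/-- The labels of the exceptional multidegrees. -/
abbrev ExceptionalIndex (ι : Type*) : Type _ :=
  {x : Bool × Finset ι × Finset ι // x.2.1.card = 2 ∧ x.2.2.card = 4}

omit [DecidableEq ι] in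
theorem card_exceptionalIndex [Fintype ι] : Fintype.card (ExceptionalIndex ι) =
    2 * (Fintype.card ι).choose 2 * (Fintype.card ι).choose 4 := by
  classical
  rw [Fintype.card_subtype]
  have : (Finset.univ.filter fun x : Bool × Finset ι × Finset ι => x.2.1.card = 2 ∧ x.2.2.card = 4)
      = Finset.univ ×ˢ (Finset.univ.powersetCard 2 ×ˢ Finset.univ.powersetCard 4) := by
    ext x; simp
  rw [this, Finset.card_product, Finset.card_product, Finset.card_powersetCard,
    Finset.card_powersetCard, Finset.card_univ, Finset.card_univ, Fintype.card_bool, mul_assoc]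

theorem IsExceptional.exists_type {s t : ι × ι} {A B : Finset ι} (hA : A.card = 2)
    (hB : B.card = 2) (h : IsExceptional s t A B) :
    ∃ x : ExceptionalIndex ι, HasExceptionalType x.1 s t A B := by
  have hcard : ∀ {i j a b q e : ι}, i ≠ j → a ≠ b → a ≠ q → a ≠ e → b ≠ q → b ≠ e → q ≠ e →
      ({i, j} : Finset ι).card = 2 ∧ ({a, b, q, e} : Finset ι).card = 4 := by
    intro i j a b q e hij hab haq hae hbq hbe hqe
    exact ⟨Finset.card_pair hij,
      by simp [Finset.card_insert_of_notMem, hab, haq, hae, hbq, hbe, hqe]⟩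
  rcases h.cases hA hB with ⟨i, j, a, b, q, e, hij, hab, haq, hae, hbq, hbe, hqe, rfl, rfl, rfl,
    rfl⟩ | ⟨i, j, a, b, q, e, hij, hab, haq, hae, hbq, hbe, hqe, rfl, rfl, rfl, rfl⟩
  · refine ⟨⟨(true, {i, j}, {a, b, q, e}), hcard hij hab haq hae hbq hbe hqe⟩, ?_⟩
    rw [HasExceptionalType, if_pos rfl]
    exact ⟨i, j, a, b, hij, hab, by simp, by simp, rfl, rfl, rfl, rfl,
      (Finset.erase_erase_of_four haq hae hbq hbe).symm⟩
  · refine ⟨⟨(false, {i, j}, {a, b, q, e}), hcard hij hab haq hae hbq hbe hqe⟩, ?_⟩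
    rw [HasExceptionalType, if_neg (by simp)]
    exact ⟨i, j, a, b, hij, hab, by simp, by simp, rfl, rfl, rfl, rfl,
      (Finset.erase_erase_of_four haq hae hbq hbe).symm⟩

theorem exists_isRowExceptional {R Q : Finset ι} (hR : R.card = 2) (hQ : Q.card = 4) :
    ∃ s t A B, IsRowExceptional R Q s t A B := by
  obtain ⟨i, j, hij, rfl⟩ := Finset.card_eq_two.1 hR
  obtain ⟨a, ha, b, hb, hab⟩ := Finset.one_lt_card.1 (show 1 < Q.card by omega)
  exact ⟨_, _, _, _, i, j, a, b, hij, hab, ha, hb, rfl, rfl, rfl, rfl, rfl⟩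

theorem ExceptionalIndex.exists_hasExceptionalType (x : ExceptionalIndex ι) :
    ∃ s t A B, HasExceptionalType x.1 s t A B := by
  obtain ⟨s, t, A, B, h⟩ := exists_isRowExceptional x.2.1 x.2.2
  obtain ⟨⟨b, R, Q⟩, hx⟩ := x
  cases b
  · exact ⟨s.swap, t.swap, B, A, by simpa [HasExceptionalType] using h⟩
  · exact ⟨s, t, A, B, by simpa [HasExceptionalType] using h⟩

theorem IsRowExceptional.card_eq {R Q : Finset ι} {s t : ι × ι} {A B : Finset ι}
    (hQ : Q.card = 4) (h : IsRowExceptional R Q s t A B) : A.card = 2 ∧ B.card = 2 := by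
  obtain ⟨i, j, a, b, hij, hab, ha, hb, -, -, -, rfl, rfl⟩ := h
  refine ⟨Finset.card_pair hij, ?_⟩
  rw [Finset.card_erase_of_mem (Finset.mem_erase.2 ⟨hab.symm, hb⟩), Finset.card_erase_of_mem ha, hQ]

theorem HasExceptionalType.card_eq {x : ExceptionalIndex ι} {s t : ι × ι} {A B : Finset ι}
    (h : HasExceptionalType x.1 s t A B) : A.card = 2 ∧ B.card = 2 := by
  rw [HasExceptionalType] at h
  split_ifs at h
  · exact h.card_eq x.2.2
  · exact (h.card_eq x.2.2).symm

theorem HasExceptionalType.isExceptional {x : Bool × Finset ι × Finset ι} {s t : ι × ι}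
    {A B : Finset ι} (h : HasExceptionalType x s t A B) : IsExceptional s t A B := by
  obtain ⟨s, s'⟩ := s
  obtain ⟨t, t'⟩ := t
  rw [HasExceptionalType] at h
  split_ifs at h
  all_goals
    obtain ⟨i, j, a, b, hij, hab, ha, hb, -, hs, ht, rfl, rfl⟩ := h
    simp only [Prod.swap_prod_mk, Prod.mk.injEq] at hs ht
    obtain ⟨rfl, rfl⟩ := hs
    obtain ⟨rfl, rfl⟩ := ht
    simp [IsExceptional, hij, hab]

theorem HasExceptionalType.blocked {x : Bool × Finset ι × Finset ι} {s t : ι × ι}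
    {A B : Finset ι} (h : HasExceptionalType x s t A B) : Blocked s A B ∧ Blocked t A B := by
  obtain ⟨-, -, ⟨rfl, -⟩ | ⟨rfl, -⟩⟩ := h.isExceptional <;> simp [Blocked]

/-- The row degree of an exceptional multidegree. -/
def exceptionalRow (x : Bool × Finset ι × Finset ι) : ι →₀ ℕ :=
  if x.1 then 2 • indicatorVector x.2.1 else indicatorVector x.2.2

/-- The column degree of an exceptional multidegree. -/
def exceptionalCol (x : Bool × Finset ι × Finset ι) : ι →₀ ℕ :=
  if x.1 then indicatorVector x.2.2 else 2 • indicatorVector x.2.1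

theorem IsRowExceptional.degree {R Q : Finset ι} {s t : ι × ι} {A B : Finset ι}
    (h : IsRowExceptional R Q s t A B) :
    Finsupp.single s.1 1 + (Finsupp.single t.1 1 + indicatorVector A) = 2 • indicatorVector R ∧
      Finsupp.single s.2 1 + (Finsupp.single t.2 1 + indicatorVector B) = indicatorVector Q := by
  obtain ⟨i, j, a, b, hij, hab, ha, hb, rfl, rfl, rfl, rfl, rfl⟩ := h
  constructor
  · rw [two_nsmul]
    conv_rhs => rw [indicatorVector, Finset.sum_pair hij]
    rw [indicatorVector, Finset.sum_pair hij, add_assoc]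
  · rw [indicatorVector_add_single (Finset.mem_erase.2 ⟨hab.symm, hb⟩),
      indicatorVector_add_single ha]

theorem HasExceptionalType.degree {x : Bool × Finset ι × Finset ι} {s t : ι × ι}
    {A B : Finset ι} (h : HasExceptionalType x s t A B) :
    Finsupp.single s.1 1 + (Finsupp.single t.1 1 + indicatorVector A) = exceptionalRow x ∧
      Finsupp.single s.2 1 + (Finsupp.single t.2 1 + indicatorVector B) = exceptionalCol x := by
  rw [HasExceptionalType] at h
  rw [exceptionalRow, exceptionalCol]
  split_ifs at h ⊢
  · exact h.degree
  · exact h.degree.symm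

theorem two_nsmul_indicatorVector_ne {R Q : Finset ι} (hQ : Q.card = 4) :
    2 • indicatorVector R ≠ indicatorVector Q := by
  intro h
  obtain ⟨a, ha⟩ : Q.Nonempty := Finset.card_pos.1 (by omega)
  have := DFunLike.congr_fun h a
  rw [Finsupp.smul_apply, indicatorVector_apply, indicatorVector_apply, if_pos ha] at this
  split_ifs at this
  all_goals simp at this

theorem ExceptionalIndex.ext_degree {x y : ExceptionalIndex ι}
    (h1 : exceptionalRow x.1 = exceptionalRow y.1) (h2 : exceptionalCol x.1 = exceptionalCol y.1) :
    x = y := by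
  have h2inj : ∀ {R R' : Finset ι}, 2 • indicatorVector R = 2 • indicatorVector R' → R = R' := by
    intro R R' h
    refine indicatorVector_injective (Finsupp.ext fun a => ?_)
    have := DFunLike.congr_fun h a
    simpa using this
  obtain ⟨⟨b, R, Q⟩, hR, hQ⟩ := x
  obtain ⟨⟨b', R', Q'⟩, hR', hQ'⟩ := y
  simp only [exceptionalRow, exceptionalCol] at h1 h2 hQ hQ'
  cases b <;> cases b' <;> simp only [if_true, Bool.false_eq_true, if_false] at h1 h2
  · obtain rfl := indicatorVector_injective h1
    obtain rfl := h2inj h2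
    rfl
  · exact absurd h1.symm (two_nsmul_indicatorVector_ne hQ)
  · exact absurd h1 (two_nsmul_indicatorVector_ne hQ')
  · obtain rfl := indicatorVector_injective h2
    obtain rfl := h2inj h1
    rfl

/-- If exchanging two rows or columns does not change signs, a cocycle is determined in an
exceptional multidegree by one value. -/
theorem HasExceptionalType.eq_zero {c l} (hl : IsTwoCocycle c (1 : ℕ) l)
    (hc : ∀ u A B, A.card = B.card → ¬ Blocked u A B → c u A B = (1 : k))
    {x : ExceptionalIndex ι} {s t s' t' : ι × ι} {A B A' B' : Finset ι}
    (h : HasExceptionalType x.1 s t A B) (h' : HasExceptionalType x.1 s' t' A' B')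
    (h0 : l s t A B = 0) : l s' t' A' B' = 0 := by
  obtain ⟨⟨c, R, Q⟩, hR, hQ⟩ := x
  obtain ⟨s, u⟩ := s
  obtain ⟨t, v⟩ := t
  obtain ⟨s', u'⟩ := s'
  obtain ⟨t', v'⟩ := t'
  have hpair : ∀ {i j i' j' : ι}, ({i, j} : Finset ι) = {i', j'} → i ≠ j → i' ≠ j' →
      (i' = i ∧ j' = j) ∨ (i' = j ∧ j' = i) := by
    intro i j i' j' h hij hij'
    have h1 : i' ∈ ({i, j} : Finset ι) := by simp [h]
    have h2 : j' ∈ ({i, j} : Finset ι) := by simp [h]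
    simp only [Finset.mem_insert, Finset.mem_singleton] at h1 h2
    rcases h1 with rfl | rfl <;> (rcases h2 with rfl | rfl <;> simp_all)
  cases c
  all_goals
    simp only [HasExceptionalType, Bool.false_eq_true, if_true, if_false] at h h'
    obtain ⟨i, j, a, b, hij, hab, ha, hb, rfl, hs, ht, rfl, rfl⟩ := h
    obtain ⟨i', j', a', b', hij', hab', ha', hb', hR', hs', ht', rfl, rfl⟩ := h'
    simp only [Prod.swap_prod_mk, Prod.mk.injEq] at hs ht hs' ht'
    obtain ⟨rfl, rfl⟩ := hs
    obtain ⟨rfl, rfl⟩ := ht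
    obtain ⟨rfl, rfl⟩ := hs'
    obtain ⟨rfl, rfl⟩ := ht'
    simp only at hQ
    rcases hpair hR' hij hij' with ⟨rfl, rfl⟩ | ⟨rfl, rfl⟩
  · exact hl.exceptional_col_eq_zero hc hij hQ ha hb hab h0 ha' hb' hab'
  · rw [hl.skew, Finset.erase_right_comm, Finset.pair_comm,
      hl.exceptional_col_eq_zero hc hij hQ ha hb hab h0 hb' ha' hab'.symm, neg_zero]
  · exact hl.exceptional_row_eq_zero hc hij hQ ha hb hab h0 ha' hb' hab'
  · rw [hl.skew, Finset.erase_right_comm, Finset.pair_comm,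
      hl.exceptional_row_eq_zero hc hij hQ ha hb hab h0 hb' ha' hab'.symm, neg_zero]

theorem two_nsmul_indicatorVector_sub {i j : ι} (hij : i ≠ j) :
    2 • indicatorVector {i, j} - Finsupp.single i 1 - Finsupp.single j 1 =
      indicatorVector {i, j} := by
  rw [two_nsmul]
  conv_lhs => enter [1, 1, 1]; rw [indicatorVector, Finset.sum_pair hij]
  rw [add_assoc, add_tsub_cancel_left, add_tsub_cancel_left]

/-- In an exceptional multidegree, the quadrics in `I` times two variables from different rows
(or columns) have coefficient sum zero. -/
theorem HasExceptionalType.exists_separating {I : Ideal (MvPolynomial (ι × ι) k)}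
    (Φ : MinorSystem I) (h1 : Φ.ev ∅ ∅ 1 = 1)
    (hsgn : ∀ u A B, A.card = B.card → ¬ Blocked u A B → Φ.sgn u A B = 1)
    {x : ExceptionalIndex ι} {s t : ι × ι} {A B : Finset ι} (h : HasExceptionalType x.1 s t A B) :
    ∃ C : ι × ι → Prop, C s ∧ ¬ C t ∧ ∀ u v, C u → ¬ C v → ∀ g ∈ I,
      multidegreeSum k (exceptionalRow x.1) (exceptionalCol x.1) (X u * (X v * g)) = 0 := by
  have hcard : ∀ {Q : Finset ι}, Q.card = 4 → ∀ {a b}, a ∈ Q → b ∈ Q.erase a →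
      ((Q.erase a).erase b).card = 2 := by
    intro Q hQ a b ha hb
    rw [Finset.card_erase_of_mem hb, Finset.card_erase_of_mem ha, hQ]
  have hmem : ∀ {Q : Finset ι} {a : ι}, indicatorVector Q a ≠ 0 → a ∈ Q := by
    intro Q a h
    by_contra h'
    exact h (by rw [indicatorVector_apply, if_neg h'])
  have hpair : ∀ {i j w : ι}, w ≠ i →
      (2 • indicatorVector {i, j} - Finsupp.single i 1 : ι →₀ ℕ) w ≠ 0 → w = j := by
    intro i j w hw h
    by_contra h'
    refine h ?_
    rw [Finsupp.tsub_apply, Finsupp.smul_apply, indicatorVector_apply, if_neg (by simp [hw, h'])]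
    simp
  obtain ⟨⟨c, R, Q⟩, hR, hQ⟩ := x
  simp only at hQ
  cases c
  · simp only [HasExceptionalType, Bool.false_eq_true, if_false] at h
    obtain ⟨i, j, a, b, hij, hab, ha, hb, rfl, hs, ht, -, -⟩ := h
    -- `C` selects one of the two doubled columns. If cells on different sides of `C` contribute,
    -- they use each doubled column once, and a squarefree multidegree remains for `g`. There the
    -- coefficient sum is a coordinate of `S / I`, which vanishes on `I`.
    refine ⟨fun u => u.2 = i, congrArg Prod.fst hs, ?_, ?_⟩
    · exact fun hti : t.2 = i => hij (hti.symm.trans (congrArg Prod.fst ht))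
    · intro u v hu hv g hg
      simp only [exceptionalRow, exceptionalCol, Bool.false_eq_true, if_false]
      rw [multidegreeSum_X_mul]
      split_ifs with hh
      swap
      · rfl
      rw [multidegreeSum_X_mul]
      split_ifs with hh'
      swap
      · rfl
      have m1 := hmem hh.1
      rw [indicatorVector_sub_single m1] at hh' ⊢
      have m2 := hmem hh'.1
      rw [hu] at hh' ⊢
      rw [indicatorVector_sub_single m2, hpair hv hh'.2, two_nsmul_indicatorVector_sub hij,
        Φ.multidegreeSum_eq_ev h1 hsgn _ _ _ ((hcard hQ m1 m2).trans (Finset.card_pair hij).symm)]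
      exact (Φ.mem_iff g).1 hg _ _ ((hcard hQ m1 m2).trans (Finset.card_pair hij).symm)
  · simp only [HasExceptionalType, if_true] at h
    obtain ⟨i, j, a, b, hij, hab, ha, hb, rfl, rfl, rfl, -, -⟩ := h
    refine ⟨fun u => u.1 = i, rfl, hij.symm, ?_⟩
    intro u v hu hv g hg
    simp only [exceptionalRow, exceptionalCol, if_true]
    rw [multidegreeSum_X_mul]
    split_ifs with hh
    swap
    · rfl
    rw [multidegreeSum_X_mul]
    split_ifs with hh'
    swap
    · rfl
    have m1 := hmem hh.2
    rw [indicatorVector_sub_single m1] at hh' ⊢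
    have m2 := hmem hh'.2
    rw [hu] at hh' ⊢
    rw [indicatorVector_sub_single m2, hpair hv hh'.1, two_nsmul_indicatorVector_sub hij,
      Φ.multidegreeSum_eq_ev h1 hsgn _ _ _ ((Finset.card_pair hij).trans (hcard hQ m1 m2).symm)]
    exact (Φ.mem_iff g).1 hg _ _ ((Finset.card_pair hij).trans (hcard hQ m1 m2).symm)

end Exceptional

/-! ### Counting new quadratic relations -/

section Count

/-- Duality with `z` makes `θ` a surjection from `W` onto `k^J` that kills `U`. By `hspan`, no
functional can separate `W` from `U` plus the span of `z`, so nothing else of `W` is killed. -/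
theorem finrank_quotient_eq_card {k V J : Type*} [Field k] [AddCommGroup V] [Module k V]
    [Fintype J] [DecidableEq J] {W U : Submodule k V} {z : J → V} (hz : ∀ x, z x ∈ W)
    {θ : J → V →ₗ[k] k} (hθ : ∀ x, ∀ u ∈ U, θ x u = 0)
    (hδ : ∀ x y, θ x (z y) = if x = y then 1 else 0)
    (hspan : ∀ f : V →ₗ[k] k, (∀ u ∈ U, f u = 0) → (∀ x, f (z x) = 0) → ∀ w ∈ W, f w = 0) :
    Module.finrank k (W ⧸ U.comap W.subtype) = Fintype.card J := by
  set T : W →ₗ[k] (J → k) := (LinearMap.pi θ).comp W.subtype with hT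
  have hTz : ∀ y, T ⟨z y, hz y⟩ = Pi.single y 1 := by
    intro y
    ext x
    change θ x (z y) = _
    rw [hδ, Pi.single_apply]
  have hker : LinearMap.ker T = U.comap W.subtype := by
    ext w
    rw [LinearMap.mem_ker, Submodule.mem_comap]
    constructor
    · intro hw
      have hw' : (w : V) ∈ U ⊔ Submodule.span k (Set.range z) := by
        by_contra hcon
        obtain ⟨f, hf, hf0⟩ := Submodule.exists_le_ker_of_notMem hcon
        exact hf (hspan f (fun u hu => hf0 (Submodule.mem_sup_left hu))
          (fun x => hf0 (Submodule.mem_sup_right (Submodule.subset_span ⟨x, rfl⟩))) w w.2)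
      obtain ⟨u, hu, v, hv, huv⟩ := Submodule.mem_sup.1 hw'
      obtain ⟨g, rfl⟩ := (Submodule.mem_span_range_iff_exists_fun k).1 hv
      have hg : ∀ x, g x = 0 := by
        intro x
        have h : θ x w = 0 := congrFun hw x
        rw [← huv, map_add, hθ x u hu, map_sum, zero_add] at h
        simpa [hδ] using h
      rw [Submodule.subtype_apply, ← huv]
      simpa [hg] using hu
    · intro hw
      ext x
      exact hθ x _ hw
  have hsurj : Function.Surjective T := by
    intro g
    refine ⟨∑ y, g y • ⟨z y, hz y⟩, ?_⟩
    rw [map_sum]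
    simp only [map_smul, hTz]
    rw [← pi_eq_sum_univ' g]
  rw [← hker, (T.quotKerEquivOfSurjective hsurj).finrank_eq, Module.finrank_fintype_fun_eq_card]

variable {ι k : Type*} [Fintype ι] [DecidableEq ι] [Field k]
  {I : Ideal (MvPolynomial (ι × ι) k)}

/-- Each label gives one class, represented by `X s • y - X t • y'`, where `y` and `y'` lift `X t`
and `X s` times a basis monomial of `S / I`. A functional supported on one side of the separating
set detects it, and multidegrees keep the labels apart. These classes span because one value of a
cocycle determines it in its exceptional multidegree. -/
theorem MinimalGradedFreeResolution.finrank_relations_two_eq (F : MinimalGradedFreeResolution I)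
    (Φ : MinorSystem I) (h1 : Φ.ev ∅ ∅ 1 = 1)
    (hsgn : ∀ u A B, A.card = B.card → ¬ Blocked u A B → Φ.sgn u A B = 1)
    (hmon : ∀ A B, A.card = B.card → ∃ m, Φ.mon A B = monomial m 1 ∧
      m.mapDomain Prod.fst = indicatorVector A ∧ m.mapDomain Prod.snd = indicatorVector B) :
    Module.finrank k (F.relations 2 ⧸ (F.decomposableRelations 1).comap (F.relations 2).subtype) =
      2 * (Fintype.card ι).choose 2 * (Fintype.card ι).choose 4 := by
  classical
  obtain ⟨-, P, hP⟩ := F.exists_presentation Φ.isQuadratic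
  rw [← card_exceptionalIndex]
  choose s t A B h using fun x : ExceptionalIndex ι => x.exists_hasExceptionalType
  choose C hCs hCt hC using fun x => (h x).exists_separating Φ h1 hsgn
  have hcard : ∀ x, (A x).card = (B x).card := fun x => (h x).card_eq.1.trans (h x).card_eq.2.symm
  have hlift : ∀ u x, Blocked u (A x) (B x) → ∃ y, P.D y = X u * Φ.mon (A x) (B x) ∧
      ∀ b, (y b).IsHomogeneous 1 := by
    intro u x hu
    refine P.exists_homogeneous_lift (Φ.X_mul_mon_mem (hcard x) hu) ?_
    have := (isHomogeneous_X k u).mul (Φ.mon_homog _ _ (hcard x))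
    rwa [(h x).card_eq.1] at this
  choose y hyD hy using fun x => hlift (t x) x (h x).blocked.2
  choose y' hyD' hy' using fun x => hlift (s x) x (h x).blocked.1
  have hν : ∀ x, ∃ θ : (Fin (F.rank 1) → MvPolynomial (ι × ι) k) →ₗ[k] k, ∀ u y,
      (∀ b, (y b).IsHomogeneous 1) → θ ((X u : MvPolynomial (ι × ι) k) • y) =
        if C x u then multidegreeSum k (exceptionalRow x.1) (exceptionalCol x.1) (X u * P.D y)
        else 0 := by
    intro x
    -- Cutting the coefficient sum off outside `C x` keeps the family compatible on `I`: the mixed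
    -- terms vanish by separation. Without the cut-off, the functional would kill every relation.
    obtain ⟨θ, hθ⟩ := P.exists_functional (ν := fun u => if C x u then
      (multidegreeSum k (exceptionalRow x.1) (exceptionalCol x.1)).comp (LinearMap.mulLeft k (X u))
      else 0) (by
        intro u v g hg _
        by_cases hu : C x u <;> by_cases hv : C x v <;>
          simp only [hu, hv, if_true, if_false, LinearMap.comp_apply, LinearMap.mulLeft_apply,
            LinearMap.zero_apply]
        · rw [mul_left_comm]
        · exact hC x u v hu hv g hg
        · exact (hC x v u hv hu g hg).symm)
    refine ⟨θ, fun u y hy => ?_⟩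
    rw [hθ u y hy]
    split_ifs <;> rfl
  choose θ hθ using hν
  have hms : ∀ x x', multidegreeSum k (exceptionalRow x.1) (exceptionalCol x.1)
      (X (s x') * (X (t x') * Φ.mon (A x') (B x'))) = if x = x' then 1 else 0 := by
    intro x x'
    obtain ⟨m, hm, hm1, hm2⟩ := hmon _ _ (hcard x')
    rw [hm, X, X, monomial_mul, monomial_mul, one_mul, one_mul, multidegreeSum_monomial]
    simp only [Finsupp.mapDomain_add, Finsupp.mapDomain_single, hm1, hm2]
    rw [(h x').degree.1, (h x').degree.2]
    congr 1
    rw [eq_iff_iff]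
    refine ⟨fun hh => (ExceptionalIndex.ext_degree hh.1 hh.2).symm, ?_⟩
    rintro rfl
    exact ⟨rfl, rfl⟩
  refine finrank_quotient_eq_card
    (z := fun x => (X (s x) : MvPolynomial (ι × ι) k) • y x -
      (X (t x) : MvPolynomial (ι × ι) k) • y' x) (θ := θ) ?_ ?_ ?_ ?_
  · intro x
    refine ⟨(hP _).1 ?_, fun b => ?_⟩
    · rw [map_sub, map_smul, map_smul, hyD, hyD', smul_eq_mul, smul_eq_mul, mul_left_comm, sub_self]
    · exact ((isHomogeneous_X k _).mul (hy x b)).sub ((isHomogeneous_X k _).mul (hy' x b))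
  · intro x u hu
    induction hu using Submodule.span_induction with
    | mem u hu =>
      obtain ⟨v, w, hw, rfl⟩ := hu
      rw [hθ x v w hw.2, (hP w).2 hw.1, mul_zero, map_zero, ite_self]
    | zero => exact map_zero _
    | add u v _ _ hu hv => rw [map_add, hu, hv, add_zero]
    | smul a u _ hu => rw [map_smul, hu, smul_zero]
  · intro x x'
    rw [map_sub, hθ x _ _ (hy x'), hθ x _ _ (hy' x'), hyD, hyD', mul_left_comm (X (t x')), hms]
    by_cases hxx : x = x'
    · subst hxx
      simp [hCs, hCt]
    · simp [hxx]
  · intro f hf hfz w hw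
    refine P.functional_eq_zero Φ le_rfl f ?_ ?_ (z := w) ?_
    · intro u v hv
      rw [F.rel_eq_relations hP] at hv
      exact hf _ (Submodule.subset_span ⟨u, v, hv, rfl⟩)
    · intro _ l hl hval s' t' A' B' hA' hB' hexc
      obtain ⟨x, hx⟩ := hexc.exists_type hA' hB'
      refine (h x).eq_zero hl hsgn hx ?_
      rw [hval _ _ _ _ (h x).card_eq.1 (h x).card_eq.2 (h x).isExceptional _ _ (hy x) (hy' x)
        (hyD x) (hyD' x)]
      exact hfz x
    · rwa [F.rel_eq_relations hP]

theorem MinimalGradedFreeResolution.betti_two_four_eq (F : MinimalGradedFreeResolution I)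
    (Φ : MinorSystem I) (h1 : Φ.ev ∅ ∅ 1 = 1)
    (hsgn : ∀ u A B, A.card = B.card → ¬ Blocked u A B → Φ.sgn u A B = 1)
    (hmon : ∀ A B, A.card = B.card → ∃ m, Φ.mon A B = monomial m 1 ∧
      m.mapDomain Prod.fst = indicatorVector A ∧ m.mapDomain Prod.snd = indicatorVector B) :
    F.betti 2 4 = 2 * (Fintype.card ι).choose 2 * (Fintype.card ι).choose 4 := by
  rw [← F.finrank_relations_two Φ.isQuadratic, quadraticFromLinear_eq,
    F.finrank_relations_two_eq Φ h1 hsgn hmon]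

end Count

/-! ### Dimensions of graded pieces -/

section Dimension

variable {σ k : Type*} [Field k]

theorem homogeneousSubmodule_eq_restrictSupport (d : ℕ) :
    homogeneousSubmodule σ k d = restrictSupport k {m : σ →₀ ℕ | m.degree = d} :=
  homogeneousSubmodule_eq_finsupp_supported σ k d

theorem finrank_homogeneousSubmodule [Fintype σ] (d : ℕ) :
    Module.finrank k (homogeneousSubmodule σ k d) = (Fintype.card σ + d - 1).choose d := by
  classical
  rw [homogeneousSubmodule_eq_restrictSupport,
    Module.finrank_eq_nat_card_basis (basisRestrictSupport k _)]
  have : {m : σ →₀ ℕ | m.degree = d} = (Finset.univ.finsuppAntidiag d : Finset (σ →₀ ℕ)) := by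
    ext m
    simp [Finsupp.degree_eq_sum]
  rw [this, Nat.card_coe_set_eq, Set.ncard_coe_finset, Finset.card_finsuppAntidiag_nat_eq_choose,
    Finset.card_univ]

instance finite_homogeneousSubmodule [Finite σ] (d : ℕ) :
    Module.Finite k (homogeneousSubmodule σ k d) :=
  Module.Finite.iff_fg.2 (homogeneousSubmodule_fg σ k d)

/-- Vectors with homogeneous entries are families of homogeneous polynomials. -/
def homogeneousVectorsEquiv (r m : ℕ) :
    homogeneousVectors σ k r m ≃ₗ[k] (Fin r → homogeneousSubmodule σ k m) where
  toFun v b := ⟨v.1 b, mem_homogeneousVectors.1 v.2 b⟩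
  invFun w := ⟨fun b => w b, mem_homogeneousVectors.2 fun b => (w b).2⟩
  map_add' _ _ := rfl
  map_smul' _ _ := rfl
  left_inv _ := rfl
  right_inv _ := rfl

instance finite_homogeneousVectors [Finite σ] (r m : ℕ) :
    Module.Finite k (homogeneousVectors σ k r m) :=
  Module.Finite.equiv (homogeneousVectorsEquiv r m).symm

theorem finrank_homogeneousVectors [Finite σ] (r m : ℕ) :
    Module.finrank k (homogeneousVectors σ k r m) =
      r * Module.finrank k (homogeneousSubmodule σ k m) := by
  rw [(homogeneousVectorsEquiv r m).finrank_eq, Module.finrank_pi_fintype]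
  simp

/-- The forms of degree `d` in the ideal `I`. -/
def idealPart (I : Ideal (MvPolynomial σ k)) (d : ℕ) : Submodule k (MvPolynomial σ k) :=
  I.restrictScalars k ⊓ homogeneousSubmodule σ k d

variable {I : Ideal (MvPolynomial σ k)}

theorem mem_idealPart {d : ℕ} {p : MvPolynomial σ k} :
    p ∈ idealPart I d ↔ p ∈ I ∧ p.IsHomogeneous d := Iff.rfl

theorem QuadricPresentation.finrank_rel_add [Finite σ] {r : ℕ} (P : QuadricPresentation I r)
    (m : ℕ) : Module.finrank k (idealPart I (m + 2)) + Module.finrank k (P.rel m) =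
      r * Module.finrank k (homogeneousSubmodule σ k m) := by
  set T : homogeneousVectors σ k r m →ₗ[k] MvPolynomial σ k :=
    (P.D.restrictScalars k).comp (homogeneousVectors σ k r m).subtype with hT
  have hrange : LinearMap.range T = idealPart I (m + 2) := by
    ext p
    rw [LinearMap.mem_range, mem_idealPart]
    constructor
    · rintro ⟨v, rfl⟩
      exact ⟨P.D_mem _, P.D_isHomogeneous (mem_homogeneousVectors.1 v.2)⟩
    · rintro ⟨hp, hpm⟩
      obtain ⟨v, hv, hvh⟩ := P.exists_homogeneous_lift hp hpm
      exact ⟨⟨v, mem_homogeneousVectors.2 hvh⟩, hv⟩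
  have hker : (LinearMap.ker T).map (homogeneousVectors σ k r m).subtype = P.rel m := by
    ext v
    rw [Submodule.mem_map]
    constructor
    · rintro ⟨w, hw, rfl⟩
      exact ⟨hw, mem_homogeneousVectors.1 w.2⟩
    · intro hv
      exact ⟨⟨v, mem_homogeneousVectors.2 hv.2⟩, hv.1, rfl⟩
  rw [← finrank_homogeneousVectors, ← T.finrank_range_add_finrank_ker, hrange, ← hker,
    Submodule.finrank_map_subtype_eq]

end Dimension

/-! ### The Hilbert function and the linear relations -/

section MinorSystem

variable {ι k : Type*} [Fintype ι] [DecidableEq ι] [Field k]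
  {I : Ideal (MvPolynomial (ι × ι) k)}

theorem MinorSystem.finrank_idealPart_add (Φ : MinorSystem I) (d : ℕ) :
    (Fintype.card ι).choose d ^ 2 + Module.finrank k (idealPart I d) =
      (Fintype.card ι ^ 2 + d - 1).choose d := by
  set T : homogeneousSubmodule (ι × ι) k d →ₗ[k] (minorIndex ι d → k) :=
    (LinearMap.pi fun x : minorIndex ι d => Φ.ev x.1.1 x.1.2).comp
      (homogeneousSubmodule (ι × ι) k d).subtype with hT
  have hT_apply : ∀ p x, T p x = Φ.ev x.1.1 x.1.2 p := fun _ _ => rfl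
  have hsurj : LinearMap.range T = ⊤ := by
    rw [LinearMap.range_eq_top]
    intro g
    set g' : Finset ι → Finset ι → k := fun A B =>
      if h : (A, B) ∈ minorIndex ι d then g ⟨(A, B), h⟩ else 0 with hg'
    refine ⟨⟨_, Φ.sum_mon_isHomogeneous g' d⟩, ?_⟩
    ext ⟨⟨A, B⟩, hx⟩
    have hc := mem_minorIndex.1 hx
    rw [hT_apply, Φ.ev_sum_mon g' A B (hc.1.trans hc.2.symm), if_pos hc.1, hg']
    simp only [hx, dif_pos]
  have hker : (LinearMap.ker T).map (homogeneousSubmodule (ι × ι) k d).subtype = idealPart I d := by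
    ext p
    rw [Submodule.mem_map, mem_idealPart]
    constructor
    · rintro ⟨q, hq, rfl⟩
      refine ⟨Φ.mem_of_ev q.2 fun A B hA hB => ?_, q.2⟩
      exact congrFun hq ⟨(A, B), mem_minorIndex.2 ⟨hA, hB⟩⟩
    · rintro ⟨hp, hpd⟩
      refine ⟨⟨p, hpd⟩, ?_, rfl⟩
      ext ⟨⟨A, B⟩, hx⟩
      have hc := mem_minorIndex.1 hx
      exact (Φ.mem_iff p).1 hp A B (hc.1.trans hc.2.symm)
  have h := T.finrank_range_add_finrank_ker
  rw [← Submodule.finrank_map_subtype_eq, hker, hsurj, finrank_top,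
    Module.finrank_fintype_fun_eq_card, finrank_homogeneousSubmodule, Fintype.card_coe, minorIndex,
    Finset.card_product, Finset.card_powersetCard, Finset.card_univ, Fintype.card_prod] at h
  rw [pow_two, pow_two, h]

theorem Nat.cast_choose_three (n : ℕ) : (n.choose 3 : ℚ) = n * (n - 1) * (n - 2) / 6 := by
  induction n with
  | zero => simp
  | succ n ih =>
    rw [Nat.choose_succ_succ, Nat.cast_add, ih, Nat.cast_choose_two, Nat.cast_add_one]
    ring

theorem Nat.cast_choose_four (n : ℕ) :
    (n.choose 4 : ℚ) = n * (n - 1) * (n - 2) * (n - 3) / 24 := by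
  induction n with
  | zero => simp
  | succ n ih =>
    rw [Nat.choose_succ_succ, Nat.cast_add, ih, Nat.cast_choose_three, Nat.cast_add_one]
    ring

/-- There are no relations with constant coefficients, so the generators number `dim I_2`, and
rank–nullity in degree three reads `dim I_3 + β_{2,3} = n² dim I_2`. Both dimensions come from the
Hilbert function, whatever the signs. -/
theorem MinimalGradedFreeResolution.betti_two_three_eq (F : MinimalGradedFreeResolution I)
    (Φ : MinorSystem I) : F.betti 2 3 =
      4 * (Fintype.card ι + 1).choose 3 * (Fintype.card ι + 2).choose 3 := by
  obtain ⟨-, P, hP⟩ := F.exists_presentation Φ.isQuadratic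
  have e0 := P.finrank_rel_add 0
  have e1 := P.finrank_rel_add 1
  have e2 := Φ.finrank_idealPart_add 2
  have e3 := Φ.finrank_idealPart_add 3
  rw [F.rel_eq_relations hP, finrank_homogeneousSubmodule] at e0 e1
  rw [F.relations_zero_eq_bot, finrank_bot, Nat.choose_zero_right] at e0
  rw [F.finrank_relations_one Φ.isQuadratic, Fintype.card_prod, ← sq, Nat.add_sub_cancel,
    Nat.choose_one_right] at e1
  simp only [add_zero, mul_one, Nat.reduceAdd] at e0 e1
  rw [show Fintype.card ι ^ 2 + 2 - 1 = Fintype.card ι ^ 2 + 1 by omega] at e2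
  rw [show Fintype.card ι ^ 2 + 3 - 1 = Fintype.card ι ^ 2 + 2 by omega] at e3
  set n := Fintype.card ι
  rw [← e0] at e1
  have f1 : (Module.finrank k (idealPart I 3) : ℚ) + F.betti 2 3 =
    Module.finrank k (idealPart I 2) * (n : ℚ) ^ 2 := by exact_mod_cast e1
  have f2 := congrArg (Nat.cast : ℕ → ℚ) e2
  have f3 := congrArg (Nat.cast : ℕ → ℚ) e3
  push_cast [Nat.cast_choose_two, Nat.cast_choose_three] at f2 f3
  have : (F.betti 2 3 : ℚ) = ((4 * (n + 1).choose 3 * (n + 2).choose 3 : ℕ) : ℚ) := by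
    push_cast [Nat.cast_choose_three]
    linear_combination f1 - f3 + (n : ℚ) ^ 2 * f2
  exact_mod_cast this

end MinorSystem

/-! ### The permanent and the determinant as immanants -/

section Generic

theorem monomial_permExponent_univ {ι k : Type*} [Fintype ι] [DecidableEq ι] [Field k]
    (τ : Equiv.Perm ι) :
    (monomial (permExponent τ Finset.univ) 1 : MvPolynomial (ι × ι) k) = ∏ i, X (τ i, i) := by
  rw [permExponent, monomial_sum_one]
  rfl

theorem genericPerm_eq_immanant (k : Type*) [Field k] (n : ℕ) :
    genericPerm k n = immanant (1 : Equiv.Perm (Fin n) →* ℤˣ) k := by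
  rw [genericPerm, Matrix.permanent, immanant]
  refine Finset.sum_congr rfl fun τ _ => ?_
  simp only [MonoidHom.one_apply, Units.val_one, Int.cast_one, monomial_permExponent_univ,
    Matrix.mvPolynomialX_apply]

theorem genericDet_eq_immanant (k : Type*) [Field k] (n : ℕ) :
    genericDet k n = immanant Equiv.Perm.sign k := by
  rw [genericDet, Matrix.det_apply, immanant]
  refine Finset.sum_congr rfl fun τ _ => ?_
  rw [← mul_one (((Equiv.Perm.sign τ : ℤˣ) : ℤ) : k), ← smul_eq_mul, ← smul_monomial,
    monomial_permExponent_univ]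
  simp only [Matrix.mvPolynomialX_apply]
  rw [Units.smul_def, Int.cast_smul_eq_zsmul]

end Generic

end

theorem mainTheorem7 (k : Type*) [Field k] (n : ℕ) :
    (Nonempty (MinimalGradedFreeResolution (apolarIdeal (genericPerm k n))) ∧
      ∀ F : MinimalGradedFreeResolution (apolarIdeal (genericPerm k n)),
        (Module.finrank k (F.relations 1) = F.betti 2 3 ∧
          F.betti 2 3 = 4 * (n + 1).choose 3 * (n + 2).choose 3 ∧
          (F.betti 2 3 : ℚ) = 1 / 9 * (n : ℚ) ^ 2 * (n + 1) ^ 2 * (n - 1) * (n + 2)) ∧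
        (Module.finrank k (F.relations 2 ⧸ F.quadraticFromLinear) = F.betti 2 4 ∧
          F.betti 2 4 = 2 * n.choose 2 * n.choose 4 ∧
          (F.betti 2 4 : ℚ) = 1 / 24 * (n : ℚ) ^ 2 * (n - 1) ^ 2 * (n - 2) * (n - 3)) ∧
        ∀ j : ℤ, j ≠ 3 → j ≠ 4 → F.betti 2 j = 0) ∧
    (Nonempty (MinimalGradedFreeResolution (apolarIdeal (genericDet k n))) ∧
      (ringChar k ≠ 2 →
        ∀ F : MinimalGradedFreeResolution (apolarIdeal (genericDet k n)),
          ∀ j : ℤ, j ≠ 3 → F.betti 2 j = 0)) := by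
  rw [genericPerm_eq_immanant, genericDet_eq_immanant]
  refine ⟨?_, ?_⟩
  · set Φ := immanantMinorSystem (k := k) (1 : Equiv.Perm (Fin n) →* ℤˣ)
    refine ⟨Φ.isQuadratic.nonempty_resolution, fun F => ?_⟩
    have h3 := F.betti_two_three_eq Φ
    have h4 := F.betti_two_four_eq Φ (immanantMinorSystem_ev_empty 1)
      (fun _ _ _ h hb => immanantMinorSystem_sgn_one h hb)
      fun A B h => ⟨_, rfl, by rw [mapDomain_fst_permExponent, image_minorPerm h],
        mapDomain_snd_permExponent _ _⟩
    rw [Fintype.card_fin] at h3 h4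
    refine ⟨⟨F.finrank_relations_one Φ.isQuadratic, h3, ?_⟩,
      ⟨F.finrank_relations_two Φ.isQuadratic, h4, ?_⟩, fun j hj hj' => F.betti_two_eq_zero Φ hj hj'⟩
    · rw [h3]
      push_cast [Nat.cast_choose_three]
      ring
    · rw [h4]
      push_cast [Nat.cast_choose_two, Nat.cast_choose_four]
      ring
  · set Φ := immanantMinorSystem (k := k) (Equiv.Perm.sign : Equiv.Perm (Fin n) →* ℤˣ)
    refine ⟨Φ.isQuadratic.nonempty_resolution, fun hk F j hj => ?_⟩
    -- Only `j = 4` involves the characteristic: a transposition has sign `-1`, and 2 must be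
    -- invertible.
    by_cases hj' : j = 4
    · subst hj'
      refine F.betti_two_four_eq_zero Φ (Ring.two_ne_zero hk) fun i j q e hij hqe => ?_
      have := immanantMinorSystem_sgn_swap (k := k) Equiv.Perm.sign hij hqe
      rwa [Equiv.Perm.sign_swap hqe, Units.val_neg, Units.val_one, Int.cast_neg, Int.cast_one,
        neg_one_mul] at this
    · exact F.betti_two_eq_zero Φ hj hj'
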